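/- **Setting.** Let $\mathfrak g$ be a semisimple real Lie algebra of antihermitian complex $N\times N$ matrices, let $g\in\mathbb R$, and let $A_\mu$ ($\mu=1,2,3$) be $\mathfrak g$-valued gauge fields on Euclidean $\mathbb R^3$. Indices are raised and lowered with $\delta_{\mu\nu}$ and repeated indices are summed. Put $$F_{\mu\nu}=\partial_\mu A_\nu-\partial_\nu A_\mu+g[A_\mu,A_\nu],\qquad D_\mu=\partial_\mu+g[A_\mu,\cdot\,],$$ $$\mathcal S_{CS}(A)=\tfrac12\,\mathrm{tr}\!\int d^3x\,\varepsilon^{\mu\nu\rho}\big(A_\mu\partial_\nu A_\rho+\tfrac23 g A_\mu A_\nu A_\rho\big),\qquad \mathcal S_{YM}(A)=\tfrac1{4m}\,\mathrm{tr}\!\int d^3x\,F_{\mu\nu}F^{\mu\nu}.$$ A *Yang–Mills type action* is $\int d^3x\,P(A)$, where $P$ is a real polynomial without constant term in the components of $F_{\mu\nu}$ and its covariant derivatives $D_{\sigma_1}\cdots D_{\sigma_k}F_{\mu\nu}$ that is gauge invariant, i.e. invariant under the infinitesimal adjoint action of $\mathfrak g$ on all these variables. A *covariant local coefficient* is a $\mathfrak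 g$-valued polynomial in the same variables that is equivariant for the infinitesimal adjoint action of $\mathfrak g$. Mass dimension is counted with $F$ of dimension $2$, $D$ of dimension $1$ and $g$ of dimension $0$. The parameter $1/m$ is a formal variable: identities between actions are identities of formal power series in $1/m$, and they hold for all $A$ that are smooth and rapidly decreasing together with all their derivatives. **Statement.** 1. Let $\mathcal S_n(A)=\int d^3x\,P_n(A)$, $n\ge1$, be any Yang–Mills type actions. The integrals $\mathcal S_n(A)$ converge, and there are covariant local coefficients $\vartheta^n_\mu$, $n\ge 1$, such that, with $$\widehat A_\mu=A_\mu+\sum_{n\ge1}\frac1{m^n}\vartheta^n_\mu ,$$ one has $$\mathcal S_{CS}(A)+\sum_{n\ge1}\frac1{m^n}\mathcal S_n(A)=\mathcal S_{CS}(\widehat A),$$ where the integrals defining the coefficients of $\mathcal S_{CS}(\widehat A)$ converge. The field $\widehat A$ is a connection: under the infinitesimal gauge transformation $\delta A_\mu=D_\mu\omega$ one has $\delta\widehat A_\mu=\partial_\mu\omega+g[\widehat A_\mu,\omega]$. If moreover every $P_n$ has mass dimension $n+3$, then every $\vartheta^n_\mu$ can be taken of mass dimension $n+1$. (This includes $\mathcal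 S_{YM}$, $\int FD^2F$, $\int\varepsilon FDF$ and all their combinations with powers of $1/m$.) 2. For every $\lambda\in\mathbb R$ the action $\mathcal S_{YM}(A)+\mathcal S_{CS}(A)+\frac{\lambda}{2m^2}\,\mathrm{tr}\int d^3x\,\varepsilon^{\mu\nu\rho}F_{\mu\sigma}D_\nu F_\rho{}^{\sigma}$ equals $\mathcal S_{CS}(\widehat A)$ for a connection $\widehat A$ as in 1, with $\vartheta^n$ of mass dimension $n+1$ for all $n$ and $$\vartheta^1_\mu=\tfrac14\varepsilon_{\mu\sigma\tau}F^{\sigma\tau},\qquad \vartheta^2_\mu=\tfrac{1-4\lambda}8D^\sigma F_{\sigma\mu},\qquad \vartheta^3_\mu=-\tfrac{1-4\lambda}{16}\varepsilon_{\mu\sigma\tau}D^\sigma D_\rho F^{\rho\tau}+\tfrac g{48}\varepsilon_{\mu\sigma\tau}[F^{\sigma\rho},F_\rho{}^{\tau}].$$ 3. For every $\tau\in\mathbb R$ the action $\mathcal S_{YM}(A)+\mathcal S_{CS}(A)+\frac{\tau}{4m^3}\,\mathrm{tr}\int d^3x\,F^{\mu\nu}D^2F_{\mu\nu}$ equals $\mathcal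 S_{CS}(\widehat A)$ for a connection $\widehat A$ as in 1, with $\vartheta^n$ of mass dimension $n+1$ for all $n$ and $$\vartheta^1_\mu=\tfrac14\varepsilon_{\mu\sigma\tau}F^{\sigma\tau},\qquad \vartheta^2_\mu=\tfrac18D^\sigma F_{\sigma\mu},\qquad \vartheta^3_\mu=-\tfrac1{16}\varepsilon_{\mu\sigma\kappa}D^\sigma D_\rho F^{\rho\kappa}+\tfrac g{48}\varepsilon_{\mu\sigma\kappa}[F^{\sigma\rho},F_\rho{}^{\kappa}]+\tfrac\tau4\varepsilon_{\mu\nu\rho}D^2F^{\nu\rho}.$$ -/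

import Mathlib

open MeasureTheory
open scoped Matrix.Norms.Frobenius SchwartzMap ContDiff

attribute [local instance 100] LieRing.ofAssociativeRing

noncomputable section

namespace ChernSimons

/-- Flat Euclidean space-time of dimension three. -/
abbrev Space : Type := EuclideanSpace ℝ (Fin 3)

/-- The matrices in which the gauge Lie algebra is realised. -/
abbrev Mat (N : ℕ) : Type := Matrix (Fin N) (Fin N) ℂ

/-- Matrix valued fields; they form a ring under pointwise operations. -/
abbrev Field (N : ℕ) : Type := Space → Mat N

/-- Matrix valued fields with one space-time index, such as a gauge field `A_μ`. -/
abbrev VField (N : ℕ) : Type := Fin 3 → Field N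

variable {N : ℕ}

/-- The Levi-Civita symbol `ε_{μνρ}`, normalised by `ε_{012} = 1`. -/
def eps (μ ν ρ : Fin 3) : ℝ :=
  Matrix.det (Matrix.of fun i j : Fin 3 => if ![μ, ν, ρ] i = j then (1 : ℝ) else 0)

/-- The partial derivative `∂_μ f`. -/
def pd (μ : Fin 3) (f : Field N) : Field N :=
  fun x => fderiv ℝ f x (EuclideanSpace.single μ 1)

/-- The covariant derivative `D_μ f = ∂_μ f + g [A_μ, f]`. -/
def cov (g : ℝ) (A : VField N) (μ : Fin 3) (f : Field N) : Field N :=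
  fun x => pd μ f x + g • ⁅A μ x, f x⁆

/-- The field strength `F_{μν} = ∂_μ A_ν - ∂_ν A_μ + g [A_μ, A_ν]`. -/
def fieldStrength (g : ℝ) (A : VField N) (μ ν : Fin 3) : Field N :=
  fun x => pd μ (A ν) x - pd ν (A μ) x + g • ⁅A μ x, A ν x⁆

/-- The covariant Laplacian `D² f = D^σ D_σ f`. -/
def covLaplacian (g : ℝ) (A : VField N) (f : Field N) : Field N :=
  ∑ σ : Fin 3, cov g A σ (cov g A σ f)

/-! ### Local expressions built from the field strength and its covariant derivatives -/

/-- The index `([σ₁, …, σ_k], μ, ν)` stands for the variable `D_{σ₁} ⋯ D_{σ_k} F_{μν}`. -/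
abbrev JetIdx : Type := List (Fin 3) × Fin 3 × Fin 3

/-- The values at `x` of all the fields `D_{σ₁} ⋯ D_{σ_k} F_{μν}` of the gauge field `A`. -/
def jet (g : ℝ) (A : VField N) (x : Space) : JetIdx → Mat N :=
  fun j => j.1.foldr (cov g A) (fieldStrength g A j.2.1 j.2.2) x

/-- The real polynomial functions of the (matrix valued) variables `D_{σ₁} ⋯ D_{σ_k} F_{μν}`:
the algebra of functions generated by the real-linear functionals of the single variables.
Every element involves finitely many variables. -/
def polyFun (N : ℕ) : Subalgebra ℝ ((JetIdx → Mat N) → ℝ) :=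
  Algebra.adjoin ℝ (Set.range fun q : JetIdx × (Mat N →ₗ[ℝ] ℝ) =>
    fun v : JetIdx → Mat N => q.2 (v q.1))

/-- `P` is the Lagrangian of a Yang-Mills type action: a real polynomial, without constant term,
in the field strength and its covariant derivatives, which is gauge invariant. Each variable
`v = D_{σ₁} ⋯ D_{σ_k} F_{μν}` changes by `g [v, η]` under an infinitesimal gauge transformation,
so gauge invariance means invariance under the (simultaneous) infinitesimal adjoint action. -/
structure IsYMLagrangian (𝔤 : LieSubalgebra ℝ (Mat N)) (P : (JetIdx → Mat N) → ℝ) : Prop where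
  poly : P ∈ polyFun N
  map_zero : P 0 = 0
  invariant : ∀ ξ ∈ 𝔤, ∀ v : JetIdx → Mat N, (∀ j, v j ∈ 𝔤) →
    HasDerivAt (fun t : ℝ => P fun j => v j + t • ⁅v j, ξ⁆) 0 0

/-- `Θ` is a covariant local expression: a `𝔤`-valued polynomial in the field strength and its
covariant derivatives which is equivariant for the infinitesimal adjoint action. -/
structure IsCovariant (𝔤 : LieSubalgebra ℝ (Mat N)) (Θ : (JetIdx → Mat N) → Mat N) : Prop where
  poly : ∀ ℓ : Mat N →ₗ[ℝ] ℝ, (fun v => ℓ (Θ v)) ∈ polyFun N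
  mem : ∀ v : JetIdx → Mat N, (∀ j, v j ∈ 𝔤) → Θ v ∈ 𝔤
  equivariant : ∀ ξ ∈ 𝔤, ∀ v : JetIdx → Mat N, (∀ j, v j ∈ 𝔤) →
    HasDerivAt (fun t : ℝ => Θ fun j => v j + t • ⁅v j, ξ⁆) ⁅Θ v, ξ⁆ 0

/-- A local expression has mass dimension `d`, where `F` has mass dimension `2` and each
covariant derivative adds `1` (and `g` is dimensionless). -/
def HasMassDim {V : Type*} [SMul ℝ V] (𝔤 : LieSubalgebra ℝ (Mat N)) (d : ℕ)
    (Φ : (JetIdx → Mat N) → V) : Prop :=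
  ∀ v : JetIdx → Mat N, (∀ j, v j ∈ 𝔤) → ∀ s : ℝ,
    Φ (fun j => s ^ (j.1.length + 2) • v j) = s ^ d • Φ v

/-! ### Actions -/

/-- The Chern-Simons action
`½ tr ∫ d³x ε^{μνρ} (A_μ ∂_ν A_ρ + ⅔ g A_μ A_ν A_ρ)`. -/
def csAction (g : ℝ) (A : VField N) : ℂ :=
  (1 / 2 : ℂ) * ∫ x : Space, Matrix.trace (∑ μ, ∑ ν, ∑ ρ, eps μ ν ρ •
    (A μ x * pd ν (A ρ) x + (2 / 3 * g) • (A μ x * A ν x * A ρ x)))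

/-- `¼ tr ∫ d³x F_{μν} F^{μν}`. -/
def ymAction (g : ℝ) (A : VField N) : ℂ :=
  (1 / 4 : ℂ) * ∫ x : Space, Matrix.trace (∑ μ, ∑ ν,
    fieldStrength g A μ ν x * fieldStrength g A μ ν x)

/-- `½ tr ∫ d³x ε^{μνρ} F_{μσ} D_ν F_ρ^σ`. -/
def fdfAction (g : ℝ) (A : VField N) : ℂ :=
  (1 / 2 : ℂ) * ∫ x : Space, Matrix.trace (∑ μ, ∑ ν, ∑ ρ, ∑ σ, eps μ ν ρ •
    (fieldStrength g A μ σ x * cov g A ν (fieldStrength g A ρ σ) x))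

/-- `¼ tr ∫ d³x F^{μν} D² F_{μν}`. -/
def fddfAction (g : ℝ) (A : VField N) : ℂ :=
  (1 / 4 : ℂ) * ∫ x : Space, Matrix.trace (∑ μ, ∑ ν,
    fieldStrength g A μ ν x * covLaplacian g A (fieldStrength g A μ ν) x)

/-! ### Formal power series in `1/m`

The variable `X` of all formal power series below is `1/m`. -/

/-- `∂_μ`, coefficient by coefficient. -/
def pdSeries (μ : Fin 3) (f : PowerSeries (Field N)) : PowerSeries (Field N) :=
  PowerSeries.mk fun n => pd μ (PowerSeries.coeff n f)

/-- The field `ε^{μνρ} (Â_μ ∂_ν Â_ρ + ⅔ g Â_μ Â_ν Â_ρ)` of a formal power series of gauge fields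
`Â`, expanded in powers of `1/m`. -/
def csSeriesDensity (g : ℝ) (Ahat : Fin 3 → PowerSeries (Field N)) : PowerSeries (Field N) :=
  ∑ μ, ∑ ν, ∑ ρ, eps μ ν ρ •
    (Ahat μ * pdSeries ν (Ahat ρ) + (2 / 3 * g) • (Ahat μ * Ahat ν * Ahat ρ))

/-- The Chern-Simons action of a formal power series of gauge fields, as a formal power series. -/
def csSeries (g : ℝ) (Ahat : Fin 3 → PowerSeries (Field N)) : PowerSeries ℂ :=
  PowerSeries.mk fun n => (1 / 2 : ℂ) *
    ∫ x : Space, Matrix.trace (PowerSeries.coeff n (csSeriesDensity g Ahat) x)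

/-- The redefined gauge field `Â_μ = A_μ + ∑_{n ≥ 1} m^{-n} ϑ^n_μ`, where `ϑ^n_μ` is evaluated on
the field strength of `A` and its covariant derivatives. The entry `ϑ 0` is not used. -/
def redefinition (g : ℝ) (ϑ : ℕ → Fin 3 → (JetIdx → Mat N) → Mat N) (A : VField N)
    (μ : Fin 3) : PowerSeries (Field N) :=
  PowerSeries.mk fun n => if n = 0 then A μ else fun x => ϑ n μ (jet g A x)

/-- A field which is smooth and takes values in `𝔤`. -/
def IsSmoothField (𝔤 : LieSubalgebra ℝ (Mat N)) (f : Field N) : Prop :=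
  ContDiff ℝ ∞ f ∧ ∀ x, f x ∈ 𝔤

/-- The functional `A ↦ Â[A]` transforms as a connection: under the infinitesimal gauge
transformation `δA_μ = D_μ η` one has `δÂ_μ = ∂_μ η + g [Â_μ, η]`, order by order in `1/m`. -/
def TransformsAsConnection (𝔤 : LieSubalgebra ℝ (Mat N)) (g : ℝ)
    (Ahat : VField N → Fin 3 → PowerSeries (Field N)) : Prop :=
  ∀ (A : VField N) (η : Field N), (∀ μ, IsSmoothField 𝔤 (A μ)) → IsSmoothField 𝔤 η →
    ∀ (n : ℕ) (μ : Fin 3) (x : Space),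
      HasDerivAt
        (fun t : ℝ => PowerSeries.coeff n (Ahat (fun ν => A ν + t • cov g A ν η) μ) x)
        (PowerSeries.coeff n (PowerSeries.C (pd μ η) +
          g • (Ahat A μ * PowerSeries.C η - PowerSeries.C η * Ahat A μ)) x) 0

/-- The formal power series of actions `S` is the pure Chern-Simons action of the connection
`Â = A + ∑_{n ≥ 1} m^{-n} ϑ^n` with covariant local coefficients `ϑ^n`. The identity holds on all
`𝔤`-valued gauge fields that decrease rapidly together with all their derivatives. -/
structure IsPureChernSimons (𝔤 : LieSubalgebra ℝ (Mat N)) (g : ℝ)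
    (S : VField N → PowerSeries ℂ) (ϑ : ℕ → Fin 3 → (JetIdx → Mat N) → Mat N) : Prop where
  covariant : ∀ n, 1 ≤ n → ∀ μ, IsCovariant 𝔤 (ϑ n μ)
  connection : TransformsAsConnection 𝔤 g (redefinition g ϑ)
  integrable : ∀ A : Fin 3 → 𝓢(Space, Mat N), (∀ μ x, A μ x ∈ 𝔤) → ∀ n,
    Integrable fun x : Space => Matrix.trace
      (PowerSeries.coeff n (csSeriesDensity g (redefinition g ϑ fun μ => ⇑(A μ))) x)
  action_eq : ∀ A : Fin 3 → 𝓢(Space, Mat N), (∀ μ x, A μ x ∈ 𝔤) →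
    csSeries g (redefinition g ϑ fun μ => ⇑(A μ)) = S fun μ => ⇑(A μ)

/-- The formal power series `S_CS(A) + ∑_{n ≥ 1} m^{-n} ∫ d³x P_n(F, DF, …)`. -/
def ymTypeSeries (g : ℝ) (P : ℕ → (JetIdx → Mat N) → ℝ) (A : VField N) : PowerSeries ℂ :=
  PowerSeries.C (csAction g A) +
    PowerSeries.mk fun n => if n = 0 then 0 else ((∫ x : Space, P n (jet g A x) : ℝ) : ℂ)

end ChernSimons

end

noncomputable section

namespace ChernSimons

variable {N : ℕ}

/-! Write `Â = A + θ` with `θ = ∑_{n ≥ 1} m^{-n} ϑ^n`. Up to total derivatives and cyclic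
permutations under the trace, the Chern–Simons Lagrangian changes by `½ tr ε^{μνρ} θ_μ F_{νρ}` plus
`½ tr ε^{μνρ} θ_μ (D_ν θ_ρ + (g/3)[θ_ν, θ_ρ])` (`chernSimons_expansion`, `coeff_csSeries`). At order
`m^{-n}` the first term is linear in `ϑ^n`. The second is at least quadratic in a series without
constant term, so it involves only `ϑ^k` with `1 ≤ k < n` (`interactionLagrangian_congr`), and it is
itself of Yang–Mills type. The problem is therefore triangular: at each order one has to solve `∫ ½
tr ε ϑ^n F = ∫ R`, where `R` is `P_n` minus the known interaction.

This equation always has a covariant local solution (`exists_linearLagrangian`). Since `R` has no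
constant term, dividing its homogeneous component of degree `k` by `k` gives an invariant polynomial
`P` whose derivative along the Euler field is `R`. The trace form is definite on antihermitian
matrices, so `P` has gradients `Q_j` with values in `𝔤`; they are equivariant, and `R = ∑_j tr (Q_j
v_j)` (`exists_gradient`). Each `v_j` is some `D ⋯ D F`; integration by parts moves the derivatives
onto `Q_j` and leaves a factor `F_{μν}`, and contracting two Levi-Civita symbols turns the sum into
`½ tr ε θ F`. Mass dimensions are tracked along the way.

The jets are independent variables: `D_σ` becomes the linear vector field `shift σ`, a gauge
transformation the linear field `adj ξ`. These commute, so `D_σ` preserves covariance, and on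
covariant expressions it agrees with the actual covariant derivative (`cov_isCovariant_jet`).
Neither the Bianchi identity nor `[D, D] = g [F, ·]` is needed. Semisimplicity serves to make the
centre trivial, so that covariant expressions vanish at the zero jet and are rapidly decreasing on
gauge fields.

For the explicit coefficients, one checks that the prescribed `ϑ^1, ϑ^2, ϑ^3` solve the first three
equations and lets the recursion start after them. -/

/-- Values of all the variables `D_{σ₁} ⋯ D_{σ_k} F_{μν}`. -/
abbrev Jets (N : ℕ) : Type := JetIdx → Mat N

/-! ### Calculus with polynomial functions of the jets -/

/-- Directional derivative of a function of the jets. -/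
def dder {V : Type*} [NormedAddCommGroup V] [NormedSpace ℝ V] (Φ : Jets N → V)
    (v w : Jets N) : V :=
  deriv (fun t : ℝ => Φ (v + t • w)) 0

/-- A vector valued function of the jets which is polynomial. -/
def IsPoly {V : Type*} [AddCommGroup V] [Module ℝ V] (Φ : Jets N → V) : Prop :=
  ∀ ℓ : V →ₗ[ℝ] ℝ, (fun v => ℓ (Φ v)) ∈ polyFun N

lemma gen_mem_polyFun (j : JetIdx) (ℓ : Mat N →ₗ[ℝ] ℝ) :
    (fun v : Jets N => ℓ (v j)) ∈ polyFun N :=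
  Algebra.subset_adjoin ⟨(j, ℓ), rfl⟩

lemma const_mem_polyFun (c : ℝ) : (fun _ : Jets N => c) ∈ polyFun N :=
  (polyFun N).algebraMap_mem c

lemma polyFun_induction {C : (p : Jets N → ℝ) → p ∈ polyFun N → Prop}
    (gen : ∀ j (ℓ : Mat N →ₗ[ℝ] ℝ), C (fun v => ℓ (v j)) (gen_mem_polyFun j ℓ))
    (const : ∀ c, C (fun _ => c) (const_mem_polyFun c))
    (add : ∀ p q (hp : p ∈ polyFun N) (hq : q ∈ polyFun N), C p hp → C q hq →
      C (fun v => p v + q v) (add_mem hp hq))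
    (mul : ∀ p q (hp : p ∈ polyFun N) (hq : q ∈ polyFun N), C p hp → C q hq →
      C (fun v => p v * q v) (mul_mem hp hq))
    {p : Jets N → ℝ} (hp : p ∈ polyFun N) : C p hp := by
  refine Algebra.adjoin_induction (p := fun p hp => C p hp) ?_ const add mul hp
  rintro _ ⟨⟨j, ℓ⟩, rfl⟩
  exact gen j ℓ

/-- Curves in the space of jets all of whose components are differentiable. -/
def HasJetDerivAt (γ : ℝ → Jets N) (w : Jets N) (t : ℝ) : Prop :=
  ∀ j, HasDerivAt (fun s => γ s j) (w j) t

lemma hasJetDerivAt_line (v w : Jets N) (t : ℝ) :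
    HasJetDerivAt (fun s : ℝ => v + s • w) w t := fun j => by
  have h := ((hasDerivAt_id t).smul_const (w j)).const_add (v j)
  rwa [one_smul] at h

/-- There are infinitely many jet variables and the space of jets is not normed, so the Fréchet
derivative is replaced by a linear differential built along the generation of `polyFun`. The finite
set `S` records the variables on which the polynomial depends. -/
lemma exists_differential {p : Jets N → ℝ} (hp : p ∈ polyFun N) :
    ∃ d : Jets N → Jets N →ₗ[ℝ] ℝ,
      (∀ γ w t, HasJetDerivAt γ w t → HasDerivAt (fun s => p (γ s)) (d (γ t) w) t) ∧
      (∀ X : Jets N → Jets N, (∀ j, IsPoly fun v => X v j) →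
        (fun v => d v (X v)) ∈ polyFun N) ∧
      ∃ S : Finset JetIdx, ∀ v w, (∀ j ∈ S, w j = 0) → d v w = 0 := by
  classical
  induction hp using polyFun_induction with
  | gen j ℓ =>
    refine ⟨fun _ => ℓ ∘ₗ LinearMap.proj j, fun γ w t h => ?_, fun X hX => hX j ℓ,
      {j}, fun v w h => by simp [h j (by simp)]⟩
    exact (LinearMap.toContinuousLinearMap ℓ).hasFDerivAt.comp_hasDerivAt t (h j)
  | const c =>
    exact ⟨fun _ => 0, fun γ w t h => by simpa using hasDerivAt_const t c,
      fun X hX => const_mem_polyFun 0, ∅, fun v w h => rfl⟩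
  | add p q hp hq h1 h2 =>
    obtain ⟨d, a, b, S, c⟩ := h1
    obtain ⟨d', a', b', S', c'⟩ := h2
    refine ⟨fun v => d v + d' v, fun γ w t h => (a γ w t h).add (a' γ w t h),
      fun X hX => add_mem (b X hX) (b' X hX), S ∪ S', fun v w h => ?_⟩
    simp [c v w fun j hj => h j (by simp [hj]), c' v w fun j hj => h j (by simp [hj])]
  | mul p q hp hq h1 h2 =>
    obtain ⟨d, a, b, S, c⟩ := h1
    obtain ⟨d', a', b', S', c'⟩ := h2
    refine ⟨fun v => q v • d v + p v • d' v, fun γ w t h => ?_,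
      fun X hX => add_mem (mul_mem hq (b X hX)) (mul_mem hp (b' X hX)), S ∪ S', fun v w h => ?_⟩
    · refine ((a γ w t h).mul (a' γ w t h)).congr_deriv ?_
      simp [mul_comm]
    · simp [c v w fun j hj => h j (by simp [hj]), c' v w fun j hj => h j (by simp [hj])]

section Real

variable {p q : Jets N → ℝ}

lemma hasDerivAt_comp_curve (hp : p ∈ polyFun N) {γ : ℝ → Jets N} {w : Jets N} {t : ℝ}
    (h : HasJetDerivAt γ w t) : HasDerivAt (fun s => p (γ s)) (dder p (γ t) w) t := by
  obtain ⟨d, a, -⟩ := exists_differential hp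
  have := (a _ w 0 (hasJetDerivAt_line (γ t) w 0)).deriv
  rw [zero_smul, add_zero] at this
  rw [dder, this]
  exact a γ w t h

lemma exists_differential' (hp : p ∈ polyFun N) :
    ∃ d : Jets N → Jets N →ₗ[ℝ] ℝ, (∀ v w, dder p v w = d v w) ∧
      (∀ X : Jets N → Jets N, (∀ j, IsPoly fun v => X v j) →
        (fun v => d v (X v)) ∈ polyFun N) ∧
      ∃ S : Finset JetIdx, ∀ v w, (∀ j ∈ S, w j = 0) → d v w = 0 := by
  obtain ⟨d, a, b⟩ := exists_differential hp
  refine ⟨d, fun v w => ?_, b⟩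
  have := (a _ w 0 (hasJetDerivAt_line v w 0)).deriv
  rwa [zero_smul, add_zero] at this

lemma dder_add_right (hp : p ∈ polyFun N) (v w w' : Jets N) :
    dder p v (w + w') = dder p v w + dder p v w' := by
  obtain ⟨d, h, -⟩ := exists_differential' hp
  simp [h]

lemma dder_smul_right (hp : p ∈ polyFun N) (c : ℝ) (v w : Jets N) :
    dder p v (c • w) = c * dder p v w := by
  obtain ⟨d, h, -⟩ := exists_differential' hp
  simp [h]

lemma dder_mem_polyFun (hp : p ∈ polyFun N) {X : Jets N → Jets N}
    (hX : ∀ j, IsPoly fun v => X v j) : (fun v => dder p v (X v)) ∈ polyFun N := by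
  obtain ⟨d, h, h', -⟩ := exists_differential' hp
  simpa only [h] using h' X hX

lemma exists_dder_eq_sum (hp : p ∈ polyFun N) :
    ∃ S : Finset JetIdx, ∀ v w, dder p v w = ∑ j ∈ S, dder p v (Pi.single j (w j)) := by
  classical
  obtain ⟨d, h, -, S, hS⟩ := exists_differential' hp
  refine ⟨S, fun v w => ?_⟩
  simp only [h]
  rw [← map_sum, ← sub_eq_zero, ← map_sub]
  refine hS v _ fun j hj => ?_
  simp only [Pi.sub_apply, Finset.sum_apply]
  rw [Finset.sum_eq_single j (fun b _ hb => by simp [hb.symm]) (by simp [hj])]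
  simp

lemma dder_const (c : ℝ) (v w : Jets N) : dder (fun _ => c) v w = 0 := by simp [dder]

lemma dder_gen (j : JetIdx) (ℓ : Mat N →ₗ[ℝ] ℝ) (v w : Jets N) :
    dder (fun v => ℓ (v j)) v w = ℓ (w j) := by
  have : HasDerivAt (fun t : ℝ => ℓ (v j) + t * ℓ (w j)) (ℓ (w j)) 0 := by
    simpa using ((hasDerivAt_id (0 : ℝ)).mul_const (ℓ (w j))).const_add (ℓ (v j))
  rw [← this.deriv, dder]
  simp

lemma dder_add (hp : p ∈ polyFun N) (hq : q ∈ polyFun N) (v w : Jets N) :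
    dder (fun v => p v + q v) v w = dder p v w + dder q v w := by
  have h := hasJetDerivAt_line v w 0
  have := ((hasDerivAt_comp_curve hp h).add (hasDerivAt_comp_curve hq h)).deriv
  rwa [zero_smul, add_zero] at this

lemma dder_mul (hp : p ∈ polyFun N) (hq : q ∈ polyFun N) (v w : Jets N) :
    dder (fun v => p v * q v) v w = dder p v w * q v + p v * dder q v w := by
  have h := hasJetDerivAt_line v w 0
  have := ((hasDerivAt_comp_curve hp h).mul (hasDerivAt_comp_curve hq h)).deriv
  rwa [zero_smul, add_zero] at this

lemma dder_mul_add_mul {r s : Jets N → ℝ} (hp : p ∈ polyFun N) (hq : q ∈ polyFun N)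
    (hr : r ∈ polyFun N) (hs : s ∈ polyFun N) (v w : Jets N) :
    dder (fun v => p v * q v + r v * s v) v w =
      dder p v w * q v + p v * dder q v w + (dder r v w * s v + r v * dder s v w) := by
  rw [← dder_mul hp hq, ← dder_mul hr hs]
  exact dder_add (mul_mem hp hq) (mul_mem hr hs) v w

lemma isPoly_const {V : Type*} [AddCommGroup V] [Module ℝ V] (c : V) :
    IsPoly fun _ : Jets N => c := fun ℓ => const_mem_polyFun (ℓ c)

lemma dder_const_mem (hp : p ∈ polyFun N) (w : Jets N) : (fun v => dder p v w) ∈ polyFun N :=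
  dder_mem_polyFun hp (X := fun _ => w) fun j => isPoly_const (w j)

/-- Symmetry of second derivatives, algebraically: linear functionals have constant first
derivatives, and the Leibniz rule propagates the symmetry to sums and products. -/
lemma dder_dder_comm (hp : p ∈ polyFun N) (v a b : Jets N) :
    dder (fun u => dder p u a) v b = dder (fun u => dder p u b) v a := by
  induction hp using polyFun_induction generalizing v with
  | gen j ℓ => simp only [dder_gen, dder_const]
  | const c => simp only [dder_const]
  | add p q hp hq h1 h2 =>
    simp only [dder_add hp hq]
    rw [dder_add (dder_const_mem hp a) (dder_const_mem hq a),
      dder_add (dder_const_mem hp b) (dder_const_mem hq b), h1, h2]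
  | mul p q hp hq h1 h2 =>
    simp only [dder_mul hp hq]
    have e1 := fun w => dder_const_mem hp w
    have e2 := fun w => dder_const_mem hq w
    rw [dder_mul_add_mul (e1 a) hq hp (e2 a), dder_mul_add_mul (e1 b) hq hp (e2 b), h1, h2]
    ring

/-- Leibniz rule for `u ↦ (X p)(u)` with `X` a linear vector field: the second derivative falls
either on `p` or on `X`. With `dder_dder_comm` it gives commutators of such vector fields. -/
lemma dder_vectorField (hp : p ∈ polyFun N) (X : Jets N →ₗ[ℝ] Jets N)
    (hX : ∀ j, IsPoly fun v => X v j)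
    (hX' : ∀ j (ℓ : Mat N →ₗ[ℝ] ℝ) v b, dder (fun v => ℓ (X v j)) v b = ℓ (X b j))
    (v b : Jets N) :
    dder (fun u => dder p u (X u)) v b = dder (fun u => dder p u (X v)) v b + dder p v (X b) := by
  induction hp using polyFun_induction generalizing v with
  | gen j ℓ => simp only [dder_gen, dder_const, hX', zero_add]
  | const c => simp only [dder_const, add_zero]
  | add p q hp hq h1 h2 =>
    simp only [dder_add hp hq]
    rw [dder_add (dder_mem_polyFun hp hX) (dder_mem_polyFun hq hX),
      dder_add (dder_const_mem hp _) (dder_const_mem hq _), h1, h2]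
    ring
  | mul p q hp hq h1 h2 =>
    simp only [dder_mul hp hq]
    have e1 := dder_mem_polyFun hp hX
    have e2 := dder_mem_polyFun hq hX
    have e3 := fun w => dder_const_mem hp w
    have e4 := fun w => dder_const_mem hq w
    rw [dder_mul_add_mul e1 hq hp e2, dder_mul_add_mul (e3 _) hq hp (e4 _), h1, h2]
    ring

end Real

section Vector

variable {V W : Type*} [NormedAddCommGroup V] [NormedSpace ℝ V] [NormedAddCommGroup W]
  [NormedSpace ℝ W]

variable [FiniteDimensional ℝ V]

lemma IsPoly.of_mem {p : Jets N → ℝ} (hp : p ∈ polyFun N) : IsPoly p := fun ℓ => by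
  have : (fun v => ℓ (p v)) = fun v => p v * ℓ 1 := by
    ext v
    rw [← smul_eq_mul, ← map_smul, smul_eq_mul, mul_one]
  rw [this]
  exact mul_mem hp (const_mem_polyFun _)

/-- Reduction to the scalar case by expanding the values in a basis of the finite-dimensional
target. -/
lemma IsPoly.hasDerivAt {Φ : Jets N → V} (hΦ : IsPoly Φ) {γ : ℝ → Jets N} {w : Jets N} {t : ℝ}
    (h : HasJetDerivAt γ w t) : HasDerivAt (fun s => Φ (γ s)) (dder Φ (γ t) w) t := by
  have key : ∀ (γ : ℝ → Jets N) (t : ℝ), HasJetDerivAt γ w t →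
      HasDerivAt (fun s => Φ (γ s)) (∑ i, dder (fun v => (Module.finBasis ℝ V).coord i (Φ v))
        (γ t) w • Module.finBasis ℝ V i) t := by
    intro γ t h
    have : (fun s => Φ (γ s)) = fun s =>
        ∑ i, (Module.finBasis ℝ V).coord i (Φ (γ s)) • Module.finBasis ℝ V i := by
      ext s
      exact ((Module.finBasis ℝ V).sum_repr _).symm
    rw [this]
    exact HasDerivAt.fun_sum fun i _ => (hasDerivAt_comp_curve (hΦ _) h).smul_const _
  have h0 := (key _ 0 (hasJetDerivAt_line (γ t) w 0)).deriv
  rw [zero_smul, add_zero] at h0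
  rw [dder, h0]
  exact key γ t h

lemma IsPoly.hasDerivAt_line {Φ : Jets N → V} (hΦ : IsPoly Φ) (v w : Jets N) :
    HasDerivAt (fun t : ℝ => Φ (v + t • w)) (dder Φ v w) 0 := by
  simpa using hΦ.hasDerivAt (hasJetDerivAt_line v w 0)

lemma map_dder {Φ : Jets N → V} (hΦ : IsPoly Φ) (ℓ : V →ₗ[ℝ] W) (v w : Jets N) :
    dder (fun v => ℓ (Φ v)) v w = ℓ (dder Φ v w) :=
  ((LinearMap.toContinuousLinearMap ℓ).hasFDerivAt.comp_hasDerivAt (0 : ℝ)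
    (hΦ.hasDerivAt_line v w)).deriv

end Vector

/-! ### The infinitesimal adjoint action, the shift and the scaling of the jets -/

/-- The infinitesimal adjoint action of `ξ` on the jets. -/
def adj (ξ : Mat N) : Jets N →ₗ[ℝ] Jets N where
  toFun v j := ⁅v j, ξ⁆
  map_add' v w := by ext1 j; exact add_lie (v j) (w j) ξ
  map_smul' c v := by ext1 j; exact smul_lie c (v j) ξ

/-- The vector field on the jets which generates the total covariant derivative `D_σ`. -/
def shift (σ : Fin 3) : Jets N →ₗ[ℝ] Jets N where
  toFun v j := v (σ :: j.1, j.2)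
  map_add' _ _ := rfl
  map_smul' _ _ := rfl

/-- Rescaling of the jets according to their mass dimension. -/
def scale (s : ℝ) : Jets N →ₗ[ℝ] Jets N where
  toFun v j := s ^ (j.1.length + 2) • v j
  map_add' v w := by ext1 j; exact smul_add _ _ _
  map_smul' c v := by ext1 j; exact smul_comm (s ^ _) c (v j)

lemma adj_apply (ξ : Mat N) (v : Jets N) (j : JetIdx) : adj ξ v j = ⁅v j, ξ⁆ := rfl

lemma shift_apply (σ : Fin 3) (v : Jets N) (j : JetIdx) : shift σ v j = v (σ :: j.1, j.2) := rfl

lemma scale_apply (s : ℝ) (v : Jets N) (j : JetIdx) :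
    scale s v j = s ^ (j.1.length + 2) • v j := rfl

lemma adj_single (ξ : Mat N) (j : JetIdx) (w : Mat N) :
    adj ξ (Pi.single j w) = Pi.single j ⁅w, ξ⁆ := by
  ext1 i
  rw [adj_apply]
  rcases eq_or_ne i j with rfl | h
  · simp
  · simp [h]

lemma scale_single (s : ℝ) (j : JetIdx) (w : Mat N) :
    scale s (Pi.single j w) = s ^ (j.1.length + 2) • (Pi.single j w : Jets N) := by
  ext1 i
  rw [scale_apply, Pi.smul_apply]
  rcases eq_or_ne i j with rfl | h
  · simp
  · simp [h]

/-- Right bracket with a fixed matrix, as a linear map. -/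
def lieRight (ξ : Mat N) : Mat N →ₗ[ℝ] Mat N where
  toFun v := ⁅v, ξ⁆
  map_add' v w := add_lie v w ξ
  map_smul' c v := smul_lie c v ξ

lemma isPoly_adj (ξ : Mat N) (j : JetIdx) : IsPoly fun v => adj ξ v j :=
  fun ℓ => gen_mem_polyFun j (ℓ ∘ₗ lieRight ξ)

lemma isPoly_shift (σ : Fin 3) (j : JetIdx) : IsPoly fun v : Jets N => shift σ v j :=
  fun ℓ => gen_mem_polyFun _ ℓ

lemma dder_adj (ξ : Mat N) (j : JetIdx) (ℓ : Mat N →ₗ[ℝ] ℝ) (v b : Jets N) :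
    dder (fun v => ℓ (adj ξ v j)) v b = ℓ (adj ξ b j) :=
  dder_gen j (ℓ ∘ₗ lieRight ξ) v b

lemma dder_shift (σ : Fin 3) (j : JetIdx) (ℓ : Mat N →ₗ[ℝ] ℝ) (v b : Jets N) :
    dder (fun v => ℓ (shift σ v j)) v b = ℓ (shift σ b j) :=
  dder_gen _ ℓ v b

/-! ### Jets with values in the gauge Lie algebra -/

section Algebra

variable {𝔤 : LieSubalgebra ℝ (Mat N)}

/-- Jets with values in the gauge Lie algebra. -/
def InLie (𝔤 : LieSubalgebra ℝ (Mat N)) (v : Jets N) : Prop := ∀ j, v j ∈ 𝔤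

lemma InLie.add {v w : Jets N} (hv : InLie 𝔤 v) (hw : InLie 𝔤 w) : InLie 𝔤 (v + w) :=
  fun j => add_mem (hv j) (hw j)

lemma InLie.smul {v : Jets N} (hv : InLie 𝔤 v) (c : ℝ) : InLie 𝔤 (c • v) :=
  fun j => 𝔤.smul_mem c (hv j)

lemma InLie.shift {v : Jets N} (hv : InLie 𝔤 v) (σ : Fin 3) : InLie 𝔤 (shift σ v) :=
  fun _ => hv _

lemma InLie.single {w : Mat N} (hw : w ∈ 𝔤) (j : JetIdx) : InLie 𝔤 (Pi.single j w) := fun i => by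
  rcases eq_or_ne i j with rfl | h
  · simpa using hw
  · simp [h]

lemma InLie.zero : InLie 𝔤 (0 : Jets N) := fun _ => zero_mem 𝔤

/-- A finite-dimensional subspace is closed and contains all the difference quotients. -/
lemma _root_.HasDerivAt.mem_lieSubalgebra {f : ℝ → Mat N} {f' : Mat N} {t : ℝ}
    (h : HasDerivAt f f' t) (hf : ∀ s, f s ∈ 𝔤) : f' ∈ 𝔤 := by
  have hc : IsClosed (𝔤.toSubmodule : Set (Mat N)) := 𝔤.toSubmodule.closed_of_finiteDimensional
  refine hc.mem_of_tendsto (hasDerivAt_iff_tendsto_slope.mp h) (Filter.Eventually.of_forall ?_)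
  intro s
  exact 𝔤.smul_mem _ (sub_mem (hf s) (hf t))

lemma dder_mem {Φ : Jets N → Mat N} (hΦ : IsPoly Φ) {v w : Jets N}
    (h : ∀ t : ℝ, Φ (v + t • w) ∈ 𝔤) : dder Φ v w ∈ 𝔤 :=
  (hΦ.hasDerivAt_line v w).mem_lieSubalgebra h

/-! ### Homogeneous components -/

/-- Evaluation of polynomial functions at a jet. -/
def evalAt (v : Jets N) : polyFun N →+* ℝ :=
  (Pi.evalRingHom (fun _ : Jets N => ℝ) v).comp (polyFun N).val.toRingHom

/-- By induction on generation, `t ↦ p (t • v)` is evaluation of a single polynomial in `t` with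
coefficients in `polyFun N`; these coefficients are the homogeneous components. -/
lemma exists_homogeneous {p : Jets N → ℝ} (hp : p ∈ polyFun N) :
    ∃ (K : ℕ) (q : ℕ → Jets N → ℝ), (∀ k, q k ∈ polyFun N) ∧
      ∀ (t : ℝ) v, p (t • v) = ∑ k ∈ Finset.range K, t ^ k * q k v := by
  have key : ∃ Q : Polynomial (polyFun N), ∀ (t : ℝ) v,
      p (t • v) = Q.eval₂ (evalAt v) t := by
    induction hp using polyFun_induction with
    | gen j ℓ =>
      refine ⟨Polynomial.X * Polynomial.C ⟨_, gen_mem_polyFun j ℓ⟩, fun t v => ?_⟩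
      rw [Polynomial.eval₂_mul, Polynomial.eval₂_X, Polynomial.eval₂_C]
      exact map_smul ℓ t (v j)
    | const c =>
      refine ⟨Polynomial.C ⟨_, const_mem_polyFun c⟩, fun t v => ?_⟩
      simp [evalAt]
    | add p q hp hq h1 h2 =>
      obtain ⟨Q, h⟩ := h1
      obtain ⟨R, h'⟩ := h2
      exact ⟨Q + R, fun t v => by rw [Polynomial.eval₂_add, ← h, ← h']⟩
    | mul p q hp hq h1 h2 =>
      obtain ⟨Q, h⟩ := h1
      obtain ⟨R, h'⟩ := h2
      exact ⟨Q * R, fun t v => by rw [Polynomial.eval₂_mul, ← h, ← h']⟩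
  obtain ⟨Q, hQ⟩ := key
  refine ⟨Q.natDegree + 1, fun k => Q.coeff k, fun k => (Q.coeff k).2, fun t v => ?_⟩
  rw [hQ, Polynomial.eval₂_eq_sum_range]
  exact Finset.sum_congr rfl fun k _ => mul_comm _ _

lemma coeff_eq_of_forall_sum_eq {K : ℕ} {a b : ℕ → ℝ}
    (h : ∀ t : ℝ, ∑ k ∈ Finset.range K, t ^ k * a k = ∑ k ∈ Finset.range K, t ^ k * b k)
    {k : ℕ} (hk : k < K) : a k = b k := by
  have : (∑ k ∈ Finset.range K, Polynomial.monomial k (a k)) =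
      ∑ k ∈ Finset.range K, Polynomial.monomial k (b k) := by
    refine Polynomial.funext fun t => ?_
    simpa [Polynomial.eval_finsetSum, mul_comm] using h t
  have := congrArg (fun P => Polynomial.coeff P k) this
  simpa [Polynomial.finsetSum_coeff, Polynomial.coeff_monomial, hk] using this

lemma sum_mem_polyFun {ι : Type*} (s : Finset ι) {p : ι → Jets N → ℝ}
    (h : ∀ i ∈ s, p i ∈ polyFun N) : (fun v => ∑ i ∈ s, p i v) ∈ polyFun N := by
  have : (fun v => ∑ i ∈ s, p i v) = ∑ i ∈ s, p i := by
    ext v; simp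
  rw [this]
  exact sum_mem h

lemma const_mul_mem_polyFun {p : Jets N → ℝ} (c : ℝ) (h : p ∈ polyFun N) :
    (fun v => c * p v) ∈ polyFun N := mul_mem (const_mem_polyFun c) h

lemma dder_sum {ι : Type*} (s : Finset ι) (c : ι → ℝ) {p : ι → Jets N → ℝ}
    (h : ∀ i ∈ s, p i ∈ polyFun N) (v w : Jets N) :
    dder (fun v => ∑ i ∈ s, c i * p i v) v w = ∑ i ∈ s, c i * dder (p i) v w :=
  (HasDerivAt.fun_sum fun i hi =>
    ((IsPoly.of_mem (h i hi)).hasDerivAt_line v w).const_mul (c i)).deriv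

/-- A function of the jets whose product with the `k`-th power of a mass has dimension `d`. -/
def HasWeight {V : Type*} [SMul ℝ V] (𝔤 : LieSubalgebra ℝ (Mat N)) (d k : ℕ)
    (Φ : Jets N → V) : Prop :=
  ∀ v, InLie 𝔤 v → ∀ s : ℝ, s ^ k • Φ (scale s v) = s ^ d • Φ v

lemma HasMassDim.hasWeight {V : Type*} [AddCommGroup V] [Module ℝ V] {d : ℕ} {Φ : Jets N → V}
    (h : HasMassDim 𝔤 d Φ) : HasWeight 𝔤 d 0 Φ := fun v hv s => by
  rw [pow_zero, one_smul]
  exact h v hv s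

/-- Inversion of the Euler vector field on invariant polynomials without constant term. -/
lemma exists_primitive {p : Jets N → ℝ} (hp : p ∈ polyFun N) (h0 : p 0 = 0)
    (hinv : ∀ ξ ∈ 𝔤, ∀ v, InLie 𝔤 v → dder p v (adj ξ v) = 0) :
    ∃ P ∈ polyFun N, (∀ v, dder P v v = p v) ∧
      (∀ ξ ∈ 𝔤, ∀ v, InLie 𝔤 v → dder P v (adj ξ v) = 0) ∧
      ∀ d, HasMassDim 𝔤 d p → HasWeight 𝔤 d 0 P := by
  obtain ⟨K, q, hq, hpq⟩ := exists_homogeneous hp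
  have hom : ∀ k < K, ∀ (t : ℝ) v, q k (t • v) = t ^ k * q k v := fun k hk t v =>
    coeff_eq_of_forall_sum_eq (K := K) (a := fun k => q k (t • v)) (b := fun k => t ^ k * q k v)
      (fun s => by
        rw [← hpq, smul_smul, hpq]
        exact Finset.sum_congr rfl fun k _ => by ring) hk
  -- The component of degree `k` is an eigenvector of the Euler field with eigenvalue `k`. For `k =
  -- 0` the convention `0⁻¹ = 0` is harmless, because the constant component is `p 0 = 0`.
  refine ⟨fun v => ∑ k ∈ Finset.range K, (k : ℝ)⁻¹ * q k v,
    sum_mem_polyFun _ fun k _ => const_mul_mem_polyFun _ (hq k), fun v => ?_, fun ξ hξ v hv => ?_,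
    fun d hd v hv s => ?_⟩
  · have e : ∀ k < K, dder (q k) v v = k * q k v := fun k hk => by
      have h1 : HasDerivAt (fun t : ℝ => (1 + t) ^ k * q k v) (k * q k v) 0 := by
        simpa using (((hasDerivAt_id (0 : ℝ)).const_add 1).pow k).mul_const (q k v)
      refine ((IsPoly.of_mem (hq k)).hasDerivAt_line v v).unique ?_
      refine h1.congr_of_eventuallyEq (Filter.Eventually.of_forall fun t => ?_)
      simp only []
      rw [← hom k hk, add_smul, one_smul]
    rw [dder_sum _ _ fun k _ => hq k]
    have h1 := hpq 1 v
    rw [one_smul] at h1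
    rw [h1]
    refine Finset.sum_congr rfl fun k hk => ?_
    have hk := Finset.mem_range.mp hk
    rw [e k hk, one_pow, one_mul]
    rcases eq_or_ne k 0 with rfl | hk0
    · have h2 := hpq 0 v
      rw [zero_smul, h0, Finset.sum_eq_single 0 (fun b _ hb => by simp [hb])
        (fun h => absurd (Finset.mem_range.mpr hk) h)] at h2
      simpa using h2
    · field_simp
  · rw [dder_sum _ _ fun k _ => hq k]
    refine Finset.sum_eq_zero fun k hk => ?_
    -- The adjoint action commutes with dilations, so invariance of `p` along `t • v` is an identity
    -- between polynomials in `t`, and each component is invariant separately.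
    have : dder (q k) v (adj ξ v) = 0 := by
      refine coeff_eq_of_forall_sum_eq (K := K) (a := fun k => dder (q k) v (adj ξ v))
        (b := fun _ => 0) (fun t => ?_) (Finset.mem_range.mp hk)
      rw [← dder_sum _ _ fun k _ => hq k]
      have h1 : HasDerivAt (fun s : ℝ => p (t • v + s • adj ξ (t • v))) 0 0 := by
        exact ((IsPoly.of_mem hp).hasDerivAt_line _ _).congr_deriv (hinv ξ hξ _ (hv.smul t))
      have h2 : (fun s : ℝ => p (t • v + s • adj ξ (t • v))) =
          fun s : ℝ => ∑ k ∈ Finset.range K, t ^ k * q k (v + s • adj ξ v) := by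
        ext s
        rw [← hpq, map_smul, smul_add, smul_comm]
      rw [h2] at h1
      simpa [dder] using h1.deriv
    rw [this, mul_zero]
  · have : ∀ k ∈ Finset.range K, q k (scale s v) = s ^ d * q k v := fun k hk =>
      coeff_eq_of_forall_sum_eq (K := K) (a := fun k => q k (scale s v))
        (b := fun k => s ^ d * q k v) (fun t => by
          rw [← hpq, ← map_smul]
          refine (hd (t • v) (hv.smul t) s).trans ?_
          rw [hpq, smul_eq_mul, Finset.mul_sum]
          exact Finset.sum_congr rfl fun k _ => by ring) (Finset.mem_range.mp hk)
    rw [pow_zero, one_smul, smul_eq_mul, Finset.mul_sum]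
    refine Finset.sum_congr rfl fun k hk => ?_
    rw [this k hk]
    ring

/-! ### The trace form -/

/-- The real part of the trace. -/
def retr : Mat N →ₗ[ℝ] ℝ := Complex.reLm ∘ₗ (Matrix.traceLinearMap (Fin N) ℝ ℂ)

lemma retr_apply (X : Mat N) : retr X = (Matrix.trace X).re := rfl

lemma retr_mul_comm (X Y : Mat N) : retr (X * Y) = retr (Y * X) := by
  rw [retr_apply, Matrix.trace_mul_comm, retr_apply]

lemma trace_eq_retr {X Y : Mat N} (hX : X.conjTranspose = -X) (hY : Y.conjTranspose = -Y) :
    Matrix.trace (X * Y) = (retr (X * Y) : ℂ) := by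
  symm
  rw [retr_apply, ← Complex.conj_eq_iff_re]
  have : (starRingEnd ℂ) (Matrix.trace (X * Y)) = Matrix.trace (X * Y).conjTranspose :=
    (Matrix.trace_conjTranspose _).symm
  rw [this, Matrix.conjTranspose_mul, hX, hY, neg_mul_neg, Matrix.trace_mul_comm]

-- For antihermitian `X` one has `-tr X² = tr X†X`, the sum of the squared moduli of the entries.
open scoped ComplexOrder in
lemma eq_zero_of_retr_mul_self {X : Mat N} (hX : X.conjTranspose = -X)
    (h : retr (X * X) = 0) : X = 0 := by
  rw [← Matrix.trace_conjTranspose_mul_self_eq_zero_iff, hX, neg_mul, Matrix.trace_neg,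
    trace_eq_retr hX hX, h]
  simp

lemma retr_lie_mul (X Y Z : Mat N) : retr (⁅X, Y⁆ * Z) = -retr (X * ⁅Z, Y⁆) := by
  have h : retr (Y * X * Z) = retr (X * (Z * Y)) := by rw [mul_assoc, retr_mul_comm, mul_assoc]
  rw [Ring.lie_def, Ring.lie_def, sub_mul, mul_sub, map_sub, map_sub, h, mul_assoc]
  ring

lemma ext_of_retr (h𝔤 : ∀ X ∈ 𝔤, Matrix.conjTranspose X = -X) {X Y : Mat N} (hX : X ∈ 𝔤)
    (hY : Y ∈ 𝔤) (h : ∀ w ∈ 𝔤, retr (X * w) = retr (Y * w)) : X = Y := by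
  have hm := sub_mem hX hY
  rw [← sub_eq_zero]
  refine eq_zero_of_retr_mul_self (h𝔤 _ hm) ?_
  rw [sub_mul, map_sub, h _ hm, sub_self]

/-- The trace form on the gauge Lie algebra. -/
def traceForm (𝔤 : LieSubalgebra ℝ (Mat N)) : LinearMap.BilinForm ℝ 𝔤 :=
  ((LinearMap.mul ℝ (Mat N)).compr₂ retr).domRestrict₁₂ 𝔤.toSubmodule 𝔤.toSubmodule

lemma traceForm_apply (X Y : 𝔤) : traceForm 𝔤 X Y = retr ((X : Mat N) * (Y : Mat N)) := rfl

lemma traceForm_nondegenerate (h𝔤 : ∀ X ∈ 𝔤, Matrix.conjTranspose X = -X) :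
    (traceForm 𝔤).Nondegenerate := by
  have hs : (traceForm 𝔤).IsSymm := ⟨fun X Y => retr_mul_comm _ _⟩
  refine (LinearMap.IsRefl.nondegenerate_iff_separatingLeft hs.isRefl).mpr fun X h => ?_
  exact Subtype.ext (eq_zero_of_retr_mul_self (h𝔤 _ X.2) (h X))

/-- Nondegeneracy of the trace form on `𝔤` yields dual bases inside `𝔤`. They turn linear
functionals on `𝔤` into elements of `𝔤`. -/
lemma exists_dual_basis (h𝔤 : ∀ X ∈ 𝔤, Matrix.conjTranspose X = -X) :
    ∃ (n : ℕ) (b e : Fin n → Mat N), (∀ a, b a ∈ 𝔤) ∧ (∀ a, e a ∈ 𝔤) ∧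
      ∀ w ∈ 𝔤, w = ∑ a, retr (e a * w) • b a := by
  let b := Module.finBasis ℝ 𝔤
  have hB := traceForm_nondegenerate h𝔤
  let e := (traceForm 𝔤).dualBasis hB b
  refine ⟨_, fun a => b a, fun a => e a, fun a => (b a).2, fun a => (e a).2, fun w hw => ?_⟩
  have key : ∀ a, traceForm 𝔤 (e a) ⟨w, hw⟩ = b.repr ⟨w, hw⟩ a := fun a => by
    conv_lhs => rw [← b.sum_repr ⟨w, hw⟩]
    rw [map_sum, Finset.sum_eq_single a]
    · rw [map_smul, LinearMap.BilinForm.apply_dualBasis_left]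
      simp
    · intro i _ hi
      rw [map_smul, LinearMap.BilinForm.apply_dualBasis_left]
      simp [hi]
    · simp
  have h := congrArg (Subtype.val) (b.sum_repr ⟨w, hw⟩)
  simp only [← key, traceForm_apply] at h
  exact (h.symm.trans (by simp))

/-! ### Gradients of invariant polynomials -/

lemma isCovariant_iff {Θ : Jets N → Mat N} : IsCovariant 𝔤 Θ ↔ IsPoly Θ ∧
    (∀ v, InLie 𝔤 v → Θ v ∈ 𝔤) ∧
    ∀ ξ ∈ 𝔤, ∀ v, InLie 𝔤 v → dder Θ v (adj ξ v) = ⁅Θ v, ξ⁆ := by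
  constructor
  · exact fun h => ⟨h.poly, h.mem, fun ξ hξ v hv => (h.equivariant ξ hξ v hv).deriv⟩
  · exact fun ⟨h1, h2, h3⟩ => ⟨h1, h2, fun ξ hξ v hv =>
      (h1.hasDerivAt_line v _).congr_deriv (h3 ξ hξ v hv)⟩

lemma IsCovariant.dder_adj {Θ : Jets N → Mat N} (h : IsCovariant 𝔤 Θ) {ξ : Mat N} (hξ : ξ ∈ 𝔤)
    {v : Jets N} (hv : InLie 𝔤 v) : dder Θ v (adj ξ v) = ⁅Θ v, ξ⁆ :=
  (isCovariant_iff.mp h).2.2 ξ hξ v hv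

lemma isYMLagrangian_iff {p : Jets N → ℝ} : IsYMLagrangian 𝔤 p ↔ p ∈ polyFun N ∧ p 0 = 0 ∧
    ∀ ξ ∈ 𝔤, ∀ v, InLie 𝔤 v → dder p v (adj ξ v) = 0 := by
  constructor
  · exact fun h => ⟨h.poly, h.map_zero, fun ξ hξ v hv => (h.invariant ξ hξ v hv).deriv⟩
  · exact fun ⟨h1, h2, h3⟩ => ⟨h1, h2, fun ξ hξ v hv =>
      ((IsPoly.of_mem h1).hasDerivAt_line v _).congr_deriv (h3 ξ hξ v hv)⟩

/-- Right multiplication by a fixed matrix followed by the trace. -/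
def retrMul (w : Mat N) : Mat N →ₗ[ℝ] ℝ := retr ∘ₗ LinearMap.mulRight ℝ w

lemma retrMul_apply (w X : Mat N) : retrMul w X = retr (X * w) := rfl

/-- The `Q j` are the partial gradients of the Euler primitive of `p`. Euler's formula gives the
decomposition of `p`; equivariance is the derivative of invariance; the weight follows because
differentiating in `v j` removes its dimension `j.1.length + 2`. -/
theorem exists_gradient (h𝔤 : ∀ X ∈ 𝔤, Matrix.conjTranspose X = -X) {p : Jets N → ℝ}
    (hp : IsYMLagrangian 𝔤 p) :
    ∃ (S : Finset JetIdx) (Q : JetIdx → Jets N → Mat N), (∀ j, IsCovariant 𝔤 (Q j)) ∧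
      (∀ v, InLie 𝔤 v → p v = ∑ j ∈ S, retr (Q j v * v j)) ∧
      ∀ d, HasMassDim 𝔤 d p → ∀ j, HasWeight 𝔤 d (j.1.length + 2) (Q j) := by
  obtain ⟨h1, h2, h3⟩ := isYMLagrangian_iff.mp hp
  obtain ⟨P, hP, euler, hinv, hweight⟩ := exists_primitive h1 h2 h3
  obtain ⟨n, b, e, hb, he, hbe⟩ := exists_dual_basis h𝔤
  obtain ⟨S, hS⟩ := exists_dder_eq_sum hP
  -- This is the element of `𝔤` representing `w ↦ dder P v (Pi.single j w)` in the trace form,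
  -- written with the dual basis.
  set Q : JetIdx → Jets N → Mat N := fun j v => ∑ a, dder P v (Pi.single j (b a)) • e a with hQ
  have Qpoly : ∀ j, IsPoly (Q j) := fun j ℓ => by
    simp only [hQ, map_sum, map_smul, smul_eq_mul]
    exact sum_mem_polyFun _ fun a _ => mul_mem (dder_const_mem hP _) (const_mem_polyFun _)
  have Qmem : ∀ j v, Q j v ∈ 𝔤 := fun j v => sum_mem fun a _ => 𝔤.smul_mem _ (he a)
  have Qpair : ∀ j v, ∀ w ∈ 𝔤, retr (Q j v * w) = dder P v (Pi.single j w) := by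
    intro j v w hw
    obtain ⟨d, hd, -⟩ := exists_differential' hP
    have hl : dder P v (Pi.single j w) = (d v ∘ₗ LinearMap.single ℝ (fun _ => Mat N) j) w := hd _ _
    rw [hl]
    conv_rhs => rw [hbe w hw]
    simp only [hQ, map_sum, map_smul, Finset.sum_mul, smul_mul_assoc, smul_eq_mul, hd]
    exact Finset.sum_congr rfl fun a _ => mul_comm _ _
  refine ⟨S, Q, fun j => isCovariant_iff.mpr ⟨Qpoly j, fun v _ => Qmem j v, fun ξ hξ v hv => ?_⟩,
    fun v hv => ?_, fun d hd j v hv s => ?_⟩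
  · refine ext_of_retr h𝔤 (dder_mem (Qpoly j) fun t => Qmem j _) (𝔤.lie_mem (Qmem j v) hξ)
      fun w hw => ?_
    rw [← retrMul_apply, ← map_dder (Qpoly j) (retrMul w)]
    simp only [retrMul_apply, Qpair j _ w hw]
    rw [dder_dder_comm hP]
    -- Differentiating the identity `dder P u (adj ξ u) = 0` in the direction `Pi.single j w` gives
    -- two terms: the derivative of the gradient along `adj ξ`, and the gradient paired with `⁅w,
    -- ξ⁆`. Invariance of the trace form moves the bracket to the gradient.
    have h4 := dder_vectorField hP (adj ξ) (isPoly_adj ξ) (ChernSimons.dder_adj ξ) v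
      (Pi.single j w)
    have h5 : dder (fun u => dder P u (adj ξ u)) v (Pi.single j w) = 0 := by
      rw [dder]
      have : (fun t : ℝ => dder P (v + t • (Pi.single j w : Jets N))
          (adj ξ (v + t • (Pi.single j w : Jets N)))) = fun _ => 0 :=
        funext fun t => hinv ξ hξ _ (hv.add ((InLie.single hw j).smul t))
      rw [this, deriv_const]
    rw [h5, adj_single, ← Qpair j v _ (𝔤.lie_mem hw hξ)] at h4
    rw [retr_lie_mul]
    linarith
  · rw [← euler v, hS v v]
    exact Finset.sum_congr rfl fun j _ => (Qpair j v _ (hv j)).symm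
  · refine ext_of_retr h𝔤 (𝔤.smul_mem _ (Qmem j _)) (𝔤.smul_mem _ (Qmem j _)) fun w hw => ?_
    rw [smul_mul_assoc, map_smul, Qpair j _ w hw, smul_mul_assoc, map_smul, Qpair j _ w hw,
      smul_eq_mul, ← dder_smul_right hP, ← scale_single]
    have h4 := (IsPoly.of_mem hP).hasDerivAt_line (scale s v) (scale s (Pi.single j w))
    have h5 : (fun t : ℝ => P (scale s v + t • scale s (Pi.single j w))) =
        fun t : ℝ => s ^ d * P (v + t • (Pi.single j w : Jets N)) := by
      ext t
      have := hweight d hd (v + t • (Pi.single j w : Jets N))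
        (hv.add ((InLie.single hw j).smul t)) s
      rw [pow_zero, one_smul, map_add, map_smul] at this
      exact this
    rw [h5] at h4
    exact h4.unique (((IsPoly.of_mem hP).hasDerivAt_line v _).const_mul _)

end Algebra

/-! ### Products and total covariant derivatives of local expressions -/

lemma IsPoly.bilin {V W U : Type*} [NormedAddCommGroup V] [NormedSpace ℝ V]
    [FiniteDimensional ℝ V] [NormedAddCommGroup W] [NormedSpace ℝ W] [FiniteDimensional ℝ W]
    [AddCommGroup U] [Module ℝ U] (B : V →ₗ[ℝ] W →ₗ[ℝ] U) {Φ : Jets N → V} {Ψ : Jets N → W}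
    (hΦ : IsPoly Φ) (hΨ : IsPoly Ψ) : IsPoly fun v => B (Φ v) (Ψ v) := fun ℓ => by
  have : (fun v => ℓ (B (Φ v) (Ψ v))) = fun v => ∑ i, ∑ k,
      (Module.finBasis ℝ V).coord i (Φ v) * ((Module.finBasis ℝ W).coord k (Ψ v) *
        ℓ (B (Module.finBasis ℝ V i) (Module.finBasis ℝ W k))) := by
    ext v
    conv_lhs => rw [← (Module.finBasis ℝ V).sum_repr (Φ v), ← (Module.finBasis ℝ W).sum_repr (Ψ v)]
    simp only [map_sum, map_smul, LinearMap.sum_apply, LinearMap.smul_apply, smul_eq_mul,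
      Module.Basis.coord_apply, Finset.mul_sum]
    rw [Finset.sum_comm]
    exact Finset.sum_congr rfl fun i _ => Finset.sum_congr rfl fun k _ => by ring
  rw [this]
  exact sum_mem_polyFun _ fun i _ => sum_mem_polyFun _ fun k _ =>
    mul_mem (hΦ _) (mul_mem (hΨ _) (const_mem_polyFun _))

lemma IsPoly.mul {Φ Ψ : Jets N → Mat N} (hΦ : IsPoly Φ) (hΨ : IsPoly Ψ) :
    IsPoly fun v => Φ v * Ψ v := IsPoly.bilin (LinearMap.mul ℝ (Mat N)) hΦ hΨ

lemma IsPoly.add {V : Type*} [AddCommGroup V] [Module ℝ V] {Φ Ψ : Jets N → V} (hΦ : IsPoly Φ)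
    (hΨ : IsPoly Ψ) : IsPoly fun v => Φ v + Ψ v := fun ℓ => by
  simp only [map_add]
  exact add_mem (hΦ ℓ) (hΨ ℓ)

lemma IsPoly.smul {V : Type*} [AddCommGroup V] [Module ℝ V] {Φ : Jets N → V} (c : ℝ)
    (hΦ : IsPoly Φ) : IsPoly fun v => c • Φ v := fun ℓ => by
  simp only [map_smul]
  exact const_mul_mem_polyFun c (hΦ ℓ)

lemma dder_matMul {Φ Ψ : Jets N → Mat N} (hΦ : IsPoly Φ) (hΨ : IsPoly Ψ) (v w : Jets N) :
    dder (fun v => Φ v * Ψ v) v w = dder Φ v w * Ψ v + Φ v * dder Ψ v w := by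
  have := ((hΦ.hasDerivAt_line v w).mul (hΨ.hasDerivAt_line v w)).deriv
  rwa [zero_smul, add_zero] at this

section Vector

variable {V : Type*} [NormedAddCommGroup V] [NormedSpace ℝ V]

/-- The total covariant derivative `D_σ` of a local expression. -/
def tder (σ : Fin 3) (Φ : Jets N → V) : Jets N → V := fun v => dder Φ v (shift σ v)

variable [FiniteDimensional ℝ V]

lemma eq_of_forall_functional {X Y : V} (h : ∀ ℓ : V →ₗ[ℝ] ℝ, ℓ X = ℓ Y) : X = Y :=
  (Module.finBasis ℝ V).ext_elem fun i => h ((Module.finBasis ℝ V).coord i)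

lemma IsPoly.tder {Φ : Jets N → V} (h : IsPoly Φ) (σ : Fin 3) : IsPoly (tder σ Φ) := fun ℓ => by
  simp only [ChernSimons.tder, ← map_dder h]
  exact dder_mem_polyFun (h ℓ) (isPoly_shift σ)

lemma dder_add_right' {Φ : Jets N → V} (h : IsPoly Φ) (v w w' : Jets N) :
    dder Φ v (w + w') = dder Φ v w + dder Φ v w' := eq_of_forall_functional fun ℓ => by
  rw [map_add]
  simp only [← map_dder h]
  exact dder_add_right (h ℓ) v w w'

lemma dder_smul_right' {Φ : Jets N → V} (h : IsPoly Φ) (c : ℝ) (v w : Jets N) :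
    dder Φ v (c • w) = c • dder Φ v w := eq_of_forall_functional fun ℓ => by
  rw [map_smul]
  simp only [← map_dder h]
  exact dder_smul_right (h ℓ) c v w

end Vector

/-! ### Closure properties of covariant expressions and invariant Lagrangians -/

section Algebra

variable {𝔤 : LieSubalgebra ℝ (Mat N)}

lemma dder_congr {V : Type*} [NormedAddCommGroup V] [NormedSpace ℝ V] {Φ Ψ : Jets N → V}
    (h : ∀ v, InLie 𝔤 v → Φ v = Ψ v) {v w : Jets N} (hv : InLie 𝔤 v) (hw : InLie 𝔤 w) :
    dder Φ v w = dder Ψ v w := by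
  have : (fun t : ℝ => Φ (v + t • w)) = fun t : ℝ => Ψ (v + t • w) :=
    funext fun t => h _ (hv.add (hw.smul t))
  rw [dder, this, dder]

/-- The linear vector fields `shift σ` and `adj ξ` commute. In both orders the second derivatives
agree by `dder_dder_comm`, and the remaining first-order terms contain the same vector `adj ξ (shift
σ v) = shift σ (adj ξ v)`. -/
lemma IsCovariant.tder {Θ : Jets N → Mat N} (h : IsCovariant 𝔤 Θ) (σ : Fin 3) :
    IsCovariant 𝔤 (tder σ Θ) := by
  have hp : IsPoly Θ := h.poly
  refine isCovariant_iff.mpr ⟨hp.tder σ,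
    fun v hv => dder_mem hp fun t => h.mem _ (hv.add ((hv.shift σ).smul t)),
    fun ξ hξ v hv => eq_of_forall_functional fun ℓ => ?_⟩
  rw [← map_dder (hp.tder σ)]
  have e1 : (fun u => ℓ (ChernSimons.tder σ Θ u)) =
      fun u => dder (fun u => ℓ (Θ u)) u (shift σ u) :=
    funext fun u => (map_dder hp ℓ _ _).symm
  have e2 : ℓ ⁅ChernSimons.tder σ Θ v, ξ⁆ =
      dder (fun u => dder (fun u => ℓ (Θ u)) u (adj ξ u)) v (shift σ v) := by
    refine (map_dder hp (ℓ ∘ₗ lieRight ξ) v (shift σ v)).symm.trans (dder_congr ?_ hv (hv.shift σ))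
    intro u hu
    rw [map_dder hp, h.dder_adj hξ hu]
    rfl
  rw [e1, e2, dder_vectorField (hp ℓ) _ (isPoly_shift σ) (dder_shift σ),
    dder_vectorField (hp ℓ) _ (isPoly_adj ξ) (ChernSimons.dder_adj ξ), dder_dder_comm (hp ℓ)]
  rfl

lemma IsCovariant.add {Θ Ψ : Jets N → Mat N} (h : IsCovariant 𝔤 Θ) (h' : IsCovariant 𝔤 Ψ) :
    IsCovariant 𝔤 (fun v => Θ v + Ψ v) where
  poly := IsPoly.add h.poly h'.poly
  mem v hv := add_mem (h.mem v hv) (h'.mem v hv)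
  equivariant ξ hξ v hv :=
    ((h.equivariant ξ hξ v hv).add (h'.equivariant ξ hξ v hv)).congr_deriv (add_lie _ _ _).symm

lemma IsCovariant.smul {Θ : Jets N → Mat N} (c : ℝ) (h : IsCovariant 𝔤 Θ) :
    IsCovariant 𝔤 (fun v => c • Θ v) where
  poly := IsPoly.smul c h.poly
  mem v hv := 𝔤.smul_mem c (h.mem v hv)
  equivariant ξ hξ v hv :=
    ((h.equivariant ξ hξ v hv).const_smul c).congr_deriv (smul_lie _ _ _).symm

lemma IsCovariant.zero : IsCovariant 𝔤 (fun _ => 0) where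
  poly := isPoly_const 0
  mem _ _ := zero_mem 𝔤
  equivariant ξ _ _ _ := (hasDerivAt_const _ _).congr_deriv (zero_lie ξ).symm

lemma IsCovariant.sum {ι : Type*} (s : Finset ι) {Θ : ι → Jets N → Mat N}
    (h : ∀ i ∈ s, IsCovariant 𝔤 (Θ i)) : IsCovariant 𝔤 (fun v => ∑ i ∈ s, Θ i v) := by
  classical
  induction s using Finset.induction_on with
  | empty => simpa using IsCovariant.zero
  | insert i s hi ih =>
    simp only [Finset.sum_insert hi]
    exact (h i (by simp)).add (ih fun j hj => h j (by simp [hj]))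

lemma IsCovariant.coord (j : JetIdx) : IsCovariant 𝔤 (fun v => v j) where
  poly ℓ := gen_mem_polyFun j ℓ
  mem _ hv := hv j
  equivariant ξ _ v _ := hasJetDerivAt_line v (adj ξ v) 0 j

lemma tder_coord (σ : Fin 3) (j : JetIdx) :
    tder σ (fun v : Jets N => v j) = fun v => v (σ :: j.1, j.2) := by
  ext1 v
  exact (hasJetDerivAt_line v (shift σ v) 0 j).deriv

lemma IsCovariant.lie {Θ Ψ : Jets N → Mat N} (h : IsCovariant 𝔤 Θ) (h' : IsCovariant 𝔤 Ψ) :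
    IsCovariant 𝔤 (fun v => ⁅Θ v, Ψ v⁆) := by
  refine isCovariant_iff.mpr ⟨?_, fun v hv => 𝔤.lie_mem (h.mem v hv) (h'.mem v hv),
    fun ξ hξ v hv => ?_⟩
  · simp only [Ring.lie_def, sub_eq_add_neg]
    refine (IsPoly.mul h.poly h'.poly).add ?_
    simpa using (IsPoly.mul h'.poly h.poly).smul (-1)
  · have h1 := (h.equivariant ξ hξ v hv)
    have h2 := (h'.equivariant ξ hξ v hv)
    have h3 := (h1.mul h2).sub (h2.mul h1)
    simp only [zero_smul, add_zero] at h3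
    refine h3.deriv.trans ?_
    simp only [Ring.lie_def]
    noncomm_ring

lemma isYMLagrangian_retr_mul {Θ Ψ : Jets N → Mat N} (h : IsCovariant 𝔤 Θ)
    (h' : IsCovariant 𝔤 Ψ) (h0 : Θ 0 = 0) : IsYMLagrangian 𝔤 (fun v => retr (Θ v * Ψ v)) := by
  have hm := IsPoly.mul h.poly h'.poly
  refine isYMLagrangian_iff.mpr ⟨hm retr, by simp [h0], fun ξ hξ v hv => ?_⟩
  rw [map_dder hm, dder_matMul h.poly h'.poly, h.dder_adj hξ hv, h'.dder_adj hξ hv, map_add,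
    retr_lie_mul, neg_add_cancel]

lemma IsYMLagrangian.add {p q : Jets N → ℝ} (h : IsYMLagrangian 𝔤 p) (h' : IsYMLagrangian 𝔤 q) :
    IsYMLagrangian 𝔤 (fun v => p v + q v) where
  poly := add_mem h.poly h'.poly
  map_zero := by rw [h.map_zero, h'.map_zero, add_zero]
  invariant ξ hξ v hv :=
    ((h.invariant ξ hξ v hv).add (h'.invariant ξ hξ v hv)).congr_deriv (add_zero 0)

lemma IsYMLagrangian.const_mul {p : Jets N → ℝ} (c : ℝ) (h : IsYMLagrangian 𝔤 p) :
    IsYMLagrangian 𝔤 (fun v => c * p v) where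
  poly := const_mul_mem_polyFun c h.poly
  map_zero := by rw [h.map_zero, mul_zero]
  invariant ξ hξ v hv := ((h.invariant ξ hξ v hv).const_mul c).congr_deriv (mul_zero c)

lemma IsYMLagrangian.sub {p q : Jets N → ℝ} (h : IsYMLagrangian 𝔤 p) (h' : IsYMLagrangian 𝔤 q) :
    IsYMLagrangian 𝔤 (fun v => p v - q v) := by
  simpa [sub_eq_add_neg] using h.add (h'.const_mul (-1))

lemma IsYMLagrangian.zero : IsYMLagrangian 𝔤 (fun _ => 0) where
  poly := const_mem_polyFun 0
  map_zero := rfl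
  invariant _ _ _ _ := hasDerivAt_const _ _

lemma IsYMLagrangian.sum {ι : Type*} (s : Finset ι) {p : ι → Jets N → ℝ}
    (h : ∀ i ∈ s, IsYMLagrangian 𝔤 (p i)) : IsYMLagrangian 𝔤 (fun v => ∑ i ∈ s, p i v) := by
  classical
  induction s using Finset.induction_on with
  | empty => simpa using IsYMLagrangian.zero
  | insert i s hi ih =>
    simp only [Finset.sum_insert hi]
    exact (h i (by simp)).add (ih fun j hj => h j (by simp [hj]))

/-- A semisimple Lie algebra has trivial centre. -/
lemma eq_zero_of_lie_eq_zero [LieAlgebra.IsSemisimple ℝ 𝔤] {X : Mat N} (hX : X ∈ 𝔤)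
    (h : ∀ ξ ∈ 𝔤, ⁅X, ξ⁆ = 0) : X = 0 := by
  have hc : (⟨X, hX⟩ : 𝔤) ∈ LieAlgebra.center ℝ 𝔤 := by
    rw [LieAlgebra.center, LieModule.mem_maxTrivSubmodule]
    intro ξ
    refine Subtype.ext ?_
    change ⁅(ξ : Mat N), X⁆ = 0
    rw [← lie_skew, h _ ξ.2, neg_zero]
  rw [LieAlgebra.center_eq_bot, LieSubmodule.mem_bot] at hc
  exact congrArg Subtype.val hc

/-- The zero jet is fixed by the adjoint action, so `Θ 0` is central. This excludes constants, which
would spoil decay and integrability. -/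
lemma IsCovariant.map_zero [LieAlgebra.IsSemisimple ℝ 𝔤] {Θ : Jets N → Mat N}
    (h : IsCovariant 𝔤 Θ) : Θ 0 = 0 := by
  refine eq_zero_of_lie_eq_zero (h.mem 0 InLie.zero) fun ξ hξ => ?_
  rw [← h.dder_adj hξ InLie.zero, _root_.map_zero]
  simp [dder]

/-! ### Mass dimensions -/

/-- Since `shift σ` lengthens the list of derivatives by one, exchanging it with `scale s` costs one
factor `s`, which is the extra unit of dimension. -/
lemma HasWeight.tder {Θ : Jets N → Mat N} {d k : ℕ} (hΘ : IsPoly Θ) (h : HasWeight 𝔤 d k Θ)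
    (σ : Fin 3) : HasWeight 𝔤 (d + 1) k (tder σ Θ) := by
  intro v hv s
  have h1 : shift σ (scale s v) = s • scale s (shift σ v) := by
    ext1 j
    rw [Pi.smul_apply, shift_apply, scale_apply, scale_apply, shift_apply, smul_smul,
      List.length_cons]
    congr 1
    ring
  have h2 : s ^ k • dder Θ (scale s v) (scale s (shift σ v)) = s ^ d • dder Θ v (shift σ v) := by
    refine ((hΘ.hasDerivAt_line (scale s v) _).const_smul (s ^ k)).unique ?_
    refine ((hΘ.hasDerivAt_line v (shift σ v)).const_smul (s ^ d)).congr_of_eventuallyEq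
      (Filter.Eventually.of_forall fun t => ?_)
    have := h (v + t • shift σ v) (hv.add ((hv.shift σ).smul t)) s
    rw [map_add, map_smul] at this
    exact this
  rw [ChernSimons.tder, h1, dder_smul_right' hΘ, smul_comm, h2, smul_smul, pow_succ']
  rfl

lemma HasWeight.smul {V : Type*} [AddCommGroup V] [Module ℝ V] {Φ : Jets N → V} {d k : ℕ}
    (c : ℝ) (h : HasWeight 𝔤 d k Φ) : HasWeight 𝔤 d k (fun v => c • Φ v) := fun v hv s => by
  rw [smul_comm, h v hv, smul_comm]

/-- For `s ≠ 0` the factor `s ^ k` cancels. At `s = 0` the scaled jet is zero, and `Θ 0 = 0`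
supplies the claim. -/
lemma HasWeight.hasMassDim [LieAlgebra.IsSemisimple ℝ 𝔤] {Θ : Jets N → Mat N} {d k : ℕ}
    (hΘ : IsCovariant 𝔤 Θ) (h : HasWeight 𝔤 (d + 1 + k) k Θ) : HasMassDim 𝔤 (d + 1) Θ := by
  intro v hv s
  rcases eq_or_ne s 0 with rfl | hs
  · rw [zero_pow d.succ_ne_zero, zero_smul, ← hΘ.map_zero]
    congr 1
    ext1 j
    simp
  · have := h v hv s
    rw [add_comm _ k, pow_add, mul_smul] at this
    exact smul_right_injective _ (pow_ne_zero k hs) this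

section MassDim

variable {V : Type*} [AddCommGroup V] [Module ℝ V] {Φ Ψ : Jets N → V} {d : ℕ}

lemma HasMassDim.add (h : HasMassDim 𝔤 d Φ) (h' : HasMassDim 𝔤 d Ψ) :
    HasMassDim 𝔤 d (fun v => Φ v + Ψ v) := fun v hv s => by
  beta_reduce
  rw [h v hv, h' v hv, smul_add]

lemma HasMassDim.sub (h : HasMassDim 𝔤 d Φ) (h' : HasMassDim 𝔤 d Ψ) :
    HasMassDim 𝔤 d (fun v => Φ v - Ψ v) := fun v hv s => by
  beta_reduce
  rw [h v hv, h' v hv, smul_sub]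

lemma HasMassDim.smul (c : ℝ) (h : HasMassDim 𝔤 d Φ) :
    HasMassDim 𝔤 d (fun v => c • Φ v) := fun v hv s => by
  beta_reduce
  rw [h v hv, smul_comm]

lemma HasMassDim.sum {ι : Type*} (s : Finset ι) {Φ : ι → Jets N → V}
    (h : ∀ i ∈ s, HasMassDim 𝔤 d (Φ i)) : HasMassDim 𝔤 d (fun v => ∑ i ∈ s, Φ i v) :=
  fun v hv t => by
    rw [Finset.smul_sum]
    exact Finset.sum_congr rfl fun i hi => h i hi v hv t

lemma HasMassDim.zero : HasMassDim 𝔤 d (fun _ => (0 : V)) := fun _ _ _ => (smul_zero _).symm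

end MassDim

lemma HasMassDim.tder {Θ : Jets N → Mat N} {d : ℕ} (hΘ : IsPoly Θ) (h : HasMassDim 𝔤 d Θ)
    (σ : Fin 3) : HasMassDim 𝔤 (d + 1) (tder σ Θ) := fun v hv s => by
  have := (h.hasWeight.tder hΘ σ) v hv s
  rwa [pow_zero, one_smul] at this

lemma HasMassDim.mul {Θ Ψ : Jets N → Mat N} {d e : ℕ} (h : HasMassDim 𝔤 d Θ)
    (h' : HasMassDim 𝔤 e Ψ) : HasMassDim 𝔤 (d + e) (fun v => Θ v * Ψ v) := fun v hv s => by
  beta_reduce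
  rw [h v hv, h' v hv, smul_mul_smul_comm, pow_add]

lemma HasMassDim.map {V W : Type*} [AddCommGroup V] [Module ℝ V] [AddCommGroup W] [Module ℝ W]
    {Φ : Jets N → V} {d : ℕ} (ℓ : V →ₗ[ℝ] W) (h : HasMassDim 𝔤 d Φ) :
    HasMassDim 𝔤 d (fun v => ℓ (Φ v)) := fun v hv s => by
  beta_reduce
  rw [h v hv, map_smul]

lemma HasMassDim.coord (j : JetIdx) : HasMassDim 𝔤 (j.1.length + 2) (fun v => v j) :=
  fun _ _ _ => rfl

end Algebra

/-! ### Jets of smooth gauge fields -/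

lemma contDiff_pd {f : Field N} (hf : ContDiff ℝ ∞ f) (μ : Fin 3) : ContDiff ℝ ∞ (pd μ f) :=
  (hf.fderiv_right (m := ∞) (by simp)).clm_apply contDiff_const

lemma contDiff_matMul {f h : Field N} (hf : ContDiff ℝ ∞ f) (hh : ContDiff ℝ ∞ h) :
    ContDiff ℝ ∞ (fun x => f x * h x) := hf.mul hh

lemma contDiff_lie {f h : Field N} (hf : ContDiff ℝ ∞ f) (hh : ContDiff ℝ ∞ h) :
    ContDiff ℝ ∞ (fun x => ⁅f x, h x⁆) :=
  (contDiff_matMul hf hh).sub (contDiff_matMul hh hf)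

lemma hasDerivAt_pd {V : Type*} [NormedAddCommGroup V] [NormedSpace ℝ V] {f : Space → V}
    (hf : ContDiff ℝ ∞ f) (x e : Space) :
    HasDerivAt (fun t : ℝ => f (x + t • e)) (fderiv ℝ f x e) 0 := by
  have h1 : HasDerivAt (fun t : ℝ => x + t • e) e 0 := by
    have := ((hasDerivAt_id (0 : ℝ)).smul_const e).const_add x
    rwa [one_smul] at this
  have h2 : HasFDerivAt f (fderiv ℝ f x) (x + (0 : ℝ) • e) := by
    rw [zero_smul, add_zero]
    exact (hf.differentiable (by simp) x).hasFDerivAt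
  exact h2.comp_hasDerivAt 0 h1

section Algebra

variable {𝔤 : LieSubalgebra ℝ (Mat N)}

lemma IsSmoothField.pd {f : Field N} (hf : IsSmoothField 𝔤 f) (μ : Fin 3) :
    IsSmoothField 𝔤 (pd μ f) :=
  ⟨contDiff_pd hf.1 μ, fun x => (hasDerivAt_pd hf.1 x _).mem_lieSubalgebra fun _ => hf.2 _⟩

lemma IsSmoothField.cov {f : Field N} (hf : IsSmoothField 𝔤 f) {A : VField N}
    (hA : ∀ μ, IsSmoothField 𝔤 (A μ)) (g : ℝ) (μ : Fin 3) : IsSmoothField 𝔤 (cov g A μ f) :=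
  ⟨(hf.pd μ).1.add ((contDiff_lie (hA μ).1 hf.1).const_smul g),
    fun x => add_mem ((hf.pd μ).2 x) (𝔤.smul_mem g (𝔤.lie_mem ((hA μ).2 x) (hf.2 x)))⟩

variable {A : VField N} (hA : ∀ μ, IsSmoothField 𝔤 (A μ)) (g : ℝ)
include hA

lemma isSmoothField_fieldStrength (μ ν : Fin 3) : IsSmoothField 𝔤 (fieldStrength g A μ ν) :=
  ⟨(((hA ν).pd μ).1.sub ((hA μ).pd ν).1).add
      ((contDiff_lie (hA μ).1 (hA ν).1).const_smul g),
    fun x => add_mem (sub_mem (((hA ν).pd μ).2 x) (((hA μ).pd ν).2 x))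
      (𝔤.smul_mem g (𝔤.lie_mem ((hA μ).2 x) ((hA ν).2 x)))⟩

lemma isSmoothField_jet (j : JetIdx) : IsSmoothField 𝔤 (fun x => jet g A x j) := by
  obtain ⟨l, μ, ν⟩ := j
  induction l with
  | nil => exact isSmoothField_fieldStrength hA g μ ν
  | cons σ l ih => exact ih.cov hA g σ

lemma inLie_jet (x : Space) : InLie 𝔤 (jet g A x) := fun j => (isSmoothField_jet hA g j).2 x

lemma contDiff_polyFun_jet {p : Jets N → ℝ} (hp : p ∈ polyFun N) :
    ContDiff ℝ ∞ (fun x => p (jet g A x)) := by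
  induction hp using polyFun_induction with
  | gen j ℓ => exact (LinearMap.toContinuousLinearMap ℓ).contDiff.comp (isSmoothField_jet hA g j).1
  | const c => exact contDiff_const
  | add p q hp hq h1 h2 => exact h1.add h2
  | mul p q hp hq h1 h2 => exact h1.mul h2

lemma contDiff_isPoly_jet {V : Type*} [NormedAddCommGroup V] [NormedSpace ℝ V]
    [FiniteDimensional ℝ V] {Φ : Jets N → V} (hΦ : IsPoly Φ) :
    ContDiff ℝ ∞ (fun x => Φ (jet g A x)) := by
  have : (fun x => Φ (jet g A x)) = fun x =>
      ∑ i, (Module.finBasis ℝ V).coord i (Φ (jet g A x)) • Module.finBasis ℝ V i := by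
    ext x
    exact ((Module.finBasis ℝ V).sum_repr _).symm
  rw [this]
  exact ContDiff.sum fun i _ => (contDiff_polyFun_jet hA g (hΦ _)).smul contDiff_const

/-- The chain rule for a local expression. -/
lemma fderiv_isPoly_jet {V : Type*} [NormedAddCommGroup V] [NormedSpace ℝ V]
    [FiniteDimensional ℝ V] {Φ : Jets N → V} (hΦ : IsPoly Φ) (σ : Fin 3) (x : Space) :
    fderiv ℝ (fun x => Φ (jet g A x)) x (EuclideanSpace.single σ 1) =
      tder σ Φ (jet g A x) + g • dder Φ (jet g A x) (adj (A σ x) (jet g A x)) := by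
  have h1 := hasDerivAt_pd (contDiff_isPoly_jet hA g hΦ) x (EuclideanSpace.single σ 1)
  have h2 : HasJetDerivAt (fun t : ℝ => jet g A (x + t • EuclideanSpace.single σ 1))
      (shift σ (jet g A x) + g • adj (A σ x) (jet g A x)) 0 := fun j => by
    refine (hasDerivAt_pd (isSmoothField_jet hA g j).1 x _).congr_deriv ?_
    change pd σ (fun x => jet g A x j) x =
      (pd σ (fun x => jet g A x j) x + g • ⁅A σ x, jet g A x j⁆) + g • ⁅jet g A x j, A σ x⁆
    rw [← lie_skew (A σ x), smul_neg]
    abel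
  rw [tder, ← dder_smul_right' hΦ, ← dder_add_right' hΦ]
  refine h1.unique ?_
  have h3 := hΦ.hasDerivAt h2
  simpa only [zero_smul, add_zero] using h3

/-- The ordinary derivative of a jet is its shift plus an adjoint rotation by `A σ`. By equivariance
this rotation acts on `Θ` as `g ⁅Θ, A σ⁆` and cancels the connection term of the covariant
derivative. -/
lemma cov_isCovariant_jet {Θ : Jets N → Mat N} (hΘ : IsCovariant 𝔤 Θ) (σ : Fin 3) (x : Space) :
    cov g A σ (fun x => Θ (jet g A x)) x = tder σ Θ (jet g A x) := by
  have h : pd σ (fun x => Θ (jet g A x)) x =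
      tder σ Θ (jet g A x) + g • dder Θ (jet g A x) (adj (A σ x) (jet g A x)) :=
    fderiv_isPoly_jet hA g (Φ := Θ) hΘ.poly σ x
  rw [cov, h, hΘ.dder_adj ((hA σ).2 x) (inLie_jet hA g x),
    ← lie_skew (A σ x), smul_neg]
  abel

lemma pd_invariant_jet {p : Jets N → ℝ} (hp : IsYMLagrangian 𝔤 p) (σ : Fin 3) (x : Space) :
    fderiv ℝ (fun x => p (jet g A x)) x (EuclideanSpace.single σ 1) = tder σ p (jet g A x) := by
  rw [fderiv_isPoly_jet hA g (IsPoly.of_mem hp.poly),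
    (isYMLagrangian_iff.mp hp).2.2 _ ((hA σ).2 x) _ (inLie_jet hA g x), smul_zero, add_zero]

end Algebra

/-! ### Rapidly decreasing fields -/

section Schwartz

variable {V W U : Type*} [NormedAddCommGroup V] [NormedSpace ℝ V] [NormedAddCommGroup W]
  [NormedSpace ℝ W] [NormedAddCommGroup U] [NormedSpace ℝ U]

/-- Functions which are rapidly decreasing together with all their derivatives. -/
def IsSchwartz (f : Space → V) : Prop := ∃ φ : 𝓢(Space, V), ⇑φ = f

lemma IsSchwartz.coe (φ : 𝓢(Space, V)) : IsSchwartz ⇑φ := ⟨φ, rfl⟩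

lemma IsSchwartz.contDiff {f : Space → V} (hf : IsSchwartz f) : ContDiff ℝ ∞ f := by
  obtain ⟨φ, rfl⟩ := hf
  exact φ.smooth ⊤

lemma IsSchwartz.integrable {f : Space → V} (hf : IsSchwartz f) : Integrable f := by
  obtain ⟨φ, rfl⟩ := hf
  exact φ.integrable

lemma IsSchwartz.zero : IsSchwartz (fun _ => (0 : V)) := ⟨0, rfl⟩

lemma IsSchwartz.add {f h : Space → V} (hf : IsSchwartz f) (hh : IsSchwartz h) :
    IsSchwartz (fun x => f x + h x) := by
  obtain ⟨φ, rfl⟩ := hf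
  obtain ⟨ψ, rfl⟩ := hh
  exact ⟨φ + ψ, rfl⟩

lemma IsSchwartz.sub {f h : Space → V} (hf : IsSchwartz f) (hh : IsSchwartz h) :
    IsSchwartz (fun x => f x - h x) := by
  obtain ⟨φ, rfl⟩ := hf
  obtain ⟨ψ, rfl⟩ := hh
  exact ⟨φ - ψ, rfl⟩

lemma IsSchwartz.const_smul {f : Space → V} (c : ℝ) (hf : IsSchwartz f) :
    IsSchwartz (fun x => c • f x) := by
  obtain ⟨φ, rfl⟩ := hf
  exact ⟨c • φ, rfl⟩

lemma IsSchwartz.sum {ι : Type*} (s : Finset ι) {f : ι → Space → V}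
    (h : ∀ i ∈ s, IsSchwartz (f i)) : IsSchwartz (fun x => ∑ i ∈ s, f i x) := by
  classical
  induction s using Finset.induction_on with
  | empty => simpa using IsSchwartz.zero
  | insert i s hi ih =>
    simp only [Finset.sum_insert hi]
    exact (h i (by simp)).add (ih fun j hj => h j (by simp [hj]))

lemma IsSchwartz.map {f : Space → V} (L : V →L[ℝ] W) (hf : IsSchwartz f) :
    IsSchwartz (fun x => L (f x)) := by
  obtain ⟨φ, rfl⟩ := hf
  exact ⟨SchwartzMap.postcompCLM L φ, rfl⟩

lemma IsSchwartz.bilin {f : Space → V} {h : Space → W} (B : V →L[ℝ] W →L[ℝ] U)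
    (hf : IsSchwartz f) (hh : IsSchwartz h) : IsSchwartz (fun x => B (f x) (h x)) := by
  obtain ⟨φ, rfl⟩ := hf
  obtain ⟨ψ, rfl⟩ := hh
  exact ⟨SchwartzMap.pairing B φ ψ, rfl⟩

lemma IsSchwartz.mul {R : Type*} [NormedRing R] [NormedAlgebra ℝ R] {f h : Space → R}
    (hf : IsSchwartz f) (hh : IsSchwartz h) : IsSchwartz (fun x => f x * h x) :=
  hf.bilin (ContinuousLinearMap.mul ℝ R) hh

lemma IsSchwartz.fderiv_apply {f : Space → V} (hf : IsSchwartz f) (e : Space) :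
    IsSchwartz (fun x => fderiv ℝ f x e) := by
  obtain ⟨φ, rfl⟩ := hf
  exact ⟨LineDeriv.lineDerivOp e φ, rfl⟩

/-- Integration by parts against the constant function `1`. -/
lemma IsSchwartz.integral_fderiv_apply {f : Space → V} (hf : IsSchwartz f) (e : Space) :
    ∫ x, fderiv ℝ f x e = 0 := by
  have hd := hf.contDiff.differentiable (by simp)
  have := integral_smul_fderiv_eq_neg_fderiv_smul_of_integrable (μ := volume) (v := e)
    (f := fun _ : Space => (1 : ℝ)) (g := f) (by simp)
    (by simpa using (hf.fderiv_apply e).integrable) (by simpa using hf.integrable)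
    (fun x _ => differentiableAt_const 1) (fun x _ => hd x)
  simpa using this

end Schwartz

section Algebra

variable {A : VField N} (hA : ∀ μ, IsSchwartz (A μ)) (g : ℝ)
include hA

lemma IsSchwartz.cov {f : Field N} (hf : IsSchwartz f) (μ : Fin 3) :
    IsSchwartz (cov g A μ f) :=
  (hf.fderiv_apply _).add ((((hA μ).mul hf).sub (hf.mul (hA μ))).const_smul g)

lemma isSchwartz_jet (j : JetIdx) : IsSchwartz (fun x => jet g A x j) := by
  obtain ⟨l, μ, ν⟩ := j
  induction l with
  | nil =>
    exact (((hA ν).fderiv_apply _).sub ((hA μ).fderiv_apply _)).add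
      ((((hA μ).mul (hA ν)).sub ((hA ν).mul (hA μ))).const_smul g)
  | cons σ l ih => exact ih.cov hA g σ

/-- The constant term does not decay and is subtracted. For products, `pq - p(0)q(0)` is rewritten
with the decaying differences `p - p(0)` and `q - q(0)`. -/
lemma isSchwartz_polyFun_jet {p : Jets N → ℝ} (hp : p ∈ polyFun N) :
    IsSchwartz (fun x => p (jet g A x) - p 0) := by
  induction hp using polyFun_induction with
  | gen j ℓ =>
    have h0 : (fun x => ℓ (jet g A x j) - ℓ ((0 : Jets N) j)) = fun x => ℓ (jet g A x j) := by
      ext x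
      rw [Pi.zero_apply, map_zero, sub_zero]
    refine h0 ▸ ?_
    exact (isSchwartz_jet hA g j).map (LinearMap.toContinuousLinearMap ℓ)
  | const c => simpa only [sub_self] using IsSchwartz.zero
  | add p q hp hq h1 h2 =>
    convert h1.add h2 using 2
    ring
  | mul p q hp hq h1 h2 =>
    have h := ((h1.mul h2).add (h1.const_smul (q 0))).add (h2.const_smul (p 0))
    have e : (fun x => p (jet g A x) * q (jet g A x) - p 0 * q 0) = fun x =>
        (p (jet g A x) - p 0) * (q (jet g A x) - q 0) + q 0 • (p (jet g A x) - p 0) +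
          p 0 • (q (jet g A x) - q 0) := by
      ext x
      simp only [smul_eq_mul]
      ring
    exact e ▸ h

lemma isSchwartz_isPoly_jet {V : Type*} [NormedAddCommGroup V] [NormedSpace ℝ V]
    [FiniteDimensional ℝ V] {Φ : Jets N → V} (hΦ : IsPoly Φ) (h0 : Φ 0 = 0) :
    IsSchwartz (fun x => Φ (jet g A x)) := by
  have : (fun x => Φ (jet g A x)) = fun x => ∑ i, ContinuousLinearMap.toSpanSingleton ℝ
      (Module.finBasis ℝ V i) ((Module.finBasis ℝ V).coord i (Φ (jet g A x))) := by
    ext x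
    exact ((Module.finBasis ℝ V).sum_repr _).symm
  rw [this]
  refine IsSchwartz.sum _ fun i _ => IsSchwartz.map _ ?_
  have := isSchwartz_polyFun_jet hA g (hΦ ((Module.finBasis ℝ V).coord i))
  simpa [h0] using this

end Algebra

/-! ### Actions of invariant Lagrangians -/

/-- Rapidly decreasing gauge fields with values in the gauge Lie algebra. -/
def IsGaugeField (𝔤 : LieSubalgebra ℝ (Mat N)) (A : VField N) : Prop :=
  (∀ μ, IsSchwartz (A μ)) ∧ ∀ μ x, A μ x ∈ 𝔤

/-- Two Lagrangians which give the same action. -/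
def ActionEq (𝔤 : LieSubalgebra ℝ (Mat N)) (g : ℝ) (p q : Jets N → ℝ) : Prop :=
  ∀ A : VField N, IsGaugeField 𝔤 A → ∫ x, p (jet g A x) = ∫ x, q (jet g A x)

section Action

variable {𝔤 : LieSubalgebra ℝ (Mat N)} {g : ℝ} {A : VField N} {p q : Jets N → ℝ}

lemma IsGaugeField.isSmoothField (hA : IsGaugeField 𝔤 A) (μ : Fin 3) : IsSmoothField 𝔤 (A μ) :=
  ⟨(hA.1 μ).contDiff, hA.2 μ⟩

lemma IsYMLagrangian.isSchwartz (hp : IsYMLagrangian 𝔤 p) (hA : IsGaugeField 𝔤 A) :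
    IsSchwartz (fun x => p (jet g A x)) :=
  isSchwartz_isPoly_jet hA.1 g (IsPoly.of_mem hp.poly) hp.map_zero

lemma IsYMLagrangian.integrable (hp : IsYMLagrangian 𝔤 p) (hA : IsGaugeField 𝔤 A) :
    Integrable (fun x => p (jet g A x)) := (hp.isSchwartz hA).integrable

/-- On an invariant Lagrangian the total covariant derivative is an ordinary derivative of a rapidly
decreasing function. -/
lemma IsYMLagrangian.integral_tder (hp : IsYMLagrangian 𝔤 p) (hA : IsGaugeField 𝔤 A)
    (σ : Fin 3) : ∫ x, tder σ p (jet g A x) = 0 := by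
  simp only [← pd_invariant_jet hA.isSmoothField g hp σ]
  exact (hp.isSchwartz hA).integral_fderiv_apply _

lemma ActionEq.of_jet
    (h : ∀ A : VField N, IsGaugeField 𝔤 A → ∀ x, p (jet g A x) = q (jet g A x)) :
    ActionEq 𝔤 g p q := fun A hA => by
  simp only [h A hA]

lemma ActionEq.of_eqOn (h : ∀ v, InLie 𝔤 v → p v = q v) : ActionEq 𝔤 g p q := fun A hA => by
  simp only [h _ (inLie_jet hA.isSmoothField g _)]

lemma ActionEq.trans {r : Jets N → ℝ} (h : ActionEq 𝔤 g p q) (h' : ActionEq 𝔤 g q r) :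
    ActionEq 𝔤 g p r := fun A hA => (h A hA).trans (h' A hA)

lemma ActionEq.symm (h : ActionEq 𝔤 g p q) : ActionEq 𝔤 g q p := fun A hA => (h A hA).symm

lemma ActionEq.add {p' q' : Jets N → ℝ} (hp : IsYMLagrangian 𝔤 p) (hq : IsYMLagrangian 𝔤 q)
    (hp' : IsYMLagrangian 𝔤 p') (hq' : IsYMLagrangian 𝔤 q') (h : ActionEq 𝔤 g p q)
    (h' : ActionEq 𝔤 g p' q') : ActionEq 𝔤 g (fun v => p v + p' v) (fun v => q v + q' v) :=
  fun A hA => by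
    rw [integral_add (hp.integrable hA) (hp'.integrable hA),
      integral_add (hq.integrable hA) (hq'.integrable hA), h A hA, h' A hA]

lemma ActionEq.const_mul (c : ℝ) (h : ActionEq 𝔤 g p q) :
    ActionEq 𝔤 g (fun v => c * p v) (fun v => c * q v) := fun A hA => by
  rw [integral_const_mul, integral_const_mul, h A hA]

lemma ActionEq.sum {ι : Type*} (s : Finset ι) {p q : ι → Jets N → ℝ}
    (hp : ∀ i ∈ s, IsYMLagrangian 𝔤 (p i)) (hq : ∀ i ∈ s, IsYMLagrangian 𝔤 (q i))
    (h : ∀ i ∈ s, ActionEq 𝔤 g (p i) (q i)) :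
    ActionEq 𝔤 g (fun v => ∑ i ∈ s, p i v) (fun v => ∑ i ∈ s, q i v) := fun A hA => by
  rw [integral_finsetSum _ fun i hi => (hp i hi).integrable hA,
    integral_finsetSum _ fun i hi => (hq i hi).integrable hA]
  exact Finset.sum_congr rfl fun i hi => h i hi A hA

variable [LieAlgebra.IsSemisimple ℝ 𝔤] {Θ Ψ : Jets N → Mat N}

lemma IsCovariant.retr_mul (h : IsCovariant 𝔤 Θ) (h' : IsCovariant 𝔤 Ψ) :
    IsYMLagrangian 𝔤 (fun v => retr (Θ v * Ψ v)) := isYMLagrangian_retr_mul h h' h.map_zero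

/-- Integration by parts. -/
lemma actionEq_integration_by_parts (h : IsCovariant 𝔤 Θ) (h' : IsCovariant 𝔤 Ψ) (σ : Fin 3) :
    ActionEq 𝔤 g (fun v => retr (Θ v * tder σ Ψ v)) (fun v => retr (-tder σ Θ v * Ψ v)) := by
  intro A hA
  have h1 := (h.retr_mul h').integral_tder (g := g) hA σ
  have h2 : tder σ (fun v => retr (Θ v * Ψ v)) =
      fun v => retr (Θ v * tder σ Ψ v) + retr (tder σ Θ v * Ψ v) := by
    ext v
    have hm := IsPoly.mul h.poly h'.poly
    rw [tder, map_dder hm, dder_matMul h.poly h'.poly, map_add, add_comm]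
    rfl
  rw [h2] at h1
  beta_reduce at h1
  rw [integral_add ((h.retr_mul (h'.tder σ)).integrable hA)
    (((h.tder σ).retr_mul h').integrable hA)] at h1
  simp only [neg_mul, map_neg, integral_neg]
  linarith

/-- The result of moving all derivatives `D_{σ₁} ⋯ D_{σ_k}` onto the local expression `Θ`. -/
def moveDerivatives : List (Fin 3) → (Jets N → Mat N) → Jets N → Mat N
  | [], Θ => Θ
  | σ :: l, Θ => moveDerivatives l (fun v => (-1 : ℝ) • tder σ Θ v)

omit [LieAlgebra.IsSemisimple ℝ 𝔤] in
lemma IsCovariant.moveDerivatives (h : IsCovariant 𝔤 Θ) (l : List (Fin 3)) :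
    IsCovariant 𝔤 (moveDerivatives l Θ) := by
  induction l generalizing Θ with
  | nil => exact h
  | cons σ l ih => exact ih ((h.tder σ).smul (-1))

omit [LieAlgebra.IsSemisimple ℝ 𝔤] in
lemma HasWeight.moveDerivatives {d k : ℕ} (hΘ : IsCovariant 𝔤 Θ) (h : HasWeight 𝔤 d k Θ)
    (l : List (Fin 3)) : HasWeight 𝔤 (d + l.length) k (moveDerivatives l Θ) := by
  induction l generalizing Θ d with
  | nil => exact h
  | cons σ l ih =>
    have := ih ((hΘ.tder σ).smul (-1)) ((h.tder hΘ.poly σ).smul (-1))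
    rwa [add_assoc, add_comm 1] at this

lemma actionEq_moveDerivatives (h : IsCovariant 𝔤 Θ) (l : List (Fin 3)) (i : Fin 3 × Fin 3) :
    ActionEq 𝔤 g (fun v => retr (Θ v * v (l, i)))
      (fun v => retr (moveDerivatives l Θ v * v ([], i))) := by
  induction l generalizing Θ with
  | nil => exact fun _ _ => rfl
  | cons σ l ih =>
    have h1 := actionEq_integration_by_parts (g := g) h (IsCovariant.coord (𝔤 := 𝔤) (l, i)) σ
    rw [tder_coord] at h1
    refine h1.trans (ActionEq.trans (ActionEq.of_eqOn fun v _ => ?_) (ih ((h.tder σ).smul (-1))))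
    rw [neg_one_smul]

end Action

/-! ### The Levi-Civita symbol -/

section LeviCivita

/-- The Vandermonde product of the three indices is antisymmetric and equals `2` at `(0, 1, 2)`. -/
lemma eps_eq (μ ν ρ : Fin 3) :
    eps μ ν ρ = ((ν : ℝ) - μ) * ((ρ : ℝ) - μ) * ((ρ : ℝ) - ν) / 2 := by
  let d : Fin 3 → Fin 3 → ℝ := fun i j => if i = j then 1 else 0
  have h : eps μ ν ρ = d μ 0 * d ν 1 * d ρ 2 - d μ 0 * d ν 2 * d ρ 1 - d μ 1 * d ν 0 * d ρ 2 +
      d μ 1 * d ν 2 * d ρ 0 + d μ 2 * d ν 0 * d ρ 1 - d μ 2 * d ν 1 * d ρ 0 :=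
    Matrix.det_fin_three _
  rw [h]
  fin_cases μ <;> fin_cases ν <;> fin_cases ρ <;> norm_num [d] <;> rfl

lemma eps_same_left (μ ν : Fin 3) : eps μ μ ν = 0 := by simp [eps_eq]

lemma eps_same_right (μ ν : Fin 3) : eps μ ν ν = 0 := by simp [eps_eq]

lemma eps_same_outer (μ ν : Fin 3) : eps μ ν μ = 0 := by simp [eps_eq]

lemma eps_zero_one_two : eps 0 1 2 = 1 := by norm_num [eps_eq]

lemma eps_one_two_zero : eps 1 2 0 = 1 := by norm_num [eps_eq]

lemma eps_two_zero_one : eps 2 0 1 = 1 := by norm_num [eps_eq]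

lemma eps_zero_two_one : eps 0 2 1 = -1 := by norm_num [eps_eq]

lemma eps_two_one_zero : eps 2 1 0 = -1 := by norm_num [eps_eq]

lemma eps_one_zero_two : eps 1 0 2 = -1 := by norm_num [eps_eq]

lemma sum_eps {M : Type*} [AddCommGroup M] [Module ℝ M] (f : Fin 3 → Fin 3 → Fin 3 → M) :
    ∑ μ, ∑ ν, ∑ ρ, eps μ ν ρ • f μ ν ρ =
      f 0 1 2 + f 1 2 0 + f 2 0 1 - f 0 2 1 - f 2 1 0 - f 1 0 2 := by
  simp only [Fin.sum_univ_three, eps_same_left, eps_same_right, eps_same_outer, eps_zero_one_two,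
    eps_one_two_zero, eps_two_zero_one, eps_zero_two_one, eps_two_one_zero, eps_one_zero_two,
    zero_smul, one_smul, neg_smul]
  abel

/-- Reconstruction of an antisymmetric tensor from its dual. -/
lemma sum_eps_eps (F : Fin 3 → Fin 3 → ℝ) (hF : ∀ ν ρ, F ρ ν = -F ν ρ) (a b : Fin 3) :
    1 / 2 * ∑ μ, ∑ ν, ∑ ρ, eps μ ν ρ * (eps μ a b * F ν ρ) = F a b := by
  simp only [← smul_eq_mul (eps _ _ _)]
  rw [sum_eps]
  simp only [smul_eq_mul]
  have h0 : ∀ ν, F ν ν = 0 := fun ν => by linarith [hF ν ν]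
  have h1 := hF 0 1
  have h2 := hF 0 2
  have h3 := hF 1 2
  fin_cases a <;> fin_cases b <;>
    simp [eps_same_left, eps_same_right, eps_same_outer, eps_zero_one_two, eps_one_two_zero,
      eps_two_zero_one, eps_zero_two_one, eps_two_one_zero, eps_one_zero_two, h0, h1, h2, h3] <;>
    ring

end LeviCivita

/-! ### Solving the linear equation of a single order -/

section Solve

variable {𝔤 : LieSubalgebra ℝ (Mat N)} {g : ℝ}

lemma fieldStrength_antisymm (A : VField N) (μ ν : Fin 3) (x : Space) :
    fieldStrength g A ν μ x = -fieldStrength g A μ ν x := by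
  rw [fieldStrength, fieldStrength, ← lie_skew (A ν x), smul_neg]
  abel

lemma jet_antisymm (A : VField N) (μ ν : Fin 3) (x : Space) :
    jet g A x ([], ν, μ) = -jet g A x ([], μ, ν) := fieldStrength_antisymm A μ ν x

/-- The Lagrangian `½ tr ε^{μνρ} θ_μ F_{νρ}`. -/
def linearLagrangian (θ : Fin 3 → Jets N → Mat N) (v : Jets N) : ℝ :=
  1 / 2 * ∑ μ, ∑ ν, ∑ ρ, eps μ ν ρ * retr (θ μ v * v ([], ν, ρ))

variable [LieAlgebra.IsSemisimple ℝ 𝔤]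

lemma isYMLagrangian_linearLagrangian {θ : Fin 3 → Jets N → Mat N}
    (h : ∀ μ, IsCovariant 𝔤 (θ μ)) : IsYMLagrangian 𝔤 (linearLagrangian θ) :=
  IsYMLagrangian.const_mul _ <| IsYMLagrangian.sum _ fun μ _ => IsYMLagrangian.sum _ fun _ _ =>
    IsYMLagrangian.sum _ fun _ _ => ((h μ).retr_mul (IsCovariant.coord _)).const_mul _

/-- Every Yang-Mills type action vanishes to first order on flat connections. -/
theorem exists_linearLagrangian (h𝔤 : ∀ X ∈ 𝔤, Matrix.conjTranspose X = -X) {p : Jets N → ℝ}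
    (hp : IsYMLagrangian 𝔤 p) :
    ∃ θ : Fin 3 → Jets N → Mat N, (∀ μ, IsCovariant 𝔤 (θ μ)) ∧
      ActionEq 𝔤 g (linearLagrangian θ) p ∧
      ∀ n, HasMassDim 𝔤 (n + 3) p → ∀ μ, HasMassDim 𝔤 (n + 1) (θ μ) := by
  obtain ⟨S, Q, hQ, hsum, hweight⟩ := exists_gradient h𝔤 hp
  have hW := fun j : JetIdx => (hQ j).moveDerivatives j.1
  -- Once the derivatives have been moved, the Lagrangian is a sum of `tr (W_j F_{ab})`. The dual
  -- `ε_{μab} W_j` reproduces each summand by `sum_eps_eps`, where antisymmetry of `F` is used.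
  refine ⟨fun μ v => ∑ j ∈ S, eps μ j.2.1 j.2.2 • moveDerivatives j.1 (Q j) v,
    fun μ => IsCovariant.sum _ fun j _ => (hW j).smul _, ?_, fun n hn μ => ?_⟩
  · have h1 : ActionEq 𝔤 g p (fun v => ∑ j ∈ S, retr (Q j v * v j)) :=
      ActionEq.of_eqOn hsum
    have h2 : ActionEq 𝔤 g (fun v => ∑ j ∈ S, retr (Q j v * v j))
        (fun v => ∑ j ∈ S, retr (moveDerivatives j.1 (Q j) v * v ([], j.2))) :=
      ActionEq.sum S (fun j _ => (hQ j).retr_mul (IsCovariant.coord j))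
        (fun j _ => (hW j).retr_mul (IsCovariant.coord _))
        fun j _ => actionEq_moveDerivatives (hQ j) j.1 j.2
    refine ((h1.trans h2).trans (ActionEq.of_jet fun A hA x => ?_)).symm
    simp only [linearLagrangian, Finset.sum_mul, smul_mul_assoc, map_sum, map_smul, smul_eq_mul,
      Finset.mul_sum]
    have h3 : ∀ j : JetIdx, _ := fun j => sum_eps_eps
      (fun ν ρ => retr (moveDerivatives j.1 (Q j) (jet g A x) * jet g A x ([], ν, ρ)))
      (fun ν ρ => by rw [jet_antisymm, mul_neg, map_neg]) j.2.1 j.2.2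
    calc _ = ∑ j ∈ S, _ := Finset.sum_congr rfl fun j _ => (h3 j).symm
      _ = _ := by
        simp only [Finset.mul_sum]
        rw [Finset.sum_comm]
        refine Finset.sum_congr rfl fun μ _ => ?_
        rw [Finset.sum_comm]
        refine Finset.sum_congr rfl fun ν _ => ?_
        rw [Finset.sum_comm]
  -- With `k` derivatives in the variable `j`, the gradient has dimension `n + 3 - (k + 2)`, and the
  -- moved derivatives add `k`: the total is `n + 1`.
  · refine HasMassDim.sum _ fun j _ => HasMassDim.smul _ (HasWeight.hasMassDim
      (k := j.1.length + 2) (hW j) ?_)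
    have := (hweight (n + 3) hn j).moveDerivatives (hQ j) j.1
    rwa [show n + 3 + j.1.length = n + 1 + (j.1.length + 2) by ring] at this

end Solve

/-! ### Infinitesimal gauge transformations -/

section Gauge

lemma pd_lie {a b : Field N} (ha : ContDiff ℝ ∞ a) (hb : ContDiff ℝ ∞ b) (μ : Fin 3) (x : Space) :
    pd μ (fun y => ⁅a y, b y⁆) x = ⁅pd μ a x, b x⁆ + ⁅a x, pd μ b x⁆ := by
  have h1 := hasDerivAt_pd ha x (EuclideanSpace.single μ 1)
  have h2 := hasDerivAt_pd hb x (EuclideanSpace.single μ 1)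
  have h3 := hasDerivAt_pd (contDiff_lie ha hb) x (EuclideanSpace.single μ 1)
  have h4 := h3.unique ((h1.mul h2).sub (h2.mul h1))
  simp only [zero_smul, add_zero] at h4
  refine h4.trans ?_
  simp only [Ring.lie_def]
  change pd μ a x * b x + a x * pd μ b x - (pd μ b x * a x + b x * pd μ a x) = _
  abel

lemma pd_add {a b : Field N} (ha : ContDiff ℝ ∞ a) (hb : ContDiff ℝ ∞ b) (μ : Fin 3) (x : Space) :
    pd μ (fun y => a y + b y) x = pd μ a x + pd μ b x :=
  (hasDerivAt_pd (ha.add hb) x (EuclideanSpace.single μ 1)).unique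
    ((hasDerivAt_pd ha x _).add (hasDerivAt_pd hb x _))

lemma pd_const_smul {a : Field N} (ha : ContDiff ℝ ∞ a) (c : ℝ) (μ : Fin 3) (x : Space) :
    pd μ (fun y => c • a y) x = c • pd μ a x :=
  (hasDerivAt_pd (ha.const_smul c) x (EuclideanSpace.single μ 1)).unique
    ((hasDerivAt_pd ha x _).const_smul c)

/-- One parameter families of fields which are jointly smooth. -/
def IsSmoothFamily (f : ℝ → Field N) : Prop := ContDiff ℝ ∞ fun z : ℝ × Space => f z.1 z.2

lemma IsSmoothFamily.pd {f : ℝ → Field N} (hf : IsSmoothFamily f) (μ : Fin 3) :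
    IsSmoothFamily fun t => pd μ (f t) := by
  have h1 : ContDiff ℝ ∞ (Function.uncurry fun (z : ℝ × Space) (y : Space) => f z.1 y) :=
    ContDiff.comp (g := fun z : ℝ × Space => f z.1 z.2) hf
      ((contDiff_fst.comp contDiff_fst).prodMk contDiff_snd)
  exact ContDiff.fderiv_apply h1 contDiff_snd contDiff_const (by simp)

lemma IsSmoothFamily.lie {f h : ℝ → Field N} (hf : IsSmoothFamily f) (hh : IsSmoothFamily h) :
    IsSmoothFamily fun t x => ⁅f t x, h t x⁆ :=
  (ContDiff.mul hf hh).sub (ContDiff.mul hh hf)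

/-- Variations commute with partial derivatives. -/
lemma hasDerivAt_fderiv_apply {V : Type*} [NormedAddCommGroup V] [NormedSpace ℝ V]
    {f : ℝ → Space → V} (hf : ContDiff ℝ ∞ fun z : ℝ × Space => f z.1 z.2) {h : Space → V}
    (hd : ∀ x, HasDerivAt (fun t => f t x) (h x) 0) (e x : Space) :
    HasDerivAt (fun t => fderiv ℝ (f t) x e) (fderiv ℝ h x e) 0 := by
  set G : ℝ × Space → V := fun z => f z.1 z.2 with hG
  have hGd := hf.differentiable (by simp)
  have hG2 : ContDiff ℝ ∞ (fderiv ℝ G) := hf.fderiv_right (by simp)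
  have hG2d := hG2.differentiable (by simp)
  have l1 : ∀ (t : ℝ) (y : Space), HasDerivAt (fun s : ℝ => (t + s, y)) ((1 : ℝ), (0 : Space)) 0 :=
    fun t y => ((hasDerivAt_id (0 : ℝ)).const_add t).prodMk (hasDerivAt_const _ _)
  have l2 : ∀ (t : ℝ) (y : Space), HasDerivAt (fun s : ℝ => (t, y + s • e)) ((0 : ℝ), e) 0 := by
    intro t y
    have := ((hasDerivAt_id (0 : ℝ)).smul_const e).const_add y
    rw [one_smul] at this
    exact (hasDerivAt_const _ _).prodMk this
  have hft : ∀ t, ContDiff ℝ ∞ (f t) := fun t =>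
    ContDiff.comp (g := G) hf (contDiff_const.prodMk contDiff_id)
  have e1 : ∀ t y, fderiv ℝ (f t) y e = fderiv ℝ G (t, y) (0, e) := fun t y => by
    refine (hasDerivAt_pd (hft t) y e).unique ?_
    refine HasFDerivAt.comp_hasDerivAt (l := G) 0 ?_ (l2 t y)
    rw [zero_smul, add_zero]
    exact (hGd _).hasFDerivAt
  have e2 : h = fun y => fderiv ℝ G (0, y) (1, 0) := funext fun y => by
    refine (hd y).unique ?_
    have := HasFDerivAt.comp_hasDerivAt (l := G) 0 (by rw [zero_add]; exact (hGd _).hasFDerivAt)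
      (l1 0 y)
    simpa [Function.comp_def] using this
  -- By `e1` and `e2` the variation and the space derivative are partial derivatives of the single
  -- function `G` on `ℝ × Space`, so the claim is the symmetry of its second derivative.
  have sym : fderiv ℝ (fderiv ℝ G) (0, x) (1, 0) (0, e) =
      fderiv ℝ (fderiv ℝ G) (0, x) (0, e) (1, 0) :=
    (hf.contDiffAt.isSymmSndFDerivAt
      (by rw [minSmoothness_of_isRCLikeNormedField]
          exact WithTop.coe_le_coe.2 (le_top (a := (2 : ℕ∞))))) _ _
  simp only [e1]
  have d1 : HasDerivAt (fun s : ℝ => fderiv ℝ G (0 + s, x) (0, e))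
      (fderiv ℝ (fderiv ℝ G) (0, x) (1, 0) (0, e)) 0 := by
    have := HasFDerivAt.comp_hasDerivAt (l := fderiv ℝ G) 0
      (by rw [zero_add]; exact (hG2d _).hasFDerivAt) (l1 0 x)
    exact ((ContinuousLinearMap.apply ℝ V ((0 : ℝ), e)).hasFDerivAt.comp_hasDerivAt 0 this)
  have d2 : HasDerivAt (fun s : ℝ => fderiv ℝ G (0, x + s • e) (1, 0))
      (fderiv ℝ (fderiv ℝ G) (0, x) (0, e) (1, 0)) 0 := by
    have := HasFDerivAt.comp_hasDerivAt (l := fderiv ℝ G) 0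
      (by rw [zero_smul, add_zero]; exact (hG2d _).hasFDerivAt) (l2 0 x)
    exact ((ContinuousLinearMap.apply ℝ V ((1 : ℝ), (0 : Space))).hasFDerivAt.comp_hasDerivAt
      0 this)
  have e3 : fderiv ℝ h x e = fderiv ℝ (fderiv ℝ G) (0, x) (0, e) (1, 0) := by
    rw [e2]
    refine (hasDerivAt_pd ?_ x e).unique d2
    exact (hG2.comp (contDiff_const.prodMk contDiff_id)).clm_apply contDiff_const
  rw [e3, ← sym]
  simpa using d1

/-- The case of the family of translates `f (y + t • e)`, whose variation at `t = 0` is the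
derivative in the direction `e`. -/
lemma fderiv_fderiv_apply_comm {V : Type*} [NormedAddCommGroup V] [NormedSpace ℝ V]
    {f : Space → V} (hf : ContDiff ℝ ∞ f) (d e x : Space) :
    fderiv ℝ (fun y => fderiv ℝ f y e) x d = fderiv ℝ (fun y => fderiv ℝ f y d) x e := by
  have h1 : ContDiff ℝ ∞ fun z : ℝ × Space => f (z.2 + z.1 • e) :=
    hf.comp (contDiff_snd.add (contDiff_fst.smul contDiff_const))
  have h2 := hasDerivAt_fderiv_apply (f := fun t y => f (y + t • e)) h1
    (fun y => hasDerivAt_pd hf y e) d x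
  refine h2.unique ?_
  have h3 : ContDiff ℝ ∞ fun y => fderiv ℝ f y d :=
    (hf.fderiv_right (m := ∞) (by simp)).clm_apply contDiff_const
  refine (hasDerivAt_pd h3 x e).congr_of_eventuallyEq (Filter.Eventually.of_forall fun t => ?_)
  simp only [fderiv_comp_add_right]

lemma IsSmoothFamily.hasDerivAt_pd {f : ℝ → Field N} (hf : IsSmoothFamily f) {h : Field N}
    (hd : ∀ x, HasDerivAt (fun t => f t x) (h x) 0) (μ : Fin 3) (x : Space) :
    HasDerivAt (fun t => ChernSimons.pd μ (f t) x) (ChernSimons.pd μ h x) 0 :=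
  hasDerivAt_fderiv_apply hf hd _ x

lemma pd_comm {f : Field N} (hf : ContDiff ℝ ∞ f) (μ ν : Fin 3) (x : Space) :
    pd μ (pd ν f) x = pd ν (pd μ f) x := fderiv_fderiv_apply_comm hf _ _ x

variable {𝔤 : LieSubalgebra ℝ (Mat N)} {A : VField N} (hA : ∀ μ, IsSmoothField 𝔤 (A μ))
  {η : Field N} (hη : IsSmoothField 𝔤 η) (g : ℝ)
include hA hη

/-- Induction on the number of derivatives. Joint smoothness in the parameter is carried along
because the variation has to commute with the next partial derivative. In the base case the second
derivatives of `η` cancel by antisymmetry. -/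
lemma gaugeVariation_jet (j : JetIdx) :
    IsSmoothFamily (fun t x => jet g (fun ν => A ν + t • cov g A ν η) x j) ∧
      ∀ x, HasDerivAt (fun t : ℝ => jet g (fun ν => A ν + t • cov g A ν η) x j)
        (g • ⁅jet g A x j, η x⁆) 0 := by
  have hc : ∀ ν, ContDiff ℝ ∞ (cov g A ν η) := fun ν => (hη.cov hA g ν).1
  have hAt : ∀ ν, IsSmoothFamily fun t => A ν + t • cov g A ν η := fun ν =>
    ((hA ν).1.comp contDiff_snd).add (contDiff_fst.smul ((hc ν).comp contDiff_snd))
  have hAd : ∀ ν x, HasDerivAt (fun t : ℝ => (A ν + t • cov g A ν η) x) (cov g A ν η x) 0 := by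
    intro ν x
    have := ((hasDerivAt_id (0 : ℝ)).smul_const (cov g A ν η x)).const_add (A ν x)
    rwa [one_smul] at this
  have hlie : ∀ {f h : ℝ → Field N} {f' h' : Mat N} {x : Space},
      HasDerivAt (fun t => f t x) f' 0 → HasDerivAt (fun t => h t x) h' 0 →
      HasDerivAt (fun t => ⁅f t x, h t x⁆) (⁅f', h 0 x⁆ + ⁅f 0 x, h'⁆) 0 := by
    intro f h f' h' x h1 h2
    refine ((h1.mul h2).sub (h2.mul h1)).congr_deriv ?_
    simp only [Ring.lie_def]
    abel
  obtain ⟨l, μ, ν⟩ := j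
  induction l with
  | nil =>
    constructor
    · exact (((hAt ν).pd μ).sub ((hAt μ).pd ν)).add (((hAt μ).lie (hAt ν)).const_smul g)
    · intro x
      have h1 := (((hAt ν).hasDerivAt_pd (hAd ν) μ x).sub ((hAt μ).hasDerivAt_pd (hAd μ) ν x)).add
        ((hlie (hAd μ x) (hAd ν x)).const_smul g)
      refine h1.congr_deriv ?_
      have h2 : ∀ α β, pd α (cov g A β η) x =
          pd α (pd β η) x + g • (⁅pd α (A β) x, η x⁆ + ⁅A β x, pd α η x⁆) := fun α β => by
        rw [← pd_lie (hA β).1 hη.1, ← pd_const_smul (contDiff_lie (hA β).1 hη.1),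
          ← pd_add (contDiff_pd hη.1 β) ((contDiff_lie (hA β).1 hη.1).const_smul g)]
        rfl
      change _ = g • ⁅fieldStrength g A μ ν x, η x⁆
      rw [h2, h2, pd_comm hη.1 μ ν]
      simp only [cov, fieldStrength, zero_smul, add_zero, Ring.lie_def, mul_add, add_mul, mul_sub,
        sub_mul, smul_add, smul_sub, mul_smul_comm, smul_mul_assoc, mul_assoc]
      abel
  | cons σ l ih =>
    obtain ⟨ih1, ih2⟩ := ih
    constructor
    · exact (ih1.pd σ).add (((hAt σ).lie ih1).const_smul g)
    · intro x
      have h1 := (ih1.hasDerivAt_pd ih2 σ x).add ((hlie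
        (h := fun t x => jet g (fun ν => A ν + t • cov g A ν η) x (l, μ, ν)) (hAd σ x)
          (ih2 x)).const_smul g)
      refine h1.congr_deriv ?_
      have hf := (isSmoothField_jet hA g (l, μ, ν)).1
      rw [pd_const_smul (contDiff_lie hf hη.1), pd_lie hf hη.1]
      change _ = g • ⁅cov g A σ (fun x => jet g A x (l, μ, ν)) x, η x⁆
      simp only [cov, zero_smul, add_zero, Ring.lie_def, mul_add, add_mul, mul_sub,
        sub_mul, smul_add, smul_sub, mul_smul_comm, smul_mul_assoc, mul_assoc]
      abel

-- At order zero this is the transformation law of `A` itself. At higher orders the jets rotate in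
-- the adjoint representation and `ϑ n μ` follows by equivariance, so no inhomogeneous term appears.
omit hA hη in
lemma transformsAsConnection {ϑ : ℕ → Fin 3 → Jets N → Mat N}
    (h : ∀ n, 1 ≤ n → ∀ μ, IsCovariant 𝔤 (ϑ n μ)) :
    TransformsAsConnection 𝔤 g (redefinition g ϑ) := by
  intro A η hA hη n μ x
  rcases Nat.eq_zero_or_pos n with rfl | hn
  · have h1 := ((hasDerivAt_id (0 : ℝ)).smul_const (cov g A μ η x)).const_add (A μ x)
    rw [one_smul] at h1
    simp only [redefinition, PowerSeries.coeff_mk, if_true]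
    refine h1.congr_deriv ?_
    simp [cov, Ring.lie_def]
  · have h1 : HasJetDerivAt (fun t : ℝ => jet g (fun ν => A ν + t • cov g A ν η) x)
        (g • adj (η x) (jet g A x)) 0 := fun j => (gaugeVariation_jet hA hη g j).2 x
    have hp : IsPoly (ϑ n μ) := (h n hn μ).poly
    have h2 := hp.hasDerivAt h1
    simp only [zero_smul, add_zero] at h2
    have hn' : n ≠ 0 := hn.ne'
    simp only [redefinition, PowerSeries.coeff_mk, if_neg hn']
    refine h2.congr_deriv ?_
    rw [dder_smul_right' hp, (h n hn μ).dder_adj (hη.2 x) (inLie_jet hA g x)]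
    simp [PowerSeries.coeff_C, hn', Ring.lie_def]

end Gauge

/-! ### Formal power series of local expressions -/

section Series

/-- The formal power series `∑_{n ≥ 1} m^{-n} ϑ^n_μ` of local expressions. -/
def correction (ϑ : ℕ → Fin 3 → Jets N → Mat N) (μ : Fin 3) : PowerSeries (Jets N → Mat N) :=
  PowerSeries.mk fun n => if n = 0 then 0 else ϑ n μ

/-- The total covariant derivative, coefficient by coefficient. -/
def tderSeries (σ : Fin 3) (Ψ : PowerSeries (Jets N → Mat N)) : PowerSeries (Jets N → Mat N) :=
  PowerSeries.mk fun n => tder σ (PowerSeries.coeff n Ψ)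

/-- `D_ν θ_ρ + (g/3) [θ_ν, θ_ρ]`. -/
def curl (g : ℝ) (θ : Fin 3 → PowerSeries (Jets N → Mat N)) (ν ρ : Fin 3) :
    PowerSeries (Jets N → Mat N) :=
  tderSeries ν (θ ρ) + (g / 3) • (θ ν * θ ρ - θ ρ * θ ν)

/-- The coefficient of `m^{-n}` in `½ tr ε^{μνρ} θ_μ (D_ν θ_ρ + (g/3) [θ_ν, θ_ρ])`. -/
def interactionLagrangian (g : ℝ) (ϑ : ℕ → Fin 3 → Jets N → Mat N) (n : ℕ) (v : Jets N) : ℝ :=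
  1 / 2 * ∑ μ, ∑ ν, ∑ ρ, eps μ ν ρ *
    retr (PowerSeries.coeff n (correction ϑ μ * curl g (correction ϑ) ν ρ) v)

variable {𝔤 : LieSubalgebra ℝ (Mat N)} {g : ℝ}

lemma coeff_mul_apply {α : Type*} (a b : PowerSeries (α → Mat N)) (n : ℕ) (v : α) :
    PowerSeries.coeff n (a * b) v =
      ∑ i ∈ Finset.HasAntidiagonal.antidiagonal n,
        PowerSeries.coeff i.1 a v * PowerSeries.coeff i.2 b v := by
  rw [PowerSeries.coeff_mul, Finset.sum_apply]
  rfl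

lemma coeff_commutator_apply {α : Type*} (a b : PowerSeries (α → Mat N)) (n : ℕ) (v : α) :
    PowerSeries.coeff n (a * b - b * a) v =
      ∑ i ∈ Finset.HasAntidiagonal.antidiagonal n,
        ⁅PowerSeries.coeff i.1 a v, PowerSeries.coeff i.2 b v⁆ := by
  rw [map_sub, Pi.sub_apply, coeff_mul_apply, coeff_mul_apply,
    ← Finset.Nat.sum_antidiagonal_swap (n := n) (f := fun i =>
      PowerSeries.coeff i.1 b v * PowerSeries.coeff i.2 a v), ← Finset.sum_sub_distrib]
  rfl

/-- Formal power series all of whose coefficients are covariant. -/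
def IsCovariantSeries (𝔤 : LieSubalgebra ℝ (Mat N)) (Ψ : PowerSeries (Jets N → Mat N)) : Prop :=
  ∀ n, IsCovariant 𝔤 (PowerSeries.coeff n Ψ)

lemma isCovariantSeries_correction {ϑ : ℕ → Fin 3 → Jets N → Mat N}
    (h : ∀ n, 1 ≤ n → ∀ μ, IsCovariant 𝔤 (ϑ n μ)) (μ : Fin 3) :
    IsCovariantSeries 𝔤 (correction ϑ μ) := fun n => by
  rw [correction, PowerSeries.coeff_mk]
  split_ifs with hn
  · exact IsCovariant.zero
  · exact h n (Nat.pos_of_ne_zero hn) μ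

lemma isCovariantSeries_curl {θ : Fin 3 → PowerSeries (Jets N → Mat N)}
    (h : ∀ μ, IsCovariantSeries 𝔤 (θ μ)) (ν ρ : Fin 3) : IsCovariantSeries 𝔤 (curl g θ ν ρ) := by
  intro n
  have h1 : IsCovariant 𝔤 (tder ν (PowerSeries.coeff n (θ ρ))) := (h ρ n).tder ν
  have h2 : IsCovariant 𝔤 (PowerSeries.coeff n (θ ν * θ ρ - θ ρ * θ ν)) := by
    have : PowerSeries.coeff n (θ ν * θ ρ - θ ρ * θ ν) = fun v =>
        ∑ i ∈ Finset.HasAntidiagonal.antidiagonal n,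
          ⁅PowerSeries.coeff i.1 (θ ν) v, PowerSeries.coeff i.2 (θ ρ) v⁆ :=
      funext fun v => coeff_commutator_apply _ _ n v
    rw [this]
    exact IsCovariant.sum _ fun i _ => (h ν i.1).lie (h ρ i.2)
  have h3 : PowerSeries.coeff n (curl g θ ν ρ) = fun v => tder ν (PowerSeries.coeff n (θ ρ)) v +
      (g / 3) • PowerSeries.coeff n (θ ν * θ ρ - θ ρ * θ ν) v := by
    ext1 v
    simp only [curl, tderSeries, map_add, PowerSeries.coeff_mk, Pi.add_apply,
      PowerSeries.coeff_smul]
    rfl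
  rw [h3]
  exact h1.add (h2.smul _)

lemma trace_coeff_mul (h𝔤 : ∀ X ∈ 𝔤, Matrix.conjTranspose X = -X)
    {a b : PowerSeries (Jets N → Mat N)} (ha : IsCovariantSeries 𝔤 a)
    (hb : IsCovariantSeries 𝔤 b) (n : ℕ) {v : Jets N} (hv : InLie 𝔤 v) :
    Matrix.trace (PowerSeries.coeff n (a * b) v) = (retr (PowerSeries.coeff n (a * b) v) : ℂ) := by
  rw [coeff_mul_apply, Matrix.trace_sum, map_sum, Complex.ofReal_sum]
  exact Finset.sum_congr rfl fun i _ =>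
    trace_eq_retr (h𝔤 _ ((ha i.1).mem v hv)) (h𝔤 _ ((hb i.2).mem v hv))

lemma isYMLagrangian_retr_coeff_mul [LieAlgebra.IsSemisimple ℝ 𝔤]
    {a b : PowerSeries (Jets N → Mat N)} (ha : IsCovariantSeries 𝔤 a)
    (hb : IsCovariantSeries 𝔤 b) (n : ℕ) :
    IsYMLagrangian 𝔤 (fun v => retr (PowerSeries.coeff n (a * b) v)) := by
  simp only [coeff_mul_apply, map_sum]
  exact IsYMLagrangian.sum _ fun i _ => (ha i.1).retr_mul (hb i.2)

lemma isYMLagrangian_interactionLagrangian [LieAlgebra.IsSemisimple ℝ 𝔤]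
    {ϑ : ℕ → Fin 3 → Jets N → Mat N}
    (h : ∀ n, 1 ≤ n → ∀ μ, IsCovariant 𝔤 (ϑ n μ)) (n : ℕ) :
    IsYMLagrangian 𝔤 (interactionLagrangian g ϑ n) :=
  IsYMLagrangian.const_mul _ <| IsYMLagrangian.sum _ fun _ _ => IsYMLagrangian.sum _ fun _ _ =>
    IsYMLagrangian.sum _ fun _ _ => (isYMLagrangian_retr_coeff_mul
      (isCovariantSeries_correction h _)
      (isCovariantSeries_curl (isCovariantSeries_correction h) _ _) n).const_mul _

/-! ### Dependence on the lower coefficients -/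

/-- The coefficients of index `n` would be multiplied by constant terms, which vanish; only strictly
lower coefficients contribute. -/
lemma coeff_mul_congr_of_lt {R : Type*} [Semiring R] {a b a' b' : PowerSeries R} {n : ℕ}
    (ha : ∀ k < n, PowerSeries.coeff k a = PowerSeries.coeff k a')
    (hb : ∀ k < n, PowerSeries.coeff k b = PowerSeries.coeff k b')
    (ha0 : PowerSeries.coeff 0 a = 0) (hb0 : PowerSeries.coeff 0 b = 0)
    (ha0' : PowerSeries.coeff 0 a' = 0) (hb0' : PowerSeries.coeff 0 b' = 0) :
    PowerSeries.coeff n (a * b) = PowerSeries.coeff n (a' * b') := by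
  rw [PowerSeries.coeff_mul, PowerSeries.coeff_mul]
  refine Finset.sum_congr rfl fun i hi => ?_
  rw [Finset.HasAntidiagonal.mem_antidiagonal] at hi
  rcases Nat.eq_zero_or_pos i.1 with h1 | h1
  · rw [h1, ha0, ha0', zero_mul, zero_mul]
  · rcases Nat.eq_zero_or_pos i.2 with h2 | h2
    · rw [h2, hb0, hb0', mul_zero, mul_zero]
    · rw [ha _ (by omega), hb _ (by omega)]

lemma coeff_mul_congr {R : Type*} [Semiring R] {a b a' b' : PowerSeries R} {n : ℕ}
    (ha : ∀ k ≤ n, PowerSeries.coeff k a = PowerSeries.coeff k a')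
    (hb : ∀ k ≤ n, PowerSeries.coeff k b = PowerSeries.coeff k b') :
    PowerSeries.coeff n (a * b) = PowerSeries.coeff n (a' * b') := by
  rw [PowerSeries.coeff_mul, PowerSeries.coeff_mul]
  refine Finset.sum_congr rfl fun i hi => ?_
  rw [Finset.HasAntidiagonal.mem_antidiagonal] at hi
  rw [ha _ (by omega), hb _ (by omega)]

lemma coeff_zero_correction (ϑ : ℕ → Fin 3 → Jets N → Mat N) (μ : Fin 3) :
    PowerSeries.coeff 0 (correction ϑ μ) = 0 := by
  rw [correction, PowerSeries.coeff_mk, if_pos rfl]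

lemma tder_zero (σ : Fin 3) : tder σ (0 : Jets N → Mat N) = 0 := by
  ext1 v
  exact deriv_const _ _

lemma coeff_zero_curl (ϑ : ℕ → Fin 3 → Jets N → Mat N) (ν ρ : Fin 3) :
    PowerSeries.coeff 0 (curl g (correction ϑ) ν ρ) = 0 := by
  have h (μ : Fin 3) : PowerSeries.constantCoeff (correction ϑ μ) = 0 := by
    rw [← PowerSeries.coeff_zero_eq_constantCoeff_apply, coeff_zero_correction]
  simp only [curl, tderSeries, map_add, PowerSeries.coeff_mk, PowerSeries.coeff_smul, map_sub,
    coeff_zero_correction, tder_zero]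
  simp [h]

lemma coeff_correction_congr {ϑ ϑ' : ℕ → Fin 3 → Jets N → Mat N} {k : ℕ}
    (h : 1 ≤ k → ϑ k = ϑ' k) (μ : Fin 3) :
    PowerSeries.coeff k (correction ϑ μ) = PowerSeries.coeff k (correction ϑ' μ) := by
  rw [correction, correction, PowerSeries.coeff_mk, PowerSeries.coeff_mk]
  split_ifs with hk
  · rfl
  · rw [h (Nat.pos_of_ne_zero hk)]

/-- Both `correction` and `curl` start at order one, so their product at order `n` contains no
coefficient of index `n`. This makes the recursion triangular. -/
lemma interactionLagrangian_congr {ϑ ϑ' : ℕ → Fin 3 → Jets N → Mat N} {n : ℕ}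
    (h : ∀ k, 1 ≤ k → k < n → ϑ k = ϑ' k) :
    interactionLagrangian g ϑ n = interactionLagrangian g ϑ' n := by
  have h1 : ∀ μ, ∀ k < n, PowerSeries.coeff k (correction ϑ μ) =
      PowerSeries.coeff k (correction ϑ' μ) :=
    fun μ k hk => coeff_correction_congr (fun h0 => h k h0 hk) μ
  have h2 : ∀ ν ρ, ∀ k < n, PowerSeries.coeff k (curl g (correction ϑ) ν ρ) =
      PowerSeries.coeff k (curl g (correction ϑ') ν ρ) := by
    intro ν ρ k hk
    have h3 : ∀ μ, ∀ l ≤ k, PowerSeries.coeff l (correction ϑ μ) =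
      PowerSeries.coeff l (correction ϑ' μ) := fun μ l hl => h1 μ l (by omega)
    simp only [curl, tderSeries, map_add, PowerSeries.coeff_mk, PowerSeries.coeff_smul, map_sub,
      h1 ρ k hk, coeff_mul_congr (h3 ν) (h3 ρ), coeff_mul_congr (h3 ρ) (h3 ν)]
  ext v
  simp only [interactionLagrangian, coeff_mul_congr_of_lt (h1 _) (h2 _ _)
    (coeff_zero_correction _ _) (coeff_zero_curl _ _ _) (coeff_zero_correction _ _)
    (coeff_zero_curl _ _ _)]

/-! ### Mass dimensions of series -/

/-- The coefficient of `m^{-n}` has mass dimension `n + e`. -/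
def HasSeriesDim (𝔤 : LieSubalgebra ℝ (Mat N)) (e : ℕ) (Ψ : PowerSeries (Jets N → Mat N)) : Prop :=
  ∀ n, HasMassDim 𝔤 (n + e) (PowerSeries.coeff n Ψ)

lemma hasSeriesDim_correction {ϑ : ℕ → Fin 3 → Jets N → Mat N}
    (h : ∀ n, 1 ≤ n → ∀ μ, HasMassDim 𝔤 (n + 1) (ϑ n μ)) (μ : Fin 3) :
    HasSeriesDim 𝔤 1 (correction ϑ μ) := fun n => by
  rw [correction, PowerSeries.coeff_mk]
  split_ifs with hn
  · exact HasMassDim.zero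
  · exact h n (Nat.pos_of_ne_zero hn) μ

lemma HasSeriesDim.mul {a b : PowerSeries (Jets N → Mat N)} {d e : ℕ} (ha : HasSeriesDim 𝔤 d a)
    (hb : HasSeriesDim 𝔤 e b) : HasSeriesDim 𝔤 (d + e) (a * b) := fun n => by
  have : PowerSeries.coeff n (a * b) = fun v =>
      ∑ i ∈ Finset.HasAntidiagonal.antidiagonal n,
        PowerSeries.coeff i.1 a v * PowerSeries.coeff i.2 b v :=
    funext fun v => coeff_mul_apply a b n v
  rw [this]
  refine HasMassDim.sum _ fun i hi => ?_
  rw [Finset.HasAntidiagonal.mem_antidiagonal] at hi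
  have := (ha i.1).mul (hb i.2)
  rwa [show i.1 + d + (i.2 + e) = n + (d + e) by omega] at this

lemma hasSeriesDim_curl {θ : Fin 3 → PowerSeries (Jets N → Mat N)}
    (hp : ∀ μ, IsCovariantSeries 𝔤 (θ μ)) (h : ∀ μ, HasSeriesDim 𝔤 1 (θ μ)) (ν ρ : Fin 3) :
    HasSeriesDim 𝔤 2 (curl g θ ν ρ) := fun n => by
  have h1 : HasMassDim 𝔤 (n + 2) (tder ν (PowerSeries.coeff n (θ ρ))) :=
    (h ρ n).tder (hp ρ n).poly ν
  have h2 : HasMassDim 𝔤 (n + 2) (PowerSeries.coeff n (θ ν * θ ρ - θ ρ * θ ν)) := by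
    rw [map_sub]
    exact ((h ν).mul (h ρ) n).sub ((h ρ).mul (h ν) n)
  have h3 : PowerSeries.coeff n (curl g θ ν ρ) = fun v => tder ν (PowerSeries.coeff n (θ ρ)) v +
      (g / 3) • PowerSeries.coeff n (θ ν * θ ρ - θ ρ * θ ν) v := by
    ext1 v
    simp only [curl, tderSeries, map_add, PowerSeries.coeff_mk, Pi.add_apply,
      PowerSeries.coeff_smul]
    rfl
  rw [h3]
  exact h1.add (h2.smul _)

lemma hasMassDim_interactionLagrangian {ϑ : ℕ → Fin 3 → Jets N → Mat N}
    (hp : ∀ n, 1 ≤ n → ∀ μ, IsCovariant 𝔤 (ϑ n μ))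
    (h : ∀ n, 1 ≤ n → ∀ μ, HasMassDim 𝔤 (n + 1) (ϑ n μ)) (n : ℕ) :
    HasMassDim 𝔤 (n + 3) (interactionLagrangian g ϑ n) :=
  HasMassDim.smul (V := ℝ) _ <| HasMassDim.sum _ fun _ _ => HasMassDim.sum _ fun _ _ =>
    HasMassDim.sum _ fun _ _ => HasMassDim.smul (V := ℝ) _ <| HasMassDim.map retr <|
      (hasSeriesDim_correction h _).mul (hasSeriesDim_curl (isCovariantSeries_correction hp)
        (hasSeriesDim_correction h) _ _) n

/-! ### Expansion of the Chern-Simons density -/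

/-- Expansion of the Chern-Simons form `a da + ⅔ g a³` at `a = A + t`, up to cyclic permutations
under the trace `T`; `W` is a total derivative. -/
lemma chernSimons_expansion {R M : Type*} [Ring R] [Algebra ℝ R] [AddCommGroup M] [Module ℝ M]
    (T : R →ₗ[ℝ] M) (hT : ∀ x y, T (x * y) = T (y * x)) (g : ℝ) (A t : Fin 3 → R)
    (DA Dt : Fin 3 → Fin 3 → R) (W : Fin 3 → Fin 3 → Fin 3 → M)
    (hW : ∀ μ ν ρ, T (A μ * Dt ν ρ) = W μ ν ρ - T (t ρ * DA ν μ)) :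
    T (∑ μ, ∑ ν, ∑ ρ, eps μ ν ρ • ((A μ + t μ) * (DA ν ρ + Dt ν ρ) +
        (2 / 3 * g) • ((A μ + t μ) * (A ν + t ν) * (A ρ + t ρ)))) =
      T (∑ μ, ∑ ν, ∑ ρ, eps μ ν ρ • (A μ * DA ν ρ + (2 / 3 * g) • (A μ * A ν * A ρ))) +
      T (∑ μ, ∑ ν, ∑ ρ, eps μ ν ρ • (t μ * (DA ν ρ - DA ρ ν + g • (A ν * A ρ - A ρ * A ν)))) +
      T (∑ μ, ∑ ν, ∑ ρ, eps μ ν ρ • (t μ * (Dt ν ρ + g • (A ν * t ρ - t ρ * A ν) +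
        (g / 3) • (t ν * t ρ - t ρ * t ν)))) +
      ∑ μ, ∑ ν, ∑ ρ, eps μ ν ρ • W μ ν ρ := by
  -- Cyclicity brings the mixed cubic words to the two normal forms `t A A` and `A t t`, after which
  -- the identity is linear.
  have cyc : ∀ x y z, T (x * y * z) = T (y * z * x) := fun x y z => by
    rw [mul_assoc, hT]
  have h1 : ∀ i j k, T (A i * A j * t k) = T (t k * A i * A j) := fun i j k => by rw [cyc, cyc]
  have h2 : ∀ i j k, T (A i * t j * A k) = T (t j * A k * A i) := fun i j k => by rw [cyc]
  have h3 : ∀ i j k, T (t i * A j * t k) = T (A j * t k * t i) := fun i j k => by rw [cyc]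
  have h4 : ∀ i j k, T (t i * t j * A k) = T (A k * t i * t j) := fun i j k => by rw [cyc, cyc]
  simp only [sum_eps, mul_add, add_mul, mul_sub, mul_smul_comm, map_add, map_sub, map_smul,
    ← mul_assoc, h1, h2, h3, h4, hW]
  module

end Series

/-! ### The Chern-Simons action of a redefined gauge field -/

section Fields

variable {𝔤 : LieSubalgebra ℝ (Mat N)} {g : ℝ} {A : VField N}
  {ϑ : ℕ → Fin 3 → Jets N → Mat N}

/-- Evaluation of local expressions on a gauge field. -/
def evJets (g : ℝ) (A : VField N) : (Jets N → Mat N) →+* Field N :=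
  RingHom.pi fun x => Pi.evalRingHom (fun _ => Mat N) (jet g A x)

lemma evJets_apply (Φ : Jets N → Mat N) (x : Space) : evJets g A Φ x = Φ (jet g A x) := rfl

/-- The trace of a coefficient at a point. -/
def trCoeff (n : ℕ) (x : Space) : PowerSeries (Field N) →ₗ[ℝ] ℂ where
  toFun f := Matrix.trace (PowerSeries.coeff n f x)
  map_add' f h := by rw [map_add, Pi.add_apply, Matrix.trace_add]
  map_smul' c f := by
    rw [PowerSeries.coeff_smul, Pi.smul_apply, Matrix.trace_smul, RingHom.id_apply]

lemma trCoeff_apply (n : ℕ) (x : Space) (f : PowerSeries (Field N)) :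
    trCoeff n x f = Matrix.trace (PowerSeries.coeff n f x) := rfl

/-- The antidiagonal is symmetric under the swap, so cyclicity of the trace passes to each
coefficient of a product of series. -/
lemma trCoeff_mul_comm (n : ℕ) (x : Space) (a b : PowerSeries (Field N)) :
    trCoeff n x (a * b) = trCoeff n x (b * a) := by
  rw [trCoeff_apply, trCoeff_apply, coeff_mul_apply, coeff_mul_apply, Matrix.trace_sum,
    Matrix.trace_sum, ← Finset.Nat.sum_antidiagonal_swap (n := n) (f := fun i =>
      (PowerSeries.coeff i.1 b x * PowerSeries.coeff i.2 a x).trace)]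
  exact Finset.sum_congr rfl fun i _ => Matrix.trace_mul_comm _ _

lemma redefinition_eq (μ : Fin 3) : redefinition g ϑ A μ =
    PowerSeries.C (A μ) + PowerSeries.map (evJets g A) (correction ϑ μ) := by
  ext1 n
  rw [redefinition, map_add, PowerSeries.coeff_mk, PowerSeries.coeff_C, PowerSeries.coeff_map,
    correction, PowerSeries.coeff_mk]
  split_ifs with hn
  · rw [map_zero, add_zero]
  · rw [zero_add]
    rfl

lemma pd_zero (ν : Fin 3) : pd ν (0 : Field N) = 0 := by
  ext1 x
  simp [pd, fderiv_zero]

lemma pdSeries_redefinition (ν ρ : Fin 3) : pdSeries ν (redefinition g ϑ A ρ) =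
    PowerSeries.C (pd ν (A ρ)) + pdSeries ν (PowerSeries.map (evJets g A) (correction ϑ ρ)) := by
  ext1 n
  rw [pdSeries, pdSeries, map_add, PowerSeries.coeff_mk, PowerSeries.coeff_mk, redefinition_eq,
    map_add, PowerSeries.coeff_C, PowerSeries.coeff_C]
  split_ifs with hn
  · rw [hn, PowerSeries.coeff_map, coeff_zero_correction, map_zero, add_zero, pd_zero, add_zero]
  · rw [zero_add, zero_add]

lemma fieldStrength_series (ν ρ : Fin 3) :
    PowerSeries.C (pd ν (A ρ)) - PowerSeries.C (pd ρ (A ν)) +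
      g • (PowerSeries.C (A ν) * PowerSeries.C (A ρ) - PowerSeries.C (A ρ) * PowerSeries.C (A ν)) =
    PowerSeries.C (fieldStrength g A ν ρ) := by
  rw [← map_mul, ← map_mul, ← map_sub, ← map_sub]
  ext1 n
  rw [map_add, PowerSeries.coeff_smul, PowerSeries.coeff_C, PowerSeries.coeff_C,
    PowerSeries.coeff_C]
  split_ifs
  · rfl
  · rw [smul_zero, add_zero]

lemma cov_series (hA : ∀ μ, IsSmoothField 𝔤 (A μ))
    (h : ∀ n, 1 ≤ n → ∀ μ, IsCovariant 𝔤 (ϑ n μ)) (ν ρ : Fin 3) :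
    pdSeries ν (PowerSeries.map (evJets g A) (correction ϑ ρ)) +
      g • (PowerSeries.C (A ν) * PowerSeries.map (evJets g A) (correction ϑ ρ) -
        PowerSeries.map (evJets g A) (correction ϑ ρ) * PowerSeries.C (A ν)) =
    PowerSeries.map (evJets g A) (tderSeries ν (correction ϑ ρ)) := by
  ext1 n
  rw [map_add, PowerSeries.coeff_smul, map_sub, PowerSeries.coeff_C_mul, PowerSeries.coeff_mul_C,
    pdSeries, PowerSeries.coeff_mk, PowerSeries.coeff_map, PowerSeries.coeff_map, tderSeries,
    PowerSeries.coeff_mk]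
  ext1 x
  exact cov_isCovariant_jet hA g (isCovariantSeries_correction h ρ n) ν x

lemma curl_series (hA : ∀ μ, IsSmoothField 𝔤 (A μ))
    (h : ∀ n, 1 ≤ n → ∀ μ, IsCovariant 𝔤 (ϑ n μ)) (ν ρ : Fin 3) :
    pdSeries ν (PowerSeries.map (evJets g A) (correction ϑ ρ)) +
      g • (PowerSeries.C (A ν) * PowerSeries.map (evJets g A) (correction ϑ ρ) -
        PowerSeries.map (evJets g A) (correction ϑ ρ) * PowerSeries.C (A ν)) +
      (g / 3) • (PowerSeries.map (evJets g A) (correction ϑ ν) *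
        PowerSeries.map (evJets g A) (correction ϑ ρ) -
        PowerSeries.map (evJets g A) (correction ϑ ρ) *
        PowerSeries.map (evJets g A) (correction ϑ ν)) =
    PowerSeries.map (evJets g A) (curl g (correction ϑ) ν ρ) := by
  rw [cov_series hA h, ← map_mul, ← map_mul, ← map_sub, curl, map_add]
  congr 1

/-- The total derivative terms in the expansion of the Chern-Simons density. -/
def boundaryTerm (g : ℝ) (A : VField N) (θ : Fin 3 → Jets N → Mat N) (μ ν ρ : Fin 3) (x : Space) :
    ℂ :=
  Matrix.trace (A μ x * pd ν (fun y => θ ρ (jet g A y)) x) +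
    Matrix.trace (θ ρ (jet g A x) * pd ν (A μ) x)

/-- This is `chernSimons_expansion` in the ring of formal series of fields, with `trCoeff n x` as
trace. The commutator terms assemble into `F` and into the covariant `curl`, and traces of products
of antihermitian matrices are real. -/
lemma trace_csSeriesDensity (h𝔤 : ∀ X ∈ 𝔤, Matrix.conjTranspose X = -X)
    (hA : ∀ μ, IsSmoothField 𝔤 (A μ)) (h : ∀ n, 1 ≤ n → ∀ μ, IsCovariant 𝔤 (ϑ n μ)) {n : ℕ}
    (hn : 1 ≤ n) (x : Space) :
    Matrix.trace (PowerSeries.coeff n (csSeriesDensity g (redefinition g ϑ A)) x) =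
      ((2 * (linearLagrangian (ϑ n) (jet g A x) + interactionLagrangian g ϑ n (jet g A x)) : ℝ) : ℂ)
        + ∑ μ, ∑ ν, ∑ ρ, eps μ ν ρ • boundaryTerm g A (ϑ n) μ ν ρ x := by
  have hn0 : n ≠ 0 := by omega
  have hcoeff : ∀ μ, PowerSeries.coeff n (correction ϑ μ) = ϑ n μ := fun μ => by
    rw [correction, PowerSeries.coeff_mk, if_neg hn0]
  have hv := inLie_jet hA g x
  have hC : ∀ f : Field N, trCoeff n x (PowerSeries.C f) = 0 := fun f => by
    rw [trCoeff_apply, PowerSeries.coeff_C, if_neg hn0, Pi.zero_apply, Matrix.trace_zero]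
  have hW : ∀ μ ν ρ, trCoeff n x (PowerSeries.C (A μ) *
      pdSeries ν (PowerSeries.map (evJets g A) (correction ϑ ρ))) =
      boundaryTerm g A (ϑ n) μ ν ρ x -
        trCoeff n x (PowerSeries.map (evJets g A) (correction ϑ ρ) *
          PowerSeries.C (pd ν (A μ))) := by
    intro μ ν ρ
    rw [trCoeff_apply, trCoeff_apply, PowerSeries.coeff_C_mul, PowerSeries.coeff_mul_C, pdSeries,
      PowerSeries.coeff_mk, PowerSeries.coeff_map, hcoeff, boundaryTerm]
    exact (add_sub_cancel_right _ _).symm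
  have key := chernSimons_expansion (trCoeff n x) (trCoeff_mul_comm n x) g
    (fun μ => PowerSeries.C (A μ)) (fun μ => PowerSeries.map (evJets g A) (correction ϑ μ))
    (fun ν ρ => PowerSeries.C (pd ν (A ρ)))
    (fun ν ρ => pdSeries ν (PowerSeries.map (evJets g A) (correction ϑ ρ)))
    (fun μ ν ρ => boundaryTerm g A (ϑ n) μ ν ρ x) hW
  simp only [fieldStrength_series, curl_series hA h] at key
  rw [← trCoeff_apply, csSeriesDensity]
  simp only [pdSeries_redefinition]
  simp only [redefinition_eq]
  rw [key]
  congr 1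
  -- The pure `A` part is a constant series, so it is absent at order `n ≥ 1`.
  have t0 : trCoeff n x (∑ μ, ∑ ν, ∑ ρ, eps μ ν ρ •
      (PowerSeries.C (A μ) * PowerSeries.C (pd ν (A ρ)) +
        (2 / 3 * g) • (PowerSeries.C (A μ) * PowerSeries.C (A ν) * PowerSeries.C (A ρ)))) = 0 := by
    simp only [map_sum, map_smul, map_add, ← map_mul, hC, smul_zero, add_zero,
      Finset.sum_const_zero]
  have t1 : ∀ μ ν ρ, trCoeff n x (PowerSeries.map (evJets g A) (correction ϑ μ) *
      PowerSeries.C (fieldStrength g A ν ρ)) =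
      (retr (ϑ n μ (jet g A x) * jet g A x ([], ν, ρ)) : ℂ) := by
    intro μ ν ρ
    rw [trCoeff_apply, PowerSeries.coeff_mul_C, PowerSeries.coeff_map, hcoeff,
      ← trace_eq_retr (h𝔤 _ ((h n hn μ).mem _ hv)) (h𝔤 _ (hv _))]
    rfl
  have t2 : ∀ μ ν ρ, trCoeff n x (PowerSeries.map (evJets g A) (correction ϑ μ) *
      PowerSeries.map (evJets g A) (curl g (correction ϑ) ν ρ)) =
      (retr (PowerSeries.coeff n (correction ϑ μ * curl g (correction ϑ) ν ρ) (jet g A x)) :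
        ℂ) := by
    intro μ ν ρ
    rw [← map_mul, trCoeff_apply, PowerSeries.coeff_map, evJets_apply,
      trace_coeff_mul h𝔤 (isCovariantSeries_correction h μ)
        (isCovariantSeries_curl (isCovariantSeries_correction h) ν ρ) n hv]
  rw [t0, zero_add]
  simp only [map_sum, map_smul, t1, t2, linearLagrangian, interactionLagrangian]
  push_cast
  simp only [Complex.real_smul]
  ring

/-! ### Integrals -/

lemma isSchwartz_local [LieAlgebra.IsSemisimple ℝ 𝔤] {Θ : Jets N → Mat N}
    (hA : IsGaugeField 𝔤 A) (h : IsCovariant 𝔤 Θ) : IsSchwartz (fun x => Θ (jet g A x)) :=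
  isSchwartz_isPoly_jet hA.1 g (Φ := Θ) h.poly h.map_zero

/-- The trace as a continuous real linear map. -/
def traceCLM (N : ℕ) : Mat N →L[ℝ] ℂ :=
  LinearMap.toContinuousLinearMap (Matrix.traceLinearMap (Fin N) ℝ ℂ)

lemma isSchwartz_boundaryTerm [LieAlgebra.IsSemisimple ℝ 𝔤] {θ : Fin 3 → Jets N → Mat N}
    (hA : IsGaugeField 𝔤 A) (h : ∀ μ, IsCovariant 𝔤 (θ μ)) (μ ν ρ : Fin 3) :
    IsSchwartz (boundaryTerm g A θ μ ν ρ) :=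
  (((hA.1 μ).mul ((isSchwartz_local hA (h ρ)).fderiv_apply _)).map (traceCLM N)).add
    (((isSchwartz_local hA (h ρ)).mul ((hA.1 μ).fderiv_apply _)).map (traceCLM N))

/-- The boundary term is `∂_ν tr (A_μ θ_ρ)`. It is not gauge invariant, but `A_μ` itself decreases
rapidly. -/
lemma integral_boundaryTerm [LieAlgebra.IsSemisimple ℝ 𝔤] {θ : Fin 3 → Jets N → Mat N}
    (hA : IsGaugeField 𝔤 A) (h : ∀ μ, IsCovariant 𝔤 (θ μ)) (μ ν ρ : Fin 3) :
    ∫ x, boundaryTerm g A θ μ ν ρ x = 0 := by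
  have hθ := isSchwartz_local (g := g) hA (h ρ)
  have hf : IsSchwartz fun x => traceCLM N (A μ x * θ ρ (jet g A x)) :=
    ((hA.1 μ).mul hθ).map (traceCLM N)
  rw [← hf.integral_fderiv_apply (EuclideanSpace.single ν 1)]
  refine integral_congr_ae (Filter.Eventually.of_forall fun x => ?_)
  have h1 := hasDerivAt_pd (hA.1 μ).contDiff x (EuclideanSpace.single ν 1)
  have h2 := hasDerivAt_pd hθ.contDiff x (EuclideanSpace.single ν 1)
  have h3 := (traceCLM N).hasFDerivAt.comp_hasDerivAt (0 : ℝ) (h1.mul h2)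
  simp only [zero_smul, add_zero] at h3
  refine Eq.trans ?_ (h3.unique (hasDerivAt_pd hf.contDiff x (EuclideanSpace.single ν 1)))
  change _ = Matrix.trace (pd ν (A μ) x * θ ρ (jet g A x) +
    A μ x * pd ν (fun y => θ ρ (jet g A y)) x)
  rw [boundaryTerm, Matrix.trace_add, Matrix.trace_mul_comm (θ ρ (jet g A x)), add_comm]

/-- Formal power series of rapidly decreasing fields. -/
def IsSchwartzSeries (a : PowerSeries (Field N)) : Prop := ∀ n, IsSchwartz (PowerSeries.coeff n a)

lemma IsSchwartzSeries.mul {a b : PowerSeries (Field N)} (ha : IsSchwartzSeries a)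
    (hb : IsSchwartzSeries b) : IsSchwartzSeries (a * b) := fun n => by
  have : PowerSeries.coeff n (a * b) = fun x => ∑ i ∈ Finset.HasAntidiagonal.antidiagonal n,
      PowerSeries.coeff i.1 a x * PowerSeries.coeff i.2 b x :=
    funext fun x => coeff_mul_apply a b n x
  rw [this]
  exact IsSchwartz.sum _ fun i _ => (ha i.1).mul (hb i.2)

lemma IsSchwartzSeries.add {a b : PowerSeries (Field N)} (ha : IsSchwartzSeries a)
    (hb : IsSchwartzSeries b) : IsSchwartzSeries (a + b) := fun n => by
  rw [map_add]
  exact (ha n).add (hb n)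

lemma IsSchwartzSeries.smul {a : PowerSeries (Field N)} (c : ℝ) (ha : IsSchwartzSeries a) :
    IsSchwartzSeries (c • a) := fun n => by
  rw [PowerSeries.coeff_smul]
  exact (ha n).const_smul c

lemma IsSchwartzSeries.sum {ι : Type*} (s : Finset ι) {a : ι → PowerSeries (Field N)}
    (ha : ∀ i ∈ s, IsSchwartzSeries (a i)) : IsSchwartzSeries (∑ i ∈ s, a i) := fun n => by
  have : PowerSeries.coeff n (∑ i ∈ s, a i) = fun x => ∑ i ∈ s, PowerSeries.coeff n (a i) x := by
    ext1 x
    rw [map_sum, Finset.sum_apply]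
  rw [this]
  exact IsSchwartz.sum s fun i hi => ha i hi n

lemma IsSchwartzSeries.pd {a : PowerSeries (Field N)} (ha : IsSchwartzSeries a) (ν : Fin 3) :
    IsSchwartzSeries (pdSeries ν a) := fun n => by
  rw [pdSeries, PowerSeries.coeff_mk]
  exact (ha n).fderiv_apply _

variable [LieAlgebra.IsSemisimple ℝ 𝔤]

lemma isSchwartzSeries_redefinition (hA : IsGaugeField 𝔤 A)
    (h : ∀ n, 1 ≤ n → ∀ μ, IsCovariant 𝔤 (ϑ n μ)) (μ : Fin 3) :
    IsSchwartzSeries (redefinition g ϑ A μ) := fun n => by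
  rw [redefinition, PowerSeries.coeff_mk]
  split_ifs with hn
  · exact hA.1 μ
  · exact isSchwartz_local hA (h n (Nat.pos_of_ne_zero hn) μ)

lemma integrable_trace_csSeriesDensity (hA : IsGaugeField 𝔤 A)
    (h : ∀ n, 1 ≤ n → ∀ μ, IsCovariant 𝔤 (ϑ n μ)) (n : ℕ) :
    Integrable fun x : Space => Matrix.trace
      (PowerSeries.coeff n (csSeriesDensity g (redefinition g ϑ A)) x) := by
  have hr := isSchwartzSeries_redefinition (g := g) hA h
  have hd : IsSchwartzSeries (csSeriesDensity g (redefinition g ϑ A)) :=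
    IsSchwartzSeries.sum _ fun μ _ => IsSchwartzSeries.sum _ fun ν _ =>
      IsSchwartzSeries.sum _ fun ρ _ => (((hr μ).mul ((hr ρ).pd ν)).add
        ((((hr μ).mul (hr ν)).mul (hr ρ)).smul _)).smul _
  exact ((hd n).map (traceCLM N)).integrable

lemma coeff_csSeries (h𝔤 : ∀ X ∈ 𝔤, Matrix.conjTranspose X = -X) (hA : IsGaugeField 𝔤 A)
    (h : ∀ n, 1 ≤ n → ∀ μ, IsCovariant 𝔤 (ϑ n μ)) {n : ℕ} (hn : 1 ≤ n) :
    PowerSeries.coeff n (csSeries g (redefinition g ϑ A)) =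
      ((∫ x, (linearLagrangian (ϑ n) (jet g A x) +
        interactionLagrangian g ϑ n (jet g A x)) : ℝ) : ℂ) := by
  have hL := (isYMLagrangian_linearLagrangian (h n hn)).add
    (isYMLagrangian_interactionLagrangian (g := g) h n)
  have hb := isSchwartz_boundaryTerm (g := g) hA (h n hn)
  rw [csSeries, PowerSeries.coeff_mk]
  simp only [trace_csSeriesDensity h𝔤 hA.isSmoothField h hn]
  rw [integral_add, integral_complex_ofReal, integral_const_mul, integral_finsetSum]
  · have h0 : ∀ μ : Fin 3,
        ∫ x : Space, ∑ ν, ∑ ρ, eps μ ν ρ • boundaryTerm g A (ϑ n) μ ν ρ x = 0 := by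
      intro μ
      rw [integral_finsetSum]
      · refine Finset.sum_eq_zero fun ν _ => ?_
        rw [integral_finsetSum]
        · refine Finset.sum_eq_zero fun ρ _ => ?_
          rw [integral_smul, integral_boundaryTerm hA (h n hn), smul_zero]
        · exact fun ρ _ => ((hb μ ν ρ).const_smul _).integrable
      · exact fun ν _ => (IsSchwartz.sum _ fun ρ _ => (hb μ ν ρ).const_smul _).integrable
    rw [Finset.sum_eq_zero fun μ _ => h0 μ]
    push_cast
    ring
  · exact fun μ _ => (IsSchwartz.sum _ fun ν _ => IsSchwartz.sum _ fun ρ _ =>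
      (hb μ ν ρ).const_smul _).integrable
  · exact (((hL.integrable hA).const_mul 2).ofReal)
  · exact (IsSchwartz.sum _ fun μ _ => IsSchwartz.sum _ fun ν _ => IsSchwartz.sum _ fun ρ _ =>
      (hb μ ν ρ).const_smul _).integrable

lemma coeff_zero_csSeries :
    PowerSeries.coeff 0 (csSeries g (redefinition g ϑ A)) = csAction g A := by
  have h1 : ∀ μ, PowerSeries.constantCoeff (redefinition g ϑ A μ) = A μ := fun μ => by
    rw [← PowerSeries.coeff_zero_eq_constantCoeff_apply, redefinition, PowerSeries.coeff_mk,
      if_pos rfl]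
  have h2 : ∀ ν ρ, PowerSeries.constantCoeff (pdSeries ν (redefinition g ϑ A ρ)) =
      pd ν (A ρ) := fun ν ρ => by
    rw [← PowerSeries.coeff_zero_eq_constantCoeff_apply, pdSeries, PowerSeries.coeff_mk,
      PowerSeries.coeff_zero_eq_constantCoeff_apply, h1]
  have h3 : ∀ (c : ℝ) (f : PowerSeries (Field N)), PowerSeries.constantCoeff (c • f) =
      c • PowerSeries.constantCoeff f := fun c f => by
    rw [← PowerSeries.coeff_zero_eq_constantCoeff_apply, PowerSeries.coeff_smul,
      PowerSeries.coeff_zero_eq_constantCoeff_apply]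
  rw [csSeries, PowerSeries.coeff_mk, csAction]
  simp only [PowerSeries.coeff_zero_eq_constantCoeff_apply, csSeriesDensity, map_sum, h3, map_add,
    map_mul, h1, h2, Finset.sum_apply]
  rfl

end Fields

/-! ### Construction of the redefined connection, order by order -/

section Construction

/-- Strong recursion with choice. The values already constructed are padded by `z` from index `n`
on, so that the condition `Q` can speak of total sequences. -/
lemma exists_seq_of_step {α : Type*} (z : α) (Q : ℕ → (ℕ → α) → α → Prop)
    (h : ∀ n f, ∃ a, Q n f a) :
    ∃ θ : ℕ → α, ∀ n, Q n (fun k => if k < n then θ k else z) (θ n) := by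
  choose G hG using h
  refine ⟨Nat.lt_wfRel.wf.fix fun n ih => G n fun k => if hk : k < n then ih k hk else z,
    fun n => ?_⟩
  conv => arg 3; rw [WellFounded.fix_eq]
  convert! hG n _ using 2

variable {𝔤 : LieSubalgebra ℝ (Mat N)} [LieAlgebra.IsSemisimple ℝ 𝔤]

lemma isPureChernSimons_of_actionEq (h𝔤 : ∀ X ∈ 𝔤, Matrix.conjTranspose X = -X) {g : ℝ}
    {P : ℕ → Jets N → ℝ} {ϑ : ℕ → Fin 3 → Jets N → Mat N}
    (h : ∀ n, 1 ≤ n → ∀ μ, IsCovariant 𝔤 (ϑ n μ))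
    (hP : ∀ n, 1 ≤ n →
      ActionEq 𝔤 g (fun v => linearLagrangian (ϑ n) v + interactionLagrangian g ϑ n v) (P n)) :
    IsPureChernSimons 𝔤 g (ymTypeSeries g P) ϑ where
  covariant := h
  connection := transformsAsConnection g h
  integrable A hA n := integrable_trace_csSeriesDensity ⟨fun μ => IsSchwartz.coe (A μ), hA⟩ h n
  action_eq A hA := by
    have hA' : IsGaugeField 𝔤 fun μ => ⇑(A μ) := ⟨fun μ => IsSchwartz.coe (A μ), hA⟩
    ext n
    rw [ymTypeSeries, map_add, PowerSeries.coeff_C, PowerSeries.coeff_mk]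
    split_ifs with hn
    · rw [hn, coeff_zero_csSeries, add_zero]
    · have hn' := Nat.pos_of_ne_zero hn
      rw [coeff_csSeries h𝔤 hA' h hn', zero_add, hP n hn' _ hA']

/-- The orders up to `K` are prescribed by `φ`, which must solve their equations; from `K + 1` on,
`exists_linearLagrangian` is applied to `P n` minus the interaction of the lower orders. -/
theorem exists_isPureChernSimons (h𝔤 : ∀ X ∈ 𝔤, Matrix.conjTranspose X = -X) (g : ℝ)
    {P : ℕ → Jets N → ℝ} (hP : ∀ n, 1 ≤ n → IsYMLagrangian 𝔤 (P n)) (K : ℕ)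
    (φ : ℕ → Fin 3 → Jets N → Mat N)
    (hφ : ∀ n, 1 ≤ n → n ≤ K → (∀ μ, IsCovariant 𝔤 (φ n μ)) ∧
      ActionEq 𝔤 g (fun v => linearLagrangian (φ n) v + interactionLagrangian g φ n v) (P n)) :
    ∃ ϑ : ℕ → Fin 3 → Jets N → Mat N, (∀ n, 1 ≤ n → n ≤ K → ϑ n = φ n) ∧
      IsPureChernSimons 𝔤 g (ymTypeSeries g P) ϑ ∧
      ((∀ n, 1 ≤ n → HasMassDim 𝔤 (n + 3) (P n)) →
        (∀ n, 1 ≤ n → n ≤ K → ∀ μ, HasMassDim 𝔤 (n + 1) (φ n μ)) →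
        ∀ n, 1 ≤ n → ∀ μ, HasMassDim 𝔤 (n + 1) (ϑ n μ)) := by
  -- The demand on `a` is conditional on covariance of `f`, because the recursion must make a choice
  -- for every sequence; covariance is established afterwards by induction in `hcov`. The condition
  -- `K < n` also forces `n ≥ 1`.
  obtain ⟨ϑ, hϑ⟩ := exists_seq_of_step (α := Fin 3 → Jets N → Mat N) (fun _ _ => 0)
    (fun n f a => (n ≤ K → a = φ n) ∧ (K < n → (∀ k, 1 ≤ k → ∀ μ, IsCovariant 𝔤 (f k μ)) →
      (∀ μ, IsCovariant 𝔤 (a μ)) ∧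
      ActionEq 𝔤 g (linearLagrangian a) (fun v => P n v - interactionLagrangian g f n v) ∧
      (HasMassDim 𝔤 (n + 3) (fun v => P n v - interactionLagrangian g f n v) →
        ∀ μ, HasMassDim 𝔤 (n + 1) (a μ)))) (fun n f => by
      by_cases hn : n ≤ K
      · exact ⟨φ n, fun _ => rfl, fun h => absurd hn (by omega)⟩
      · by_cases hf : ∀ k, 1 ≤ k → ∀ μ, IsCovariant 𝔤 (f k μ)
        · obtain ⟨a, h1, h2, h3⟩ := exists_linearLagrangian (g := g) h𝔤
            ((hP n (by omega)).sub (isYMLagrangian_interactionLagrangian (g := g) hf n))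
          exact ⟨a, fun h => absurd h hn, fun _ _ => ⟨h1, h2, h3 n⟩⟩
        · exact ⟨φ n, fun _ => rfl, fun _ h => absurd h hf⟩)
  have hcov : ∀ n, 1 ≤ n → ∀ μ, IsCovariant 𝔤 (ϑ n μ) := by
    intro n
    induction n using Nat.strong_induction_on with
    | _ n ih =>
      intro hn
      rcases le_or_gt n K with h | h
      · rw [(hϑ n).1 h]
        exact (hφ n hn h).1
      · refine ((hϑ n).2 h fun k hk μ => ?_).1
        beta_reduce
        split_ifs with hkn
        · exact ih k hkn hk μ
        · exact IsCovariant.zero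
  have htrunc : ∀ n, ∀ k, 1 ≤ k → ∀ μ,
      IsCovariant 𝔤 ((fun k => if k < n then ϑ k else fun _ _ => 0) k μ) := by
    intro n k hk μ
    beta_reduce
    split_ifs
    · exact hcov k hk μ
    · exact IsCovariant.zero
  -- The padding is invisible to the interaction, which sees only indices below `n`.
  have hint : ∀ n, interactionLagrangian g (fun k => if k < n then ϑ k else fun _ _ => 0) n =
      interactionLagrangian g ϑ n := fun n =>
    interactionLagrangian_congr fun k _ hk => if_pos hk
  refine ⟨ϑ, fun n _ h => (hϑ n).1 h, isPureChernSimons_of_actionEq h𝔤 hcov fun n hn => ?_,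
    fun hdim hdimφ n => ?_⟩
  · rcases le_or_gt n K with h | h
    · have h1 : interactionLagrangian g ϑ n = interactionLagrangian g φ n :=
        interactionLagrangian_congr fun k _ hk => (hϑ k).1 (by omega)
      rw [(hϑ n).1 h, h1]
      exact (hφ n hn h).2
    · obtain ⟨-, h2, -⟩ := (hϑ n).2 h (htrunc n)
      rw [hint n] at h2
      have hI := isYMLagrangian_interactionLagrangian (g := g) hcov n
      have h3 := ActionEq.add (isYMLagrangian_linearLagrangian (hcov n hn)) ((hP n hn).sub hI)
        hI hI h2 fun _ _ => rfl
      simpa only [sub_add_cancel] using h3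
  · induction n using Nat.strong_induction_on with
    | _ n ih =>
      intro hn
      rcases le_or_gt n K with h | h
      · rw [(hϑ n).1 h]
        exact hdimφ n hn h
      · refine ((hϑ n).2 h (htrunc n)).2.2 ((hdim n hn).sub
          (hasMassDim_interactionLagrangian (htrunc n) (fun k hk μ => ?_) n))
        split_ifs with hkn
        · exact ih k hkn hk μ
        · exact HasMassDim.zero

end Construction

/-! ### The lowest orders for the actions `S_YM + S_λ + S_τ` -/

section LowOrders

variable {𝔤 : LieSubalgebra ℝ (Mat N)} {g : ℝ}

lemma fderiv_neg_apply {V W : Type*} [NormedAddCommGroup V] [NormedSpace ℝ V]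
    [NormedAddCommGroup W] [NormedSpace ℝ W] (f : V → W) (x e : V) :
    fderiv ℝ (-f) x e = -fderiv ℝ f x e := by
  rw [fderiv_neg, neg_apply]

lemma cov_neg (A : VField N) (σ : Fin 3) (f : Field N) : cov g A σ (-f) = -cov g A σ f := by
  ext1 x
  have h : pd σ (-f) x = -pd σ f x := fderiv_neg_apply f x _
  rw [Pi.neg_apply, cov, cov, h, Pi.neg_apply, lie_neg, smul_neg, neg_add]

lemma jet_antisymm_list (A : VField N) (l : List (Fin 3)) (μ ν : Fin 3) (x : Space) :
    jet g A x (l, ν, μ) = -jet g A x (l, μ, ν) := by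
  have h : l.foldr (cov g A) (fieldStrength g A ν μ) =
      -l.foldr (cov g A) (fieldStrength g A μ ν) := by
    induction l with
    | nil => exact funext fun x => fieldStrength_antisymm A μ ν x
    | cons σ l ih => rw [List.foldr_cons, ih, cov_neg, List.foldr_cons]
  exact congrFun h x

/-- The coefficients `ϑ¹, ϑ², ϑ³` of the redefined gauge field. -/
def lowOrder (g lam tau : ℝ) (n : ℕ) (μ : Fin 3) (v : Jets N) : Mat N :=
  match n with
  | 1 => (1 / 4 : ℝ) • ∑ σ, ∑ τ, eps μ σ τ • v ([], σ, τ)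
  | 2 => ((1 - 4 * lam) / 8) • ∑ σ, v ([σ], σ, μ)
  | 3 => -((1 - 4 * lam) / 16) • ∑ σ, ∑ τ, ∑ ρ, eps μ σ τ • v ([σ, ρ], ρ, τ) +
      (g / 48) • ∑ σ, ∑ τ, ∑ ρ, eps μ σ τ • ⁅v ([], σ, ρ), v ([], ρ, τ)⁆ +
      (tau / 4) • ∑ ν, ∑ ρ, eps μ ν ρ • ∑ σ, v ([σ, σ], ν, ρ)
  | _ => 0

/-- The Lagrangians of `S_YM`, `S_λ` and `S_τ`. -/
def lowLagrangian (lam tau : ℝ) (n : ℕ) (v : Jets N) : ℝ :=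
  match n with
  | 1 => 1 / 4 * ∑ μ, ∑ ν, retr (v ([], μ, ν) * v ([], μ, ν))
  | 2 => lam / 2 * ∑ μ, ∑ ν, ∑ ρ, ∑ σ, eps μ ν ρ * retr (v ([], μ, σ) * v ([ν], ρ, σ))
  | 3 => tau / 4 * ∑ μ, ∑ ν, ∑ σ, retr (v ([], μ, ν) * v ([σ, σ], μ, ν))
  | _ => 0

lemma isCovariant_lowOrder (lam tau : ℝ) {n : ℕ} (hn : 1 ≤ n) (hn' : n ≤ 3) (μ : Fin 3) :
    IsCovariant 𝔤 (lowOrder g lam tau n μ) := by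
  have hc := fun j => IsCovariant.coord (𝔤 := 𝔤) j
  interval_cases n
  · exact (IsCovariant.sum _ fun σ _ => IsCovariant.sum _ fun τ _ => (hc _).smul _).smul _
  · exact (IsCovariant.sum _ fun σ _ => hc _).smul _
  · refine IsCovariant.add (IsCovariant.add (IsCovariant.smul _ ?_) (IsCovariant.smul _ ?_))
      (IsCovariant.smul _ ?_)
    · exact IsCovariant.sum _ fun σ _ => IsCovariant.sum _ fun τ _ => IsCovariant.sum _ fun ρ _ =>
        (hc _).smul _
    · exact IsCovariant.sum _ fun σ _ => IsCovariant.sum _ fun τ _ => IsCovariant.sum _ fun ρ _ =>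
        ((hc _).lie (hc _)).smul _
    · exact IsCovariant.sum _ fun ν _ => IsCovariant.sum _ fun ρ _ =>
        (IsCovariant.sum _ fun σ _ => hc _).smul _

lemma hasMassDim_lowOrder (lam tau : ℝ) {n : ℕ} (hn : 1 ≤ n) (hn' : n ≤ 3) (μ : Fin 3) :
    HasMassDim 𝔤 (n + 1) (lowOrder g lam tau n μ) := by
  have hc := fun j => HasMassDim.coord (𝔤 := 𝔤) j
  interval_cases n
  · exact HasMassDim.smul _ (HasMassDim.sum _ fun σ _ => HasMassDim.sum _ fun τ _ =>
      HasMassDim.smul _ (hc _))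
  · exact HasMassDim.smul _ (HasMassDim.sum _ fun σ _ => hc ([σ], σ, μ))
  · refine HasMassDim.add (HasMassDim.add (HasMassDim.smul _ ?_) (HasMassDim.smul _ ?_))
      (HasMassDim.smul _ ?_)
    · exact HasMassDim.sum _ fun σ _ => HasMassDim.sum _ fun τ _ => HasMassDim.sum _ fun ρ _ =>
        HasMassDim.smul _ (hc ([σ, ρ], ρ, τ))
    · exact HasMassDim.sum _ fun σ _ => HasMassDim.sum _ fun τ _ => HasMassDim.sum _ fun ρ _ =>
        HasMassDim.smul _ (((hc ([], σ, ρ)).mul (hc ([], ρ, τ))).sub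
          ((hc ([], ρ, τ)).mul (hc ([], σ, ρ))))
    · exact HasMassDim.sum _ fun ν _ => HasMassDim.sum _ fun ρ _ =>
        HasMassDim.smul _ (HasMassDim.sum _ fun σ _ => hc ([σ, σ], ν, ρ))

lemma hasMassDim_lowLagrangian (lam tau : ℝ) (n : ℕ) :
    HasMassDim 𝔤 (n + 3) (lowLagrangian (N := N) lam tau n) := by
  have hc := fun j => HasMassDim.coord (𝔤 := 𝔤) j
  match n with
  | 0 => exact HasMassDim.zero
  | 1 => exact HasMassDim.smul (V := ℝ) _ (HasMassDim.sum _ fun μ _ => HasMassDim.sum _ fun ν _ =>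
      HasMassDim.map retr ((hc ([], μ, ν)).mul (hc ([], μ, ν))))
  | 2 => exact HasMassDim.smul (V := ℝ) _ (HasMassDim.sum _ fun μ _ => HasMassDim.sum _ fun ν _ =>
      HasMassDim.sum _ fun ρ _ => HasMassDim.sum _ fun σ _ => HasMassDim.smul (V := ℝ) _
        (HasMassDim.map retr ((hc ([], μ, σ)).mul (hc ([ν], ρ, σ)))))
  | 3 => exact HasMassDim.smul (V := ℝ) _ (HasMassDim.sum _ fun μ _ => HasMassDim.sum _ fun ν _ =>
      HasMassDim.sum _ fun σ _ => HasMassDim.map retr ((hc ([], μ, ν)).mul (hc ([σ, σ], μ, ν))))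
  | n + 4 => exact HasMassDim.zero

/-- The coefficient is linear in the jets, so its derivative along `shift σ` is its value there. -/
lemma tder_lowOrder_one (lam tau : ℝ) (σ μ : Fin 3) (v : Jets N) :
    tder σ (lowOrder g lam tau 1 μ) v = lowOrder g lam tau 1 μ (shift σ v) := by
  have hj := fun j => hasJetDerivAt_line v (shift σ v) 0 j
  exact ((HasDerivAt.fun_sum fun σ _ => HasDerivAt.fun_sum fun τ _ =>
    (hj ([], σ, τ)).const_smul (eps μ σ τ)).const_smul (1 / 4 : ℝ)).deriv

lemma tder_lowOrder_two (lam tau : ℝ) (σ μ : Fin 3) (v : Jets N) :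
    tder σ (lowOrder g lam tau 2 μ) v = lowOrder g lam tau 2 μ (shift σ v) := by
  have hj := fun j => hasJetDerivAt_line v (shift σ v) 0 j
  exact ((HasDerivAt.fun_sum fun σ _ => hj ([σ], σ, μ)).const_smul ((1 - 4 * lam) / 8)).deriv

variable (ϑ : ℕ → Fin 3 → Jets N → Mat N)

lemma coeff_correction {n : ℕ} (hn : n ≠ 0) (μ : Fin 3) :
    PowerSeries.coeff n (correction ϑ μ) = ϑ n μ := by
  rw [correction, PowerSeries.coeff_mk, if_neg hn]

lemma coeff_curl_apply (n : ℕ) (ν ρ : Fin 3) (v : Jets N) :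
    PowerSeries.coeff n (curl g (correction ϑ) ν ρ) v =
      tder ν (PowerSeries.coeff n (correction ϑ ρ)) v +
      (g / 3) • ∑ i ∈ Finset.HasAntidiagonal.antidiagonal n,
        ⁅PowerSeries.coeff i.1 (correction ϑ ν) v, PowerSeries.coeff i.2 (correction ϑ ρ) v⁆ := by
  rw [← coeff_commutator_apply, curl, map_add, PowerSeries.coeff_smul, tderSeries,
    PowerSeries.coeff_mk]
  rfl

lemma coeff_one_curl (ν ρ : Fin 3) (v : Jets N) :
    PowerSeries.coeff 1 (curl g (correction ϑ) ν ρ) v = tder ν (ϑ 1 ρ) v := by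
  rw [coeff_curl_apply]
  simp [Finset.Nat.antidiagonal_succ, coeff_correction, coeff_zero_correction,
    -PowerSeries.coeff_zero_eq_constantCoeff]

lemma coeff_two_curl (ν ρ : Fin 3) (v : Jets N) :
    PowerSeries.coeff 2 (curl g (correction ϑ) ν ρ) v =
      tder ν (ϑ 2 ρ) v + (g / 3) • ⁅ϑ 1 ν v, ϑ 1 ρ v⁆ := by
  rw [coeff_curl_apply]
  simp [Finset.Nat.antidiagonal_succ, coeff_correction, coeff_zero_correction,
    -PowerSeries.coeff_zero_eq_constantCoeff]

lemma interactionLagrangian_one (v : Jets N) : interactionLagrangian g ϑ 1 v = 0 := by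
  simp [interactionLagrangian, coeff_mul_apply, Finset.Nat.antidiagonal_succ,
    coeff_zero_correction, coeff_zero_curl, -PowerSeries.coeff_zero_eq_constantCoeff]

lemma interactionLagrangian_two (v : Jets N) : interactionLagrangian g ϑ 2 v =
    1 / 2 * ∑ μ, ∑ ν, ∑ ρ, eps μ ν ρ * retr (ϑ 1 μ v * tder ν (ϑ 1 ρ) v) := by
  simp [interactionLagrangian, coeff_mul_apply, Finset.Nat.antidiagonal_succ,
    coeff_zero_correction, coeff_zero_curl, coeff_one_curl, coeff_correction,
    -PowerSeries.coeff_zero_eq_constantCoeff]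

/-- Only the splittings `1 + 2` and `2 + 1` survive. The bracket enters only through the
second-order coefficient of `curl`, as `⁅ϑ 1 ν, ϑ 1 ρ⁆`. -/
lemma interactionLagrangian_three (v : Jets N) : interactionLagrangian g ϑ 3 v =
    1 / 2 * ∑ μ, ∑ ν, ∑ ρ, eps μ ν ρ * (retr (ϑ 1 μ v * tder ν (ϑ 2 ρ) v) +
      retr (ϑ 2 μ v * tder ν (ϑ 1 ρ) v) + g / 3 * retr (ϑ 1 μ v * ⁅ϑ 1 ν v, ϑ 1 ρ v⁆)) := by
  simp only [interactionLagrangian, coeff_mul_apply]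
  congr 1
  refine Finset.sum_congr rfl fun μ _ => Finset.sum_congr rfl fun ν _ =>
    Finset.sum_congr rfl fun ρ _ => ?_
  congr 1
  simp [Finset.Nat.antidiagonal_succ,
    coeff_zero_correction, coeff_zero_curl, coeff_one_curl, coeff_two_curl, coeff_correction,
    -PowerSeries.coeff_zero_eq_constantCoeff, mul_add]
  ring

end LowOrders

/-! ### The equations of orders one to three as polynomial identities on antisymmetric jets -/

section OrderConditions

variable {𝔤 : LieSubalgebra ℝ (Mat N)} {g : ℝ}

/-- Values of the jet variables which are antisymmetric in the indices of the field strength. -/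
def IsAntisymm (v : Jets N) : Prop := ∀ l μ ν, v (l, ν, μ) = -v (l, μ, ν)

lemma IsAntisymm.same {v : Jets N} (hv : IsAntisymm v) (l : List (Fin 3)) (μ : Fin 3) :
    v (l, μ, μ) = 0 := by
  ext i j
  exact self_eq_neg.mp (congrFun₂ (hv l μ μ) i j)

lemma IsAntisymm.shift {v : Jets N} (hv : IsAntisymm v) (σ : Fin 3) : IsAntisymm (shift σ v) :=
  fun l μ ν => hv (σ :: l) μ ν

lemma IsAntisymm.jet (A : VField N) (x : Space) : IsAntisymm (jet g A x) :=
  fun l μ ν => jet_antisymm_list A l μ ν x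

lemma shift_coord (σ : Fin 3) (v : Jets N) (l : List (Fin 3)) (μ ν : Fin 3) :
    shift σ v (l, μ, ν) = v (σ :: l, μ, ν) := rfl

lemma sum_eps_mul (f : Fin 3 → Fin 3 → Fin 3 → ℝ) :
    ∑ μ, ∑ ν, ∑ ρ, eps μ ν ρ * f μ ν ρ =
      f 0 1 2 + f 1 2 0 + f 2 0 1 - f 0 2 1 - f 2 1 0 - f 1 0 2 := sum_eps f

section

variable {v : Jets N} (lam tau : ℝ)

lemma lowOrder_one_eq (hv : IsAntisymm v) :
    (lowOrder g lam tau 1 0 v = (1 / 2 : ℝ) • v ([], 1, 2)) ∧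
    (lowOrder g lam tau 1 1 v = -(1 / 2 : ℝ) • v ([], 0, 2)) ∧
    (lowOrder g lam tau 1 2 v = (1 / 2 : ℝ) • v ([], 0, 1)) := by
  refine ⟨?_, ?_, ?_⟩ <;>
  · simp only [lowOrder, Fin.sum_univ_three, eps_same_left, eps_same_right, eps_same_outer,
      eps_zero_one_two, eps_one_two_zero, eps_two_zero_one, eps_zero_two_one, eps_two_one_zero,
      eps_one_zero_two, hv _ 0 1, hv _ 0 2, hv _ 1 2]
    module

lemma lowOrder_two_eq (hv : IsAntisymm v) :
    (lowOrder g lam tau 2 0 v = -((1 - 4 * lam) / 8) • (v ([1], 0, 1) + v ([2], 0, 2))) ∧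
    (lowOrder g lam tau 2 1 v = ((1 - 4 * lam) / 8) • (v ([0], 0, 1) - v ([2], 1, 2))) ∧
    (lowOrder g lam tau 2 2 v = ((1 - 4 * lam) / 8) • (v ([0], 0, 2) + v ([1], 1, 2))) := by
  refine ⟨?_, ?_, ?_⟩ <;>
  · simp only [lowOrder, Fin.sum_univ_three, hv.same, hv _ 0 1, hv _ 0 2, hv _ 1 2]
    module

end

lemma linearLagrangian_lowOrder_one (lam tau : ℝ) {v : Jets N} (hv : IsAntisymm v) :
    linearLagrangian (lowOrder g lam tau 1) v = lowLagrangian lam tau 1 v := by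
  obtain ⟨h0, h1, h2⟩ := lowOrder_one_eq (g := g) lam tau hv
  rw [linearLagrangian, sum_eps_mul]
  simp only [h0, h1, h2, lowLagrangian, Fin.sum_univ_three, hv.same, hv _ 0 1, hv _ 0 2, hv _ 1 2,
    smul_mul_assoc, mul_neg, neg_mul, map_neg, map_smul, smul_eq_mul, mul_zero, map_zero]
  ring

/-- The `λ`-independent part of `tr ε ϑ² F` cancels the term `tr ε ϑ¹ D ϑ¹`, and the part
proportional to `λ` is the Lagrangian of `S_λ`. This holds pointwise, without integration by parts.
-/
lemma linearLagrangian_add_interaction_two (lam tau : ℝ) {v : Jets N} (hv : IsAntisymm v) :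
    linearLagrangian (lowOrder g lam tau 2) v +
      interactionLagrangian g (lowOrder g lam tau) 2 v = lowLagrangian lam tau 2 v := by
  obtain ⟨h0, h1, h2⟩ := lowOrder_two_eq (g := g) lam tau hv
  have h3 := lowOrder_one_eq (g := g) lam tau hv
  have h4 := fun σ => lowOrder_one_eq (g := g) lam tau (hv.shift σ)
  rw [linearLagrangian, sum_eps_mul, interactionLagrangian_two, sum_eps_mul]
  simp only [tder_lowOrder_one, h0, h1, h2, (h4 _).1, (h4 _).2.1, (h4 _).2.2, h3.1, h3.2.1, h3.2.2,
    shift_coord]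
  simp only [lowLagrangian, Fin.sum_univ_three, eps_same_left, eps_same_right, eps_same_outer,
      eps_zero_one_two, eps_one_two_zero, eps_two_zero_one, eps_zero_two_one, eps_two_one_zero,
      eps_one_zero_two, hv.same, hv _ 0 1, hv _ 0 2, hv _ 1 2, add_mul, sub_mul,
    smul_mul_assoc, mul_smul_comm, mul_neg, neg_mul, map_neg, map_add, map_sub, map_smul,
    smul_eq_mul,    mul_zero, zero_mul, map_zero]
  -- Under the trace the differentiated factor is put on the right, so that equal monomials are
  -- recognised by `ring`.
  have hc := fun (X Y : Mat N) => retr_mul_comm X Y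
  simp only [hc (v ([0], _)), hc (v ([1], _)), hc (v ([2], _))]
  ring

lemma lowOrder_three_eq {lam tau : ℝ} {v : Jets N} (hv : IsAntisymm v) :
    (lowOrder g lam tau 3 0 v = ((1 - 4 * lam) / 16) • (v ([2, 0], 0, 1) - v ([2, 2], 1, 2) -
        v ([1, 0], 0, 2) - v ([1, 1], 1, 2)) - (g / 24) • ⁅v ([], 0, 1), v ([], 0, 2)⁆ +
      (tau / 2) • (v ([0, 0], 1, 2) + v ([1, 1], 1, 2) + v ([2, 2], 1, 2))) ∧
    (lowOrder g lam tau 3 1 v = ((1 - 4 * lam) / 16) • (v ([0, 0], 0, 2) + v ([0, 1], 1, 2) +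
        v ([2, 1], 0, 1) + v ([2, 2], 0, 2)) - (g / 24) • ⁅v ([], 0, 1), v ([], 1, 2)⁆ -
      (tau / 2) • (v ([0, 0], 0, 2) + v ([1, 1], 0, 2) + v ([2, 2], 0, 2))) ∧
    (lowOrder g lam tau 3 2 v = ((1 - 4 * lam) / 16) • (v ([0, 2], 1, 2) - v ([0, 0], 0, 1) -
        v ([1, 1], 0, 1) - v ([1, 2], 0, 2)) - (g / 24) • ⁅v ([], 0, 2), v ([], 1, 2)⁆ +
      (tau / 2) • (v ([0, 0], 0, 1) + v ([1, 1], 0, 1) + v ([2, 2], 0, 1))) := by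
  refine ⟨?_, ?_, ?_⟩ <;>
  · simp only [lowOrder, Fin.sum_univ_three, eps_same_left, eps_same_right, eps_same_outer,
      eps_zero_one_two, eps_one_two_zero, eps_two_zero_one, eps_zero_two_one, eps_two_one_zero,
      eps_one_zero_two, hv.same, hv _ 0 1, hv _ 0 2, hv _ 1 2, Ring.lie_def, mul_neg, neg_mul,
      mul_zero, zero_mul]
    module

/-- Order three, after an integration by parts in one of the terms. -/
lemma linearLagrangian_add_interaction_three (lam tau : ℝ) {v : Jets N} (hv : IsAntisymm v) :
    linearLagrangian (lowOrder g lam tau 3) v + 1 / 2 * ∑ μ, ∑ ν, ∑ ρ, eps μ ν ρ *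
      (retr (lowOrder g lam tau 1 μ v * tder ν (lowOrder g lam tau 2 ρ) v) +
        retr (-tder ν (lowOrder g lam tau 2 μ) v * lowOrder g lam tau 1 ρ v) +
        g / 3 * retr (lowOrder g lam tau 1 μ v *
          ⁅lowOrder g lam tau 1 ν v, lowOrder g lam tau 1 ρ v⁆)) = lowLagrangian lam tau 3 v := by
  obtain ⟨h0, h1, h2⟩ := lowOrder_three_eq (g := g) (lam := lam) (tau := tau) hv
  have h3 := lowOrder_one_eq (g := g) lam tau hv
  have h4 := fun σ => lowOrder_two_eq (g := g) lam tau (hv.shift σ)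
  rw [linearLagrangian, sum_eps_mul, sum_eps_mul]
  simp only [tder_lowOrder_two, h0, h1, h2, (h4 _).1, (h4 _).2.1, (h4 _).2.2, h3.1, h3.2.1, h3.2.2,
    shift_coord]
  simp only [lowLagrangian, Fin.sum_univ_three, hv.same, hv _ 0 1, hv _ 0 2, hv _ 1 2, add_mul,
    sub_mul, mul_add, mul_sub, smul_mul_assoc, mul_smul_comm, mul_neg, neg_mul, map_neg, map_add,
    map_sub, map_smul, smul_eq_mul, mul_zero, map_zero, Ring.lie_def, neg_add, neg_sub, smul_neg,
    mul_assoc]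
  have hc := fun (X Y : Mat N) => retr_mul_comm X Y
  simp only [hc (v ([0, _], _)), hc (v ([1, _], _)), hc (v ([2, _], _))]
  -- The cubic terms are multiples of `tr (F₀₁ F₀₂ F₁₂)` and `tr (F₀₁ F₁₂ F₀₂)`; one of the former
  -- appears rotated.
  have hcyc (X Y Z : Mat N) : retr (X * (Y * Z)) = retr (Z * (X * Y)) := by
    rw [← mul_assoc, retr_mul_comm]
  rw [hcyc (v ([], 0, 2)) (v ([], 1, 2)) (v ([], 0, 1))]
  ring

end OrderConditions

/-! ### From the low order identities to identities of actions -/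

section LowOrderActions

variable {𝔤 : LieSubalgebra ℝ (Mat N)} {g : ℝ} [LieAlgebra.IsSemisimple ℝ 𝔤] (lam tau : ℝ)

lemma isYMLagrangian_lowLagrangian (n : ℕ) :
    IsYMLagrangian 𝔤 (lowLagrangian (N := N) lam tau n) := by
  have hc := fun i j => IsCovariant.retr_mul (𝔤 := 𝔤) (IsCovariant.coord i) (IsCovariant.coord j)
  match n with
  | 0 => exact IsYMLagrangian.zero
  | 1 => exact IsYMLagrangian.const_mul _ <| IsYMLagrangian.sum _ fun μ _ =>
      IsYMLagrangian.sum _ fun ν _ => hc ([], μ, ν) ([], μ, ν)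
  | 2 => exact IsYMLagrangian.const_mul _ <| IsYMLagrangian.sum _ fun μ _ =>
      IsYMLagrangian.sum _ fun ν _ => IsYMLagrangian.sum _ fun ρ _ =>
        IsYMLagrangian.sum _ fun σ _ => (hc ([], μ, σ) ([ν], ρ, σ)).const_mul _
  | 3 => exact IsYMLagrangian.const_mul _ <| IsYMLagrangian.sum _ fun μ _ =>
      IsYMLagrangian.sum _ fun ν _ => IsYMLagrangian.sum _ fun σ _ =>
        hc ([], μ, ν) ([σ, σ], μ, ν)
  | n + 4 => exact IsYMLagrangian.zero

/-- Integrating `tr ε ϑ² D ϑ¹` by parts puts all derivatives on `ϑ²`, so that every quadratic term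
has the form `F D D F`, as in the linear term; the rest holds pointwise. -/
lemma actionEq_lowOrder_three :
    ActionEq 𝔤 g (fun v => linearLagrangian (lowOrder g lam tau 3) v +
      interactionLagrangian g (lowOrder g lam tau) 3 v) (lowLagrangian lam tau 3) := by
  have hc := fun (n : ℕ) (h1 : 1 ≤ n) (h3 : n ≤ 3) (μ : Fin 3) =>
    isCovariant_lowOrder (𝔤 := 𝔤) (g := g) lam tau h1 h3 μ
  have h1 := hc 1 le_rfl (by norm_num)
  have h2 := hc 2 (by norm_num) (by norm_num)
  have h3 := hc 3 (by norm_num) le_rfl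
  have ha (μ ν ρ : Fin 3) := (h2 μ).retr_mul ((h1 ρ).tder ν)
  have ha' (μ ν ρ : Fin 3) : IsYMLagrangian 𝔤 (fun v =>
      retr (-tder ν (lowOrder g lam tau 2 μ) v * lowOrder g lam tau 1 ρ v)) := by
    simpa only [neg_one_smul] using (((h2 μ).tder ν).smul (-1)).retr_mul (h1 ρ)
  have hr (μ ν ρ : Fin 3) : IsYMLagrangian 𝔤 (fun v =>
      retr (lowOrder g lam tau 1 μ v * tder ν (lowOrder g lam tau 2 ρ) v) +
        g / 3 * retr (lowOrder g lam tau 1 μ v *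
          ⁅lowOrder g lam tau 1 ν v, lowOrder g lam tau 1 ρ v⁆)) :=
    ((h1 μ).retr_mul ((h2 ρ).tder ν)).add (((h1 μ).retr_mul ((h1 ν).lie (h1 ρ))).const_mul _)
  have hl := isYMLagrangian_linearLagrangian h3
  have hs {q : Fin 3 → Fin 3 → Fin 3 → Jets N → ℝ} (hq : ∀ μ ν ρ, IsYMLagrangian 𝔤 (q μ ν ρ)) :
      IsYMLagrangian 𝔤 (fun v => 1 / 2 * ∑ μ, ∑ ν, ∑ ρ, eps μ ν ρ * q μ ν ρ v) :=
    IsYMLagrangian.const_mul _ <| IsYMLagrangian.sum _ fun μ _ => IsYMLagrangian.sum _ fun ν _ =>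
      IsYMLagrangian.sum _ fun ρ _ => (hq μ ν ρ).const_mul _
  have hparts : ActionEq 𝔤 g
      (fun v => 1 / 2 * ∑ μ, ∑ ν, ∑ ρ, eps μ ν ρ *
        retr (lowOrder g lam tau 2 μ v * tder ν (lowOrder g lam tau 1 ρ) v))
      (fun v => 1 / 2 * ∑ μ, ∑ ν, ∑ ρ, eps μ ν ρ *
        retr (-tder ν (lowOrder g lam tau 2 μ) v * lowOrder g lam tau 1 ρ v)) :=
    ActionEq.const_mul _ <| ActionEq.sum _ (fun μ _ => IsYMLagrangian.sum _ fun ν _ =>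
        IsYMLagrangian.sum _ fun ρ _ => (ha μ ν ρ).const_mul _)
      (fun μ _ => IsYMLagrangian.sum _ fun ν _ =>
        IsYMLagrangian.sum _ fun ρ _ => (ha' μ ν ρ).const_mul _) fun μ _ =>
      ActionEq.sum _ (fun ν _ => IsYMLagrangian.sum _ fun ρ _ => (ha μ ν ρ).const_mul _)
        (fun ν _ => IsYMLagrangian.sum _ fun ρ _ => (ha' μ ν ρ).const_mul _) fun ν _ =>
      ActionEq.sum _ (fun ρ _ => (ha μ ν ρ).const_mul _) (fun ρ _ => (ha' μ ν ρ).const_mul _)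
        fun ρ _ => ActionEq.const_mul _ (actionEq_integration_by_parts (h2 μ) (h1 ρ) ν)
  have h := ActionEq.add (hs ha) (hs ha') (hl.add (hs hr)) (hl.add (hs hr)) hparts fun _ _ => rfl
  refine (ActionEq.of_eqOn fun v _ => ?_).trans (h.trans (ActionEq.of_jet fun A _ x => ?_))
  · rw [interactionLagrangian_three]
    simp only [mul_add, Finset.sum_add_distrib]
    ring
  · rw [← linearLagrangian_add_interaction_three lam tau (IsAntisymm.jet (g := g) A x)]
    simp only [mul_add, Finset.sum_add_distrib]
    ring

lemma actionEq_lowOrder {n : ℕ} (hn : 1 ≤ n) (hn' : n ≤ 3) :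
    ActionEq 𝔤 g (fun v => linearLagrangian (lowOrder g lam tau n) v +
      interactionLagrangian g (lowOrder g lam tau) n v) (lowLagrangian lam tau n) := by
  interval_cases n
  · refine ActionEq.of_jet fun A _ x => ?_
    rw [interactionLagrangian_one, add_zero,
      linearLagrangian_lowOrder_one lam tau (IsAntisymm.jet A x)]
  · exact ActionEq.of_jet fun A _ x =>
      linearLagrangian_add_interaction_two lam tau (IsAntisymm.jet A x)
  · exact actionEq_lowOrder_three lam tau

omit [LieAlgebra.IsSemisimple ℝ 𝔤]
variable {A : VField N}

lemma trace_jet_mul_jet (h𝔤 : ∀ X ∈ 𝔤, Matrix.conjTranspose X = -X) (hA : IsGaugeField 𝔤 A)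
    (i j : JetIdx) (x : Space) : Matrix.trace (jet g A x i * jet g A x j) =
      (retr (jet g A x i * jet g A x j) : ℂ) :=
  trace_eq_retr (h𝔤 _ (inLie_jet hA.isSmoothField g x i)) (h𝔤 _ (inLie_jet hA.isSmoothField g x j))

lemma ymAction_eq (h𝔤 : ∀ X ∈ 𝔤, Matrix.conjTranspose X = -X) (hA : IsGaugeField 𝔤 A) :
    ymAction g A = ((∫ x, lowLagrangian lam tau 1 (jet g A x) : ℝ) : ℂ) := by
  have h (x : Space) : Matrix.trace (∑ μ, ∑ ν,
      fieldStrength g A μ ν x * fieldStrength g A μ ν x) =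
      ((∑ μ, ∑ ν, retr (jet g A x ([], μ, ν) * jet g A x ([], μ, ν)) : ℝ) : ℂ) := by
    push_cast
    simp only [← trace_jet_mul_jet h𝔤 hA, Matrix.trace_sum]
    rfl
  simp only [ymAction, h, lowLagrangian, integral_complex_ofReal, integral_const_mul]
  push_cast
  rfl

lemma fdfAction_eq (h𝔤 : ∀ X ∈ 𝔤, Matrix.conjTranspose X = -X) (hA : IsGaugeField 𝔤 A) :
    lam * fdfAction g A = ((∫ x, lowLagrangian lam tau 2 (jet g A x) : ℝ) : ℂ) := by
  have h (x : Space) : Matrix.trace (∑ μ, ∑ ν, ∑ ρ, ∑ σ, eps μ ν ρ •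
      (fieldStrength g A μ σ x * cov g A ν (fieldStrength g A ρ σ) x)) =
      ((∑ μ, ∑ ν, ∑ ρ, ∑ σ, eps μ ν ρ *
        retr (jet g A x ([], μ, σ) * jet g A x ([ν], ρ, σ)) : ℝ) : ℂ) := by
    push_cast
    simp only [← trace_jet_mul_jet h𝔤 hA, Matrix.trace_sum, Matrix.trace_smul, Complex.real_smul]
    rfl
  simp only [fdfAction, h, lowLagrangian, integral_complex_ofReal, integral_const_mul]
  push_cast
  ring

lemma fddfAction_eq (h𝔤 : ∀ X ∈ 𝔤, Matrix.conjTranspose X = -X) (hA : IsGaugeField 𝔤 A) :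
    tau * fddfAction g A = ((∫ x, lowLagrangian lam tau 3 (jet g A x) : ℝ) : ℂ) := by
  have h (x : Space) : Matrix.trace (∑ μ, ∑ ν,
      fieldStrength g A μ ν x * covLaplacian g A (fieldStrength g A μ ν) x) =
      ((∑ μ, ∑ ν, ∑ σ,
        retr (jet g A x ([], μ, ν) * jet g A x ([σ, σ], μ, ν)) : ℝ) : ℂ) := by
    push_cast
    simp only [← trace_jet_mul_jet h𝔤 hA, Matrix.trace_sum, covLaplacian, Finset.sum_apply,
      Finset.mul_sum]
    rfl
  simp only [fddfAction, h, lowLagrangian, integral_complex_ofReal, integral_const_mul]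
  push_cast
  ring

lemma ymTypeSeries_lowLagrangian (h𝔤 : ∀ X ∈ 𝔤, Matrix.conjTranspose X = -X)
    (hA : IsGaugeField 𝔤 A) : ymTypeSeries g (lowLagrangian lam tau) A =
      PowerSeries.C (csAction g A) + PowerSeries.monomial 1 (ymAction g A) +
        PowerSeries.monomial 2 (lam * fdfAction g A) +
        PowerSeries.monomial 3 (tau * fddfAction g A) := by
  rw [ymAction_eq lam tau h𝔤 hA, fdfAction_eq lam tau h𝔤 hA, fddfAction_eq lam tau h𝔤 hA]
  ext n
  simp only [ymTypeSeries, map_add, PowerSeries.coeff_mk, PowerSeries.coeff_monomial]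
  match n with
  | 0 => simp
  | 1 => simp
  | 2 => simp
  | 3 => simp
  | n + 4 => simp [lowLagrangian]

lemma IsPureChernSimons.congr {S S' : VField N → PowerSeries ℂ}
    {ϑ : ℕ → Fin 3 → Jets N → Mat N} (h : IsPureChernSimons 𝔤 g S ϑ)
    (hS : ∀ A, IsGaugeField 𝔤 A → S A = S' A) : IsPureChernSimons 𝔤 g S' ϑ :=
  ⟨h.covariant, h.connection, h.integrable, fun A hA =>
    (h.action_eq A hA).trans (hS _ ⟨fun μ => IsSchwartz.coe (A μ), hA⟩)⟩

/-- The redefinition for the action `S_CS + S_YM + S_λ + S_τ`, with its lowest orders. -/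
theorem exists_isPureChernSimons_lowOrder [LieAlgebra.IsSemisimple ℝ 𝔤]
    (h𝔤 : ∀ X ∈ 𝔤, Matrix.conjTranspose X = -X) (g : ℝ) :
    ∃ ϑ : ℕ → Fin 3 → Jets N → Mat N,
      IsPureChernSimons 𝔤 g (fun A => PowerSeries.C (csAction g A) +
        PowerSeries.monomial 1 (ymAction g A) + PowerSeries.monomial 2 (lam * fdfAction g A) +
        PowerSeries.monomial 3 (tau * fddfAction g A)) ϑ ∧
      (∀ n, 1 ≤ n → ∀ μ, HasMassDim 𝔤 (n + 1) (ϑ n μ)) ∧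
      ∀ n, 1 ≤ n → n ≤ 3 → ϑ n = lowOrder g lam tau n := by
  obtain ⟨ϑ, h1, h2, h3⟩ := exists_isPureChernSimons h𝔤 g
    (fun n _ => isYMLagrangian_lowLagrangian lam tau n) 3 (lowOrder g lam tau)
    fun n hn hn' => ⟨isCovariant_lowOrder lam tau hn hn', actionEq_lowOrder lam tau hn hn'⟩
  exact ⟨ϑ, h2.congr fun A hA => ymTypeSeries_lowLagrangian lam tau h𝔤 hA,
    h3 (fun n _ => hasMassDim_lowLagrangian lam tau n)
      fun n hn hn' => hasMassDim_lowOrder lam tau hn hn', h1⟩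

end LowOrderActions

end ChernSimons

end

/-! ### Assembly of the main theorem -/

theorem mainTheorem2 (N : ℕ) (𝔤 : LieSubalgebra ℝ (ChernSimons.Mat N))
    [LieAlgebra.IsSemisimple ℝ 𝔤] (h𝔤 : ∀ X ∈ 𝔤, Matrix.conjTranspose X = -X) (g : ℝ) :
    -- arbitrary Yang-Mills type actions
    (∀ P : ℕ → (ChernSimons.JetIdx → ChernSimons.Mat N) → ℝ,
      (∀ n, 1 ≤ n → ChernSimons.IsYMLagrangian 𝔤 (P n)) →
      (∀ n, 1 ≤ n → ∀ A : Fin 3 → 𝓢(ChernSimons.Space, ChernSimons.Mat N),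
        (∀ μ x, A μ x ∈ 𝔤) → Integrable fun x : ChernSimons.Space =>
          P n (ChernSimons.jet g (fun μ => ⇑(A μ)) x)) ∧
      ∃ ϑ : ℕ → Fin 3 → (ChernSimons.JetIdx → ChernSimons.Mat N) → ChernSimons.Mat N,
        ChernSimons.IsPureChernSimons 𝔤 g (ChernSimons.ymTypeSeries g P) ϑ ∧
        ((∀ n, 1 ≤ n → ChernSimons.HasMassDim 𝔤 (n + 3) (P n)) →
          ∀ n, 1 ≤ n → ∀ μ, ChernSimons.HasMassDim 𝔤 (n + 1) (ϑ n μ))) ∧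
    -- the action `S_CS + S_YM + S_λ`
    (∀ lam : ℝ,
      ∃ ϑ : ℕ → Fin 3 → (ChernSimons.JetIdx → ChernSimons.Mat N) → ChernSimons.Mat N,
        ChernSimons.IsPureChernSimons 𝔤 g
          (fun A => PowerSeries.C (ChernSimons.csAction g A) +
            PowerSeries.monomial 1 (ChernSimons.ymAction g A) +
            PowerSeries.monomial 2 ((lam : ℂ) * ChernSimons.fdfAction g A)) ϑ ∧
        (∀ n, 1 ≤ n → ∀ μ, ChernSimons.HasMassDim 𝔤 (n + 1) (ϑ n μ)) ∧
        ∀ A : ChernSimons.VField N, (∀ μ, ChernSimons.IsSmoothField 𝔤 (A μ)) →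
          ∀ (μ : Fin 3) (x : ChernSimons.Space),
          ϑ 1 μ (ChernSimons.jet g A x) =
            (1 / 4 : ℝ) • ∑ σ, ∑ τ, ChernSimons.eps μ σ τ •
              ChernSimons.fieldStrength g A σ τ x ∧
          ϑ 2 μ (ChernSimons.jet g A x) =
            ((1 - 4 * lam) / 8) •
              ∑ σ, ChernSimons.cov g A σ (ChernSimons.fieldStrength g A σ μ) x ∧
          ϑ 3 μ (ChernSimons.jet g A x) =
            -((1 - 4 * lam) / 16) • ∑ σ, ∑ τ, ∑ ρ, ChernSimons.eps μ σ τ •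
              ChernSimons.cov g A σ
                (ChernSimons.cov g A ρ (ChernSimons.fieldStrength g A ρ τ)) x +
            (g / 48) • ∑ σ, ∑ τ, ∑ ρ, ChernSimons.eps μ σ τ •
              ⁅ChernSimons.fieldStrength g A σ ρ x, ChernSimons.fieldStrength g A ρ τ x⁆) ∧
    -- the action `S_CS + S_YM + S_τ`
    (∀ tau : ℝ,
      ∃ ϑ : ℕ → Fin 3 → (ChernSimons.JetIdx → ChernSimons.Mat N) → ChernSimons.Mat N,
        ChernSimons.IsPureChernSimons 𝔤 g
          (fun A => PowerSeries.C (ChernSimons.csAction g A) +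
            PowerSeries.monomial 1 (ChernSimons.ymAction g A) +
            PowerSeries.monomial 3 ((tau : ℂ) * ChernSimons.fddfAction g A)) ϑ ∧
        (∀ n, 1 ≤ n → ∀ μ, ChernSimons.HasMassDim 𝔤 (n + 1) (ϑ n μ)) ∧
        ∀ A : ChernSimons.VField N, (∀ μ, ChernSimons.IsSmoothField 𝔤 (A μ)) →
          ∀ (μ : Fin 3) (x : ChernSimons.Space),
          ϑ 1 μ (ChernSimons.jet g A x) =
            (1 / 4 : ℝ) • ∑ σ, ∑ τ, ChernSimons.eps μ σ τ •
              ChernSimons.fieldStrength g A σ τ x ∧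
          ϑ 2 μ (ChernSimons.jet g A x) =
            (1 / 8 : ℝ) •
              ∑ σ, ChernSimons.cov g A σ (ChernSimons.fieldStrength g A σ μ) x ∧
          ϑ 3 μ (ChernSimons.jet g A x) =
            -(1 / 16 : ℝ) • ∑ σ, ∑ τ, ∑ ρ, ChernSimons.eps μ σ τ •
              ChernSimons.cov g A σ
                (ChernSimons.cov g A ρ (ChernSimons.fieldStrength g A ρ τ)) x +
            (g / 48) • ∑ σ, ∑ τ, ∑ ρ, ChernSimons.eps μ σ τ •
              ⁅ChernSimons.fieldStrength g A σ ρ x, ChernSimons.fieldStrength g A ρ τ x⁆ +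
            (tau / 4) • ∑ ν, ∑ ρ, ChernSimons.eps μ ν ρ •
              ChernSimons.covLaplacian g A (ChernSimons.fieldStrength g A ν ρ) x) := by
  refine ⟨fun P hP => ⟨fun n hn A hA => (hP n hn).integrable
    ⟨fun μ => ChernSimons.IsSchwartz.coe (A μ), hA⟩, ?_⟩, fun lam => ?_, fun tau => ?_⟩
  -- With `K = 0` no order `n ≥ 1` is prescribed, so the conditions on `φ` are vacuous.
  · obtain ⟨ϑ, -, h, hdim⟩ := ChernSimons.exists_isPureChernSimons h𝔤 g hP 0 (fun _ _ _ => 0)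
      fun n hn hn' => absurd hn (by omega)
    exact ⟨ϑ, h, fun h' => hdim h' fun n hn hn' => absurd hn (by omega)⟩
  -- The two explicit families are the cases `τ = 0` and `λ = 0` of one construction.
  · obtain ⟨ϑ, h, hdim, hlow⟩ := ChernSimons.exists_isPureChernSimons_lowOrder lam 0 h𝔤 g
    refine ⟨ϑ, by simpa using h, hdim, fun A _ μ x => ?_⟩
    rw [hlow 1 le_rfl (by norm_num), hlow 2 (by norm_num) (by norm_num), hlow 3 (by norm_num) le_rfl]
    refine ⟨rfl, rfl, ?_⟩
    simp only [ChernSimons.lowOrder, zero_div, zero_smul, add_zero]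
    rfl
  · obtain ⟨ϑ, h, hdim, hlow⟩ := ChernSimons.exists_isPureChernSimons_lowOrder 0 tau h𝔤 g
    refine ⟨ϑ, by simpa using h, hdim, fun A _ μ x => ?_⟩
    rw [hlow 1 le_rfl (by norm_num), hlow 2 (by norm_num) (by norm_num), hlow 3 (by norm_num) le_rfl]
    refine ⟨rfl, ?_, ?_⟩
    · simp only [ChernSimons.lowOrder, mul_zero, sub_zero]
      rfl
    · simp only [ChernSimons.lowOrder, mul_zero, sub_zero, ChernSimons.covLaplacian,
        Finset.sum_apply]
      rfl
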